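/- Let $U\subseteq\mathbb R^4$ be open (a coordinate patch) and let $g$ be a smooth Lorentzian metric on $U$, of signature $(+,-,-,-)$ (put $\varsigma=-1$) or $(-,+,+,+)$ (put $\varsigma=1$). A null tetrad on $U$ consists of smooth vector fields $\ell,n$ (real), $m$ (complex) and $\bar m$ whose only non-zero scalar products are $\ell\cdot n=1$ and $m\cdot\bar m=\varsigma$. It is a *kinematic frame* if on $U$ $$\kappa=\ell_{a;b}m^a\ell^b=0,\quad \sigma=\ell_{a;b}m^am^b=0,\quad \rho=\ell_{a;b}m^a\bar m^b=0,\quad \epsilon=\tfrac12(\ell_{a;b}n^a\ell^b-m_{a;b}\bar m^a\ell^b)=0 .$$ The component $T(e_{A_1},\dots,e_{A_k})$ of a covariant tensor in the tetrad has boost weight equal to the number of arguments $\ell$ minus the number of arguments $n$; $T$ is of type II (or less) in the frame if all its components of positive boost weight vanish on $U$. For $n\ge0$ let $K_n$ be the class of metrics $g$ on $U$ for which there is a kinematic frame on $U$ in which the Riemann tensor and its covariant derivatives $\nabla^k(\mathrm{Riem})$, $k\le n$, are of type II or less. **Theorem.** (1) If $g\in K_1$, then $g\in K_n$ for all $n\ge2$.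 (2) More precisely, if $\mathrm{Riem}$ and $\nabla(\mathrm{Riem})$ are of type II or less in a given kinematic frame of $g$, then so is $\nabla^n(\mathrm{Riem})$, in the same frame, for every $n\ge0$. (3) Let $g$ be a Kundt metric $$ds^2=2\,du\,(dv+H\,du+W_i\,dx^i)+g_{ij}\,dx^i dx^j\qquad(i,j=2,3)$$ on $U$, with coordinates $(u,v,x^2,x^3)$ and smooth real functions $H,W_i,g_{ij}$, where $\partial_v g_{ij}=0$ and $\varsigma\,(g_{ij})$ is symmetric and positive definite. Then $g$ is a Lorentzian metric of the signature belonging to $\varsigma$ and has a kinematic frame on $U$ with $\ell=\partial_v$ (that is, $\ell_a dx^a=du$). In every kinematic frame on $U$ with $\ell=\partial_v$, the tensors $\mathrm{Riem}$ and $\nabla(\mathrm{Riem})$ are both of type II or less if and only if $W_{i,vv}=0$ for $i=2,3$ and $H_{,vvv}=0$ on $U$; and in that case $\nabla^n(\mathrm{Riem})$ is of type II or less in that frame for every $n\ge0$. -/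

import Mathlib

open scoped BigOperators Matrix ContDiff

noncomputable section

namespace Kundt

/-- Points of a four-dimensional coordinate patch. -/
abbrev Coord : Type := Fin 4 → ℝ

/-- The field of matrices `g_{ab}` of a metric in the coordinates. -/
abbrev MetricField : Type := Coord → Matrix (Fin 4) (Fin 4) ℝ

/-- Components `T_{a₁ ⋯ a_k}` of a covariant tensor field of rank `k`, with values in `V` (real or
complex numbers below). -/
abbrev CovTensor (V : Type) (k : ℕ) : Type := Coord → (Fin k → Fin 4) → V

/-- The partial derivative `∂_a f`. -/
def pd {V : Type} [NormedAddCommGroup V] [NormedSpace ℝ V] (a : Fin 4) (f : Coord → V)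
    (x : Coord) : V :=
  fderiv ℝ f x (Pi.single a 1)

/-- A smooth metric of Lorentzian signature on `U`: `ς = -1` is the convention `(+,-,-,-)` and
`ς = 1` is the convention `(-,+,+,+)`. -/
structure IsLorentzMetric (ς : ℝ) (U : Set Coord) (g : MetricField) : Prop where
  smooth : ∀ a b, ContDiffOn ℝ ∞ (fun x => g x a b) U
  symm : ∀ x ∈ U, (g x).IsSymm
  signature : ∀ x ∈ U, ∃ P : Matrix (Fin 4) (Fin 4) ℝ,
    IsUnit P.det ∧ Pᵀ * g x * P = ς • Matrix.diagonal ![-1, 1, 1, 1]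

/-- The Christoffel symbols `Γ^c_{ab}` of the Levi-Civita connection. -/
def christoffel (g : MetricField) (c a b : Fin 4) (x : Coord) : ℝ :=
  (1 / 2) * ∑ d, (g x)⁻¹ c d *
    (pd a (fun y => g y d b) x + pd b (fun y => g y d a) x - pd d (fun y => g y a b) x)

/-- The covariant derivative `T_{a₁ ⋯ a_k ; b} = ∂_b T_{a₁ ⋯ a_k} - ∑ᵢ Γ^c_{b aᵢ} T_{a₁ ⋯ c ⋯ a_k}`;
the index of differentiation is the last one. -/
def covD {V : Type} [NormedAddCommGroup V] [NormedSpace ℝ V] (g : MetricField) {k : ℕ}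
    (T : CovTensor V k) : CovTensor V (k + 1) := fun x a =>
  pd (a (Fin.last k)) (fun y => T y (Fin.init a)) x -
    ∑ i : Fin k, ∑ c : Fin 4,
      christoffel g c (a (Fin.last k)) (Fin.init a i) x • T x (Function.update (Fin.init a) i c)

/-- The curvature `R^a_{bcd} = ∂_c Γ^a_{db} - ∂_d Γ^a_{cb} + Γ^a_{ce} Γ^e_{db} - Γ^a_{de} Γ^e_{cb}`. -/
def riemannUp (g : MetricField) (a b c d : Fin 4) (x : Coord) : ℝ :=
  pd c (christoffel g a d b) x - pd d (christoffel g a c b) x +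
    ∑ e, (christoffel g a c e x * christoffel g e d b x -
      christoffel g a d e x * christoffel g e c b x)

/-- The Riemann tensor `R_{abcd} = g_{ae} R^e_{bcd}`. -/
def riemann (g : MetricField) : CovTensor ℝ 4 := fun x i =>
  ∑ e, g x (i 0) e * riemannUp g e (i 1) (i 2) (i 3) x

/-- The `n`-th covariant derivative of the Riemann tensor, `∇ⁿ(Riem)`. -/
def nablaRiem (g : MetricField) : (n : ℕ) → CovTensor ℝ (4 + n)
  | 0 => riemann g
  | n + 1 => covD g (nablaRiem g n)

/-- The vector fields `ℓ, n` (real) and `m` (complex) of a Newman-Penrose tetrad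
`{ℓ, n, m, m̄}`, by their contravariant components. -/
structure Tetrad where
  l : Coord → Fin 4 → ℝ
  n : Coord → Fin 4 → ℝ
  m : Coord → Fin 4 → ℂ

/-- The members of the tetrad as complex vector fields:
`e₀ = ℓ`, `e₁ = n`, `e₂ = m`, `e₃ = m̄`. -/
def Tetrad.e (F : Tetrad) : Fin 4 → Coord → Fin 4 → ℂ :=
  ![fun x a => (F.l x a : ℂ), fun x a => (F.n x a : ℂ), F.m, fun x a => star (F.m x a)]

/-- The covariant components `(e_A)_a = g_{ab} (e_A)^b` of a tetrad member. -/
def Tetrad.low (F : Tetrad) (g : MetricField) (A : Fin 4) : CovTensor ℂ 1 := fun x a =>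
  ∑ b, (g x (a 0) b : ℂ) * F.e A x b

/-- The scalar product `g(e_A, e_B)`, complex bilinear. -/
def Tetrad.dot (F : Tetrad) (g : MetricField) (A B : Fin 4) (x : Coord) : ℂ :=
  ∑ a, ∑ b, (g x a b : ℂ) * F.e A x a * F.e B x b

/-- A smooth null tetrad on `U`: the only non-zero products are `ℓ·n = 1` and `m·m̄ = ς`. -/
structure IsNullTetrad (ς : ℝ) (U : Set Coord) (g : MetricField) (F : Tetrad) : Prop where
  smooth_l : ContDiffOn ℝ ∞ F.l U
  smooth_n : ContDiffOn ℝ ∞ F.n U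
  smooth_m : ContDiffOn ℝ ∞ F.m U
  dot_ll : ∀ x ∈ U, F.dot g 0 0 x = 0
  dot_ln : ∀ x ∈ U, F.dot g 0 1 x = 1
  dot_lm : ∀ x ∈ U, F.dot g 0 2 x = 0
  dot_nn : ∀ x ∈ U, F.dot g 1 1 x = 0
  dot_nm : ∀ x ∈ U, F.dot g 1 2 x = 0
  dot_mm : ∀ x ∈ U, F.dot g 2 2 x = 0
  dot_mmbar : ∀ x ∈ U, F.dot g 2 3 x = (ς : ℂ)

/-- The rotation coefficient `(e_A)_{a;b} (e_B)^a (e_C)^b`. -/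
def rot (g : MetricField) (F : Tetrad) (A B C : Fin 4) (x : Coord) : ℂ :=
  ∑ a, ∑ b, covD g (F.low g A) x ![a, b] * F.e B x a * F.e C x b

/-- The spin coefficient `κ = ℓ_{a;b} m^a ℓ^b`. -/
def kappa (g : MetricField) (F : Tetrad) (x : Coord) : ℂ := rot g F 0 2 0 x

/-- The spin coefficient `σ = ℓ_{a;b} m^a m^b`. -/
def sigma (g : MetricField) (F : Tetrad) (x : Coord) : ℂ := rot g F 0 2 2 x

/-- The spin coefficient `ρ = ℓ_{a;b} m^a m̄^b`. -/
def rho (g : MetricField) (F : Tetrad) (x : Coord) : ℂ := rot g F 0 2 3 x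

/-- The spin coefficient `ε = (ℓ_{a;b} n^a ℓ^b - m_{a;b} m̄^a ℓ^b) / 2`. -/
def epsilon (g : MetricField) (F : Tetrad) (x : Coord) : ℂ :=
  (rot g F 0 1 0 x - rot g F 2 3 0 x) / 2

/-- A kinematic frame on `U`: a null tetrad with `κ = σ = ρ = ε = 0`. -/
structure IsKinematicFrame (ς : ℝ) (U : Set Coord) (g : MetricField) (F : Tetrad) : Prop where
  null : IsNullTetrad ς U g F
  kappa_eq : ∀ x ∈ U, kappa g F x = 0
  sigma_eq : ∀ x ∈ U, sigma g F x = 0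
  rho_eq : ∀ x ∈ U, rho g F x = 0
  epsilon_eq : ∀ x ∈ U, epsilon g F x = 0

/-- The tetrad component `T(e_{A₁}, …, e_{A_k})` of a tensor field. -/
def component (F : Tetrad) {k : ℕ} (T : CovTensor ℝ k) (A : Fin k → Fin 4) (x : Coord) : ℂ :=
  ∑ b : Fin k → Fin 4, (T x b : ℂ) * ∏ i, F.e (A i) x (b i)

/-- The boost weight of a covariant index: `+1` for `ℓ`, `-1` for `n`, `0` for `m` and `m̄`. -/
def boostWeight : Fin 4 → ℤ := ![1, -1, 0, 0]

/-- The tensor field is of type II or less in the frame `F` on `U`: all its components of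
positive boost weight vanish. -/
def TypeII (U : Set Coord) (F : Tetrad) {k : ℕ} (T : CovTensor ℝ k) : Prop :=
  ∀ A : Fin k → Fin 4, 0 < ∑ i, boostWeight (A i) → ∀ x ∈ U, component F T A x = 0

/-- The class `K_n`: there is a kinematic frame in which the Riemann tensor and its covariant
derivatives up to order `n` have no components of positive boost weight. -/
def InK (ς : ℝ) (U : Set Coord) (g : MetricField) (n : ℕ) : Prop :=
  ∃ F : Tetrad, IsKinematicFrame ς U g F ∧ ∀ k ≤ n, TypeII U F (nablaRiem g k)

/-- The line element `2 du (dv + H du + W_i dx^i) + h_{ij} dx^i dx^j` in the coordinates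
`(u, v, x², x³)`, which have the indices `0, 1, 2, 3`. -/
def kundtMetric (H : Coord → ℝ) (W : Fin 2 → Coord → ℝ)
    (h : Coord → Matrix (Fin 2) (Fin 2) ℝ) : MetricField := fun x =>
  !![2 * H x, 1, W 0 x, W 1 x;
     1,       0, 0,     0;
     W 0 x,   0, h x 0 0, h x 0 1;
     W 1 x,   0, h x 1 0, h x 1 1]

/-- Admissible functions in the Kundt line element on `U`: smooth, with a definite transverse
metric `h_{ij}(u, x^k)`, of the sign that belongs to `ς`, that does not depend on `v`. -/
structure IsKundtData (ς : ℝ) (U : Set Coord) (H : Coord → ℝ) (W : Fin 2 → Coord → ℝ)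
    (h : Coord → Matrix (Fin 2) (Fin 2) ℝ) : Prop where
  smooth_H : ContDiffOn ℝ ∞ H U
  smooth_W : ∀ i, ContDiffOn ℝ ∞ (W i) U
  smooth_h : ∀ i j, ContDiffOn ℝ ∞ (fun x => h x i j) U
  definite : ∀ x ∈ U, (ς • h x).PosDef
  h_v : ∀ i j, ∀ x ∈ U, pd 1 (fun y => h y i j) x = 0

/-- The conditions `W_{i,vv} = 0` and `H_{,vvv} = 0` on `U`. -/
def DegenerateData (U : Set Coord) (H : Coord → ℝ) (W : Fin 2 → Coord → ℝ) : Prop :=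
  (∀ i, ∀ x ∈ U, pd 1 (pd 1 (W i)) x = 0) ∧ ∀ x ∈ U, pd 1 (pd 1 (pd 1 H)) x = 0

/-- The vector field of the frame that is called `ℓ` is `∂/∂v` on `U`, that is,
`ℓ_a dx^a = du` for the Kundt line element. -/
def Tetrad.AlignedWithV (F : Tetrad) (U : Set Coord) : Prop :=
  ∀ x ∈ U, F.l x = Pi.single 1 1

end Kundt

end

set_option linter.unusedSectionVars false

/-! Call the order of a tensor the largest boost weight of a non-zero frame component, so that type
II means order at most 0. In a kinematic frame the connection has no coefficient of positive boost
weight. Hence `D = ∇_ℓ` does not raise the order, and derivatives along `n, m, m̄` are harmless: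
`∇T` has order at most `t` as soon as `T` has order at most `t` and `DT` has order at most `t - 1`
(`ord_nabla`). That condition on `DT` has to survive further differentiation, so the whole chain
"`D^j T` has order at most `t - j` for `j ≤ J`" is carried along; this is `Fil`. Commuting `D` past
`∇` (`nab_nabla`) only produces contractions with `∇ℓ` and with `R(ℓ, ·)`. Both have order -1 and
chains of their own, the one for `∇ℓ` by the Riccati equation `D∇ℓ = R(ℓ, ·)ℓ - (∇ℓ)²`
(`nabL_gradL`). So `∇` turns a chain of length `J + 1` into one of length `J` and the same order
(`fil_nabla`), and it remains to show that `D^j Riem` has order at most `-j` for every `j`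
(`fil_riem`). This is an induction on `j` through the second Bianchi identity `D R_{abcd} = ∇_c
R_{abℓd} - ∇_d R_{abℓc}`. The tensor `R_{abℓd}` has order -1, and if `c, d ≠ ℓ` the outer derivative
is not along `ℓ`, so no member of the chain is lost (`ord_iterate_succ`). The symmetries of the
curvature leave only the components `ℓbℓd`. Their boost weight is never negative, so they vanish for
all `D^j Riem`, `j ≥ 1`, once `D Riem` has order at most -1, which is what type II of `∇Riem` gives.
For the Kundt line element, the frame formula for the curvature removes every component of positive
weight except `R_{ℓnℓm}` and its conjugate (`ord_riem`). After that only `D R_{ℓnℓn}` obstructs type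
II of `∇Riem` (`ord_nabla_riem`). In coordinates `2 R_{ivvu} = ∂_v² g_{ui}`, and if these vanish
then `2 ∂_v R_{uvvu} = ∂_v³ g_{uu}`; `kundt_iff` translates between the two descriptions. The
argument is algebraic, over a commutative `ℝ`-algebra with derivations. It is applied to the smooth
complex functions on `U`, complex because `m` is. -/

namespace Kundt

/-! ### Endomorphisms and derivations acting on tensor components. -/

section TensorAlgebra

variable {R ι : Type*} [CommRing R] [Algebra ℝ R] [Fintype ι] [DecidableEq ι] {k : ℕ}

/-- The action of an endomorphism on all indices of a covariant tensor. -/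
def act (B : Matrix ι ι R) (T : (Fin k → ι) → R) : (Fin k → ι) → R := fun A =>
  ∑ i, ∑ E, B (A i) E * T (Function.update A i E)

/-- The covariant derivative of the components along one derivation `d` with connection matrix
`B`. -/
def nab (d : Derivation ℝ R R) (B : Matrix ι ι R) (T : (Fin k → ι) → R) : (Fin k → ι) → R :=
  fun A => d (T A) - act B T A

lemma nab_apply (d : Derivation ℝ R R) (B : Matrix ι ι R) (T : (Fin k → ι) → R) (A : Fin k → ι) :
    nab d B T A = d (T A) - act B T A := rfl

/-- The covariant derivative; the index of differentiation is the last one. -/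
def nabla (e : ι → Derivation ℝ R R) (γ : ι → Matrix ι ι R) (T : (Fin k → ι) → R) :
    (Fin (k + 1) → ι) → R :=
  fun A => nab (e (A (Fin.last k))) (γ (A (Fin.last k))) T (Fin.init A)

/-- The components of a tensor in the frame `E`. -/
def trans (E : Matrix ι ι R) (T : (Fin k → ι) → R) : (Fin k → ι) → R := fun A =>
  ∑ b : Fin k → ι, T b * ∏ i, E (A i) (b i)

lemma act_add_right (B : Matrix ι ι R) (T T' : (Fin k → ι) → R) :
    act B (T + T') = act B T + act B T' := by
  ext A; simp [act, mul_add, Finset.sum_add_distrib]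

lemma act_sub_right (B : Matrix ι ι R) (T T' : (Fin k → ι) → R) :
    act B (T - T') = act B T - act B T' := by
  ext A; simp [act, mul_sub, Finset.sum_sub_distrib]

lemma act_add_left (B B' : Matrix ι ι R) (T : (Fin k → ι) → R) :
    act (B + B') T = act B T + act B' T := by
  ext A; simp [act, add_mul, Finset.sum_add_distrib]

lemma act_sub_left (B B' : Matrix ι ι R) (T : (Fin k → ι) → R) :
    act (B - B') T = act B T - act B' T := by
  ext A; simp [act, sub_mul, Finset.sum_sub_distrib]

lemma act_smul_left (r : R) (B : Matrix ι ι R) (T : (Fin k → ι) → R) :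
    act (r • B) T = r • act B T := by
  ext A; simp [act, Finset.mul_sum, mul_assoc]

lemma act_zero_left (T : (Fin k → ι) → R) : act (0 : Matrix ι ι R) T = 0 := by
  ext A; simp [act]

lemma act_sum_left {κ : Type*} (s : Finset κ) (B : κ → Matrix ι ι R) (T : (Fin k → ι) → R) :
    act (∑ x ∈ s, B x) T = ∑ x ∈ s, act (B x) T := by
  classical
  induction s using Finset.induction_on with
  | empty => simp [act_zero_left]
  | insert a s ha ih => rw [Finset.sum_insert ha, Finset.sum_insert ha, act_add_left, ih]

/-- Entrywise application of a derivation to a matrix. -/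
def dm (d : Derivation ℝ R R) (M : Matrix ι ι R) : Matrix ι ι R := M.map d

@[simp] lemma dm_apply (d : Derivation ℝ R R) (M : Matrix ι ι R) (a b : ι) :
    dm d M a b = d (M a b) := rfl

lemma dm_mul (d : Derivation ℝ R R) (M N : Matrix ι ι R) :
    dm d (M * N) = dm d M * N + M * dm d N := by
  ext a b
  simp only [dm_apply, Matrix.mul_apply, map_sum, Derivation.leibniz, smul_eq_mul,
    Matrix.add_apply, ← Finset.sum_add_distrib]
  exact Finset.sum_congr rfl fun c _ => by ring

lemma dm_add (d : Derivation ℝ R R) (M N : Matrix ι ι R) : dm d (M + N) = dm d M + dm d N := by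
  ext a b; simp

lemma dm_sub (d : Derivation ℝ R R) (M N : Matrix ι ι R) : dm d (M - N) = dm d M - dm d N := by
  ext a b; simp

lemma dm_smul (d : Derivation ℝ R R) (r : R) (M : Matrix ι ι R) :
    dm d (r • M) = d r • M + r • dm d M := by
  ext a b; simp [mul_comm, add_comm]

lemma dm_transpose (d : Derivation ℝ R R) (M : Matrix ι ι R) : dm d Mᵀ = (dm d M)ᵀ := by
  ext a b; simp

lemma dm_sum {κ : Type*} (d : Derivation ℝ R R) (s : Finset κ) (M : κ → Matrix ι ι R) :
    dm d (∑ x ∈ s, M x) = ∑ x ∈ s, dm d (M x) := by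
  ext a b; simp [Matrix.sum_apply]

lemma deriv_act (d : Derivation ℝ R R) (B : Matrix ι ι R) (T : (Fin k → ι) → R) (A : Fin k → ι) :
    d (act B T A) = act (dm d B) T A + act B (fun A' => d (T A')) A := by
  simp only [act, map_sum, Derivation.leibniz, smul_eq_mul, dm_apply, ← Finset.sum_add_distrib]
  exact Finset.sum_congr rfl fun i _ => Finset.sum_congr rfl fun E _ => by ring

/-- On a common slot the two endomorphisms compose; on distinct slots they act independently. The
second kind of term is isolated because it is symmetric in the two actions and disappears from the
commutator. -/
lemma act_act (B B' : Matrix ι ι R) (T : (Fin k → ι) → R) (A : Fin k → ι) :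
    act B (act B' T) A = act (B * B') T A + ∑ i, ∑ j, if j = i then 0 else
      ∑ E, ∑ G, B (A i) E * B' (A j) G * T (Function.update (Function.update A i E) j G) := by
  simp only [act, ← Finset.sum_add_distrib]
  refine Finset.sum_congr rfl fun i _ => ?_
  have h1 : ∀ E, ∑ j, ∑ G, B' (Function.update A i E j) G *
        T (Function.update (Function.update A i E) j G) =
      (∑ G, B' E G * T (Function.update A i G)) + ∑ j, if j = i then 0 else
        ∑ G, B' (A j) G * T (Function.update (Function.update A i E) j G) := by
    intro E
    rw [← Finset.add_sum_erase _ _ (Finset.mem_univ i)]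
    congr 1
    · simp
    · rw [← Finset.add_sum_erase (a := i) (f := fun j => if j = i then (0 : R) else _) _ (Finset.mem_univ i)]
      simp only [if_true, zero_add]
      refine Finset.sum_congr rfl fun j hj => ?_
      have hj' := Finset.ne_of_mem_erase hj
      simp [hj']
  simp only [h1, mul_add, Finset.sum_add_distrib]
  congr 1
  · simp only [Matrix.mul_apply, Finset.mul_sum, Finset.sum_mul]
    rw [Finset.sum_comm]
    exact Finset.sum_congr rfl fun G _ => Finset.sum_congr rfl fun E _ => by ring
  · simp only [Finset.mul_sum]
    rw [Finset.sum_comm]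
    refine Finset.sum_congr rfl fun j _ => ?_
    split_ifs
    · simp
    · exact Finset.sum_congr rfl fun E _ => by
        rw [Finset.mul_sum]; exact Finset.sum_congr rfl fun G _ => by ring

/-- The action on tensors is a representation of the Lie algebra of matrices: the terms on distinct
slots agree after the two slots are renamed, and only the matrix commutator is left. -/
lemma act_comm (B B' : Matrix ι ι R) (T : (Fin k → ι) → R) :
    act B (act B' T) - act B' (act B T) = act (B * B' - B' * B) T := by
  ext A
  rw [act_sub_left, Pi.sub_apply, Pi.sub_apply, act_act, act_act]
  have : (∑ i, ∑ j, if j = i then 0 else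
      ∑ E, ∑ G, B (A i) E * B' (A j) G * T (Function.update (Function.update A i E) j G)) =
    (∑ i, ∑ j, if j = i then 0 else
      ∑ E, ∑ G, B' (A i) E * B (A j) G * T (Function.update (Function.update A i E) j G)) := by
    rw [Finset.sum_comm]
    refine Finset.sum_congr rfl fun i _ => Finset.sum_congr rfl fun j _ => ?_
    by_cases h : j = i
    · simp [h]
    · rw [if_neg h, if_neg (Ne.symm h), Finset.sum_comm]
      refine Finset.sum_congr rfl fun E _ => Finset.sum_congr rfl fun G _ => ?_
      rw [Function.update_comm h, mul_comm (B _ _)]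
  rw [this]; ring

/-- Reindexing the slots commutes with the action. -/
lemma act_perm (σ : Equiv.Perm (Fin k)) (B : Matrix ι ι R) (T : (Fin k → ι) → R) (A : Fin k → ι) :
    act B (fun A' => T (A' ∘ σ)) A = act B T (A ∘ σ) := by
  unfold act
  refine Fintype.sum_equiv σ.symm _ _ fun i => Finset.sum_congr rfl fun E _ => ?_
  simp only [Function.comp_apply, Equiv.apply_symm_apply]
  congr 2
  rw [Function.update_comp_equiv]

lemma nab_perm (σ : Equiv.Perm (Fin k)) (d : Derivation ℝ R R) (B : Matrix ι ι R)
    (T : (Fin k → ι) → R) (A : Fin k → ι) :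
    nab d B (fun A' => T (A' ∘ σ)) A = nab d B T (A ∘ σ) := by
  simp only [nab, act_perm]

/-- Splits off the last slot, which is the index of differentiation in `nabla`; this is how that
index is treated separately throughout. -/
lemma act_snoc (B : Matrix ι ι R) (T : (Fin (k + 1) → ι) → R) (A : Fin k → ι) (C : ι) :
    act B T (Fin.snoc A C) = act B (fun A' => T (Fin.snoc A' C)) A +
      ∑ E, B C E * T (Fin.snoc A E) := by
  simp only [act, Fin.sum_univ_castSucc, Fin.snoc_castSucc, Fin.snoc_last, Fin.snoc_update,
    Fin.update_snoc_last]

lemma nab_add (d : Derivation ℝ R R) (B : Matrix ι ι R) (T T' : (Fin k → ι) → R) :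
    nab d B (T + T') = nab d B T + nab d B T' := by
  ext A; simp only [nab, act_add_right, Pi.add_apply, map_add]; ring

lemma nab_sub (d : Derivation ℝ R R) (B : Matrix ι ι R) (T T' : (Fin k → ι) → R) :
    nab d B (T - T') = nab d B T - nab d B T' := by
  ext A; simp only [nab, act_sub_right, Pi.sub_apply, map_sub]; ring

lemma nabla_snoc (e : ι → Derivation ℝ R R) (γ : ι → Matrix ι ι R) (T : (Fin k → ι) → R)
    (A : Fin k → ι) (C : ι) : nabla e γ T (Fin.snoc A C) = nab (e C) (γ C) T A := by
  simp [nabla]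

/-- Leibniz rule for the action: by `act_comm`, the covariant derivative of an endomorphism is its
entrywise derivative minus its commutator with the connection. -/
lemma nab_act (d : Derivation ℝ R R) (γ B : Matrix ι ι R) (T : (Fin k → ι) → R) :
    nab d γ (act B T) = act (dm d B - (γ * B - B * γ)) T + act B (nab d γ T) := by
  have h := act_comm γ B T
  have h2 : act B (nab d γ T) = act B (fun A' => d (T A')) - act B (act γ T) := by
    rw [← act_sub_right]; rfl
  ext A
  have h' := congrFun h A
  simp only [Pi.sub_apply] at h'
  rw [h2, act_sub_left]
  simp only [nab, deriv_act, Pi.sub_apply, Pi.add_apply, ← h']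
  ring

lemma prod_update_eq (f : Fin k → R) (i : Fin k) (x : R) :
    ∏ j, Function.update f i x j = x * ∏ j ∈ Finset.univ.erase i, f j := by
  rw [Finset.prod_update_of_mem (Finset.mem_univ i), Finset.sdiff_singleton_eq_erase]

lemma deriv_prod (d : Derivation ℝ R R) (f : Fin k → R) :
    d (∏ i, f i) = ∑ i, ∏ j, Function.update f i (d (f i)) j := by
  simp only [prod_update_eq]
  induction (Finset.univ : Finset (Fin k)) using Finset.induction_on with
  | empty => simp
  | insert a s ha ih =>
    rw [Finset.prod_insert ha, Derivation.leibniz, ih, Finset.sum_insert ha,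
      Finset.erase_insert ha, smul_eq_mul, smul_eq_mul, add_comm, mul_comm, Finset.mul_sum]
    congr 1
    refine Finset.sum_congr rfl fun i hi => ?_
    have hia : a ≠ i := fun h => ha (h ▸ hi)
    rw [Finset.erase_insert_of_ne hia, Finset.prod_insert (by simp [ha])]
    ring

/-- Exchanging the `i`-th entry of `b` with the free index `c` is an involution of the pairs `(b,
c)`. It moves a contraction from the tensor to the frame vectors. -/
lemma sum_update_swap {M : Type*} [AddCommMonoid M] (i : Fin k) (f : (Fin k → ι) → ι → M) :
    ∑ b : Fin k → ι, ∑ c, f b c = ∑ b : Fin k → ι, ∑ c, f (Function.update b i c) (b i) := by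
  rw [← Fintype.sum_prod_type', ← Fintype.sum_prod_type']
  refine Finset.sum_nbij' (fun p => (Function.update p.1 i p.2, p.1 i))
    (fun p => (Function.update p.1 i p.2, p.1 i)) ?_ ?_ ?_ ?_ ?_ <;> simp

/-- The covariant derivative does not depend on the frame. -/
lemma nab_trans (d : Derivation ℝ R R) (γ Γ E : Matrix ι ι R)
    (hE : dm d E = γ * E - E * Γ) (T : (Fin k → ι) → R) :
    nab d γ (trans E T) = trans E (nab d Γ T) := by
  ext A
  have h1 : d (trans E T A) = (∑ b : Fin k → ι, d (T b) * ∏ i, E (A i) (b i)) +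
      ∑ b : Fin k → ι, T b * ∑ i, (d (E (A i) (b i))) *
        ∏ j ∈ Finset.univ.erase i, E (A j) (b j) := by
    simp only [trans, map_sum, Derivation.leibniz, deriv_prod, smul_eq_mul, prod_update_eq,
      ← Finset.sum_add_distrib]
    exact Finset.sum_congr rfl fun b _ => by ring
  have hd : ∀ a c, d (E a c) = (∑ G, γ a G * E G c) - ∑ G, E a G * Γ G c := by
    intro a c
    have := congrFun (congrFun hE a) c
    simpa [Matrix.mul_apply] using this
  have h2 : act γ (trans E T) A = ∑ b : Fin k → ι, T b * ∑ i, (∑ G, γ (A i) G * E G (b i)) *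
        ∏ j ∈ Finset.univ.erase i, E (A j) (b j) := by
    simp only [act, trans, Finset.mul_sum, Finset.sum_mul]
    rw [Finset.sum_comm' (t' := Finset.univ) (s' := fun _ => Finset.univ) (by simp)]
    rw [Finset.sum_comm]
    simp only [Finset.sum_comm (s := (Finset.univ : Finset ι))
      (t := (Finset.univ : Finset (Fin k → ι)))]
    rw [Finset.sum_comm]
    refine Finset.sum_congr rfl fun b _ => Finset.sum_congr rfl fun i _ =>
      Finset.sum_congr rfl fun G _ => ?_
    have : (fun j => E (Function.update A i G j) (b j)) =
        Function.update (fun j => E (A j) (b j)) i (E G (b i)) := by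
      ext j
      by_cases h : j = i
      · subst h; simp
      · simp [h]
    rw [this, prod_update_eq]; ring
  have h3 : ∑ b : Fin k → ι, act Γ T b * ∏ i, E (A i) (b i) =
      ∑ b : Fin k → ι, T b * ∑ i, (∑ G, E (A i) G * Γ G (b i)) *
        ∏ j ∈ Finset.univ.erase i, E (A j) (b j) := by
    simp only [act, Finset.mul_sum, Finset.sum_mul]
    rw [Finset.sum_comm]
    conv_rhs => rw [Finset.sum_comm]
    refine Finset.sum_congr rfl fun i _ => ?_
    -- After this exchange `Γ` is contracted with the frame matrix in slot `i`, so the term matches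
    -- the part `E * Γ` of the derivative of the frame.
    rw [sum_update_swap i]
    refine Finset.sum_congr rfl fun b _ => Finset.sum_congr rfl fun G _ => ?_
    have : (fun j => E (A j) (Function.update b i G j)) =
        Function.update (fun j => E (A j) (b j)) i (E (A i) G) := by
      ext j
      by_cases h : j = i
      · subst h; simp
      · simp [h]
    rw [this, prod_update_eq]; simp; ring
  have h4 : trans E (nab d Γ T) A = (∑ b : Fin k → ι, d (T b) * ∏ i, E (A i) (b i)) -
      ∑ b : Fin k → ι, act Γ T b * ∏ i, E (A i) (b i) := by
    simp only [trans, nab, sub_mul, Finset.sum_sub_distrib]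
  rw [h4, h3]
  simp only [nab, h1, h2, hd, sub_mul, Finset.sum_sub_distrib, mul_sub]
  ring

end TensorAlgebra

end Kundt

namespace Kundt

/-! ### Chains of orders under repeated differentiation. -/

section Filtration

/-- `f` has order at most `s` and its first `J` derivatives lower the order by one each. -/
def Fil {α : Type*} (O : ℤ → α → Prop) (d : α → α) : ℕ → ℤ → α → Prop
  | 0, s, f => O s f
  | J + 1, s, f => O s f ∧ Fil O d J (s - 1) (d f)

variable {α β δ : Type*} {O₁ : ℤ → α → Prop} {d₁ : α → α} {O₂ : ℤ → β → Prop} {d₂ : β → β}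
  {O₃ : ℤ → δ → Prop} {d₃ : δ → δ}

lemma Fil.of_succ {J : ℕ} {s : ℤ} {f : α} (h : Fil O₁ d₁ (J + 1) s f) : Fil O₁ d₁ J s f := by
  induction J generalizing s f with
  | zero => exact h.1
  | succ J ih => exact ⟨h.1, ih h.2⟩

lemma Fil.iterate {J : ℕ} {s : ℤ} {f : α} (h : Fil O₁ d₁ J s f) : O₁ (s - J) (d₁^[J] f) := by
  induction J generalizing s f with
  | zero => simpa [Fil] using h
  | succ J ih =>
    have := ih h.2
    rw [Function.iterate_succ_apply]
    convert this using 1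
    push_cast; ring

/-- A longer chain needs one new fact only, about its last member. This gives the induction in
`fil_riem` its form. -/
lemma Fil.succ_of_iterate {J : ℕ} {s : ℤ} {f : α} (h : Fil O₁ d₁ J s f)
    (h' : O₁ (s - (J + 1)) (d₁^[J + 1] f)) : Fil O₁ d₁ (J + 1) s f := by
  induction J generalizing s f with
  | zero => exact ⟨h, by simpa [Fil] using h'⟩
  | succ J ih =>
    refine ⟨h.1, ih h.2 ?_⟩
    rw [Function.iterate_succ_apply] at h'
    convert h' using 1
    push_cast; ring

lemma Fil.add [Add α] (hO : ∀ s f g, O₁ s f → O₁ s g → O₁ s (f + g))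
    (hd : ∀ f g, d₁ (f + g) = d₁ f + d₁ g) {J : ℕ} {s : ℤ} {f g : α}
    (hf : Fil O₁ d₁ J s f) (hg : Fil O₁ d₁ J s g) : Fil O₁ d₁ J s (f + g) := by
  induction J generalizing s f g with
  | zero => exact hO _ _ _ hf hg
  | succ J ih => exact ⟨hO _ _ _ hf.1 hg.1, by rw [hd]; exact ih hf.2 hg.2⟩

lemma Fil.map (φ : α → β) (r : ℤ) (hO : ∀ s f, O₁ s f → O₂ (s + r) (φ f))
    (hd : ∀ f, d₂ (φ f) = φ (d₁ f)) {J : ℕ} {s : ℤ} {f : α} (hf : Fil O₁ d₁ J s f) :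
    Fil O₂ d₂ J (s + r) (φ f) := by
  induction J generalizing s f with
  | zero => exact hO _ _ hf
  | succ J ih =>
    refine ⟨hO _ _ hf.1, ?_⟩
    rw [hd]
    convert ih hf.2 using 1
    ring

/-- By the Leibniz rule each term of the derivative has exactly one differentiated factor, which
lowers the total order by one; the chain of the other factor is shortened to the same length. -/
lemma Fil.bilin [Add δ] (hadd : ∀ s f g, O₃ s f → O₃ s g → O₃ s (f + g))
    (hd₃ : ∀ f g, d₃ (f + g) = d₃ f + d₃ g) (Φ : α → β → δ)
    (hO : ∀ s t f g, O₁ s f → O₂ t g → O₃ (s + t) (Φ f g))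
    (hd : ∀ f g, d₃ (Φ f g) = Φ (d₁ f) g + Φ f (d₂ g)) {J : ℕ} {s t : ℤ} {f : α} {g : β}
    (hf : Fil O₁ d₁ J s f) (hg : Fil O₂ d₂ J t g) : Fil O₃ d₃ J (s + t) (Φ f g) := by
  induction J generalizing s t f g with
  | zero => exact hO _ _ _ _ hf hg
  | succ J ih =>
    refine ⟨hO _ _ _ _ hf.1 hg.1, ?_⟩
    rw [hd]
    refine Fil.add hadd hd₃ ?_ ?_
    · convert ih hf.2 hg.of_succ using 1; ring
    · convert ih hf.of_succ hg.2 using 1; ring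

end Filtration

/-! ### Boost weight and the order of tensors and endomorphisms. -/

section Order

variable {R : Type*} [CommRing R] [Algebra ℝ R] {k : ℕ}

/-- All components of weight larger than `t` vanish. -/
def Ord {α : Type*} (w : α → ℤ) (t : ℤ) (f : α → R) : Prop := ∀ a, t < w a → f a = 0

lemma Ord.add {α : Type*} {w : α → ℤ} (t : ℤ) (f g : α → R) (hf : Ord w t f) (hg : Ord w t g) :
    Ord w t (f + g) := fun a ha => by simp [hf a ha, hg a ha]

/-- The total boost weight of a component. -/
def wt (A : Fin k → Fin 4) : ℤ := ∑ i, boostWeight (A i)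

/-- The weight that does not count the last index if it is `ℓ`. -/
def wtLast (A : Fin (k + 1) → Fin 4) : ℤ :=
  wt (Fin.init A) + min (boostWeight (A (Fin.last k))) 0

lemma wt_snoc (A : Fin k → Fin 4) (C : Fin 4) :
    wt (Fin.snoc A C : Fin (k + 1) → Fin 4) = wt A + boostWeight C := by
  simp [wt, Fin.sum_univ_castSucc]

lemma wtLast_snoc (A : Fin k → Fin 4) (C : Fin 4) :
    wtLast (Fin.snoc A C : Fin (k + 1) → Fin 4) = wt A + min (boostWeight C) 0 := by
  simp [wtLast]

lemma wt_update (A : Fin k → Fin 4) (i : Fin k) (E : Fin 4) :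
    wt (Function.update A i E) = wt A - boostWeight (A i) + boostWeight E := by
  unfold wt
  rw [← Finset.add_sum_erase _ _ (Finset.mem_univ i),
    ← Finset.add_sum_erase _ (fun j => boostWeight (A j)) (Finset.mem_univ i)]
  have : ∑ j ∈ Finset.univ.erase i, boostWeight (Function.update A i E j) =
      ∑ j ∈ Finset.univ.erase i, boostWeight (A j) :=
    Finset.sum_congr rfl fun j hj => by rw [Function.update_of_ne (Finset.ne_of_mem_erase hj)]
  rw [this, Function.update_self]; ring

lemma wtLast_le_wt (A : Fin (k + 1) → Fin 4) : wtLast A ≤ wt A := by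
  rw [← Fin.snoc_init_self A, wt_snoc, wtLast_snoc]
  simp

/-- The weight `wtLast` is the smaller one, so it tests fewer components and gives the weaker notion
of order. -/
lemma Ord.wtLast {t : ℤ} {T : (Fin (k + 1) → Fin 4) → R} (h : Ord wt t T) : Ord wtLast t T :=
  fun A hA => h A (hA.trans_le (wtLast_le_wt A))

lemma Fil.wtLast {d : ((Fin (k + 1) → Fin 4) → R) → ((Fin (k + 1) → Fin 4) → R)} {J : ℕ} {s : ℤ}
    {T : (Fin (k + 1) → Fin 4) → R} (h : Fil (Ord wt) d J s T) : Fil (Ord wtLast) d J s T := by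
  have := Fil.map (O₂ := Ord Kundt.wtLast) (d₂ := d) id 0
    (fun s f hf => by simpa using hf.wtLast) (fun f => rfl) h
  simpa using this

/-- The order of a family of endomorphisms. -/
def OrdM (t : ℤ) (M : Fin 4 → Matrix (Fin 4) (Fin 4) R) : Prop :=
  ∀ C A E, t < boostWeight C + boostWeight A - boostWeight E → M C A E = 0

/-- The order of an endomorphism. -/
def OrdL (t : ℤ) (L : Matrix (Fin 4) (Fin 4) R) : Prop :=
  ∀ C E, t < boostWeight C - boostWeight E → L C E = 0

lemma OrdL.add (t : ℤ) (L L' : Matrix (Fin 4) (Fin 4) R) (h : OrdL t L) (h' : OrdL t L') :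
    OrdL t (L + L') := fun C E hE => by simp [h C E hE, h' C E hE]

lemma OrdL.mul (s t : ℤ) (L L' : Matrix (Fin 4) (Fin 4) R) (h : OrdL s L) (h' : OrdL t L') :
    OrdL (s + t) (L * L') := fun C E hE => by
  rw [Matrix.mul_apply]
  refine Finset.sum_eq_zero fun G _ => ?_
  by_cases hG : s < boostWeight C - boostWeight G
  · rw [h _ _ hG, zero_mul]
  · rw [h' _ _ (by linarith), mul_zero]

/-- Replacing the index `A i` by `E` changes the weight by `boostWeight E - boostWeight (A i)`. If
the drop exceeds `s` the matrix entry vanishes; otherwise the remaining component of `T` still has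
weight above `t`. -/
lemma ord_act {s t : ℤ} {B : Matrix (Fin 4) (Fin 4) R} (hB : OrdL s B)
    {T : (Fin k → Fin 4) → R} (hT : Ord wt t T) : Ord wt (s + t) (act B T) := fun A hA => by
  refine Finset.sum_eq_zero fun i _ => Finset.sum_eq_zero fun E _ => ?_
  by_cases hE : s < boostWeight (A i) - boostWeight E
  · rw [hB _ _ hE, zero_mul]
  · rw [hT _ (by rw [wt_update]; linarith), mul_zero]

lemma ext_snoc {X Y : (Fin (k + 1) → Fin 4) → R}
    (h : ∀ (A : Fin k → Fin 4) (C : Fin 4), X (Fin.snoc A C) = Y (Fin.snoc A C)) : X = Y := by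
  ext A
  have := h (Fin.init A) (A (Fin.last k))
  rwa [Fin.snoc_init_self] at this

/-- A family of endomorphisms acts on a tensor, with its parameter as a new last index. -/
def famAct (M : Fin 4 → Matrix (Fin 4) (Fin 4) R) (T : (Fin k → Fin 4) → R) :
    (Fin (k + 1) → Fin 4) → R := fun A => act (M (A (Fin.last k))) T (Fin.init A)

/-- An endomorphism acts on the last index. -/
def lastAct (L : Matrix (Fin 4) (Fin 4) R) (X : (Fin (k + 1) → Fin 4) → R) :
    (Fin (k + 1) → Fin 4) → R := fun A =>
  ∑ G, L (A (Fin.last k)) G * X (Fin.snoc (Fin.init A) G)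

lemma famAct_snoc (M : Fin 4 → Matrix (Fin 4) (Fin 4) R) (T : (Fin k → Fin 4) → R)
    (A : Fin k → Fin 4) (C : Fin 4) : famAct M T (Fin.snoc A C) = act (M C) T A := by
  simp [famAct]

lemma lastAct_snoc (L : Matrix (Fin 4) (Fin 4) R) (X : (Fin (k + 1) → Fin 4) → R)
    (A : Fin k → Fin 4) (C : Fin 4) :
    lastAct L X (Fin.snoc A C) = ∑ G, L C G * X (Fin.snoc A G) := by
  simp [lastAct]

lemma ord_famAct (s t : ℤ) (M : Fin 4 → Matrix (Fin 4) (Fin 4) R) (T : (Fin k → Fin 4) → R)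
    (hM : OrdM s M) (hT : Ord wt t T) : Ord wt (s + t) (famAct M T) := fun A hA => by
  rw [← Fin.snoc_init_self A] at hA ⊢
  rw [wt_snoc] at hA
  rw [famAct_snoc]
  -- With its parameter fixed, one member of the family has order `s` minus the weight of that
  -- parameter.
  refine ord_act (s := s - boostWeight (A (Fin.last k))) (fun C E h => hM _ _ _ (by linarith)) hT _
    (by linarith)

lemma ord_lastAct (s t : ℤ) (L : Matrix (Fin 4) (Fin 4) R) (X : (Fin (k + 1) → Fin 4) → R)
    (hL : OrdL s L) (hX : Ord wt t X) : Ord wt (s + t) (lastAct L X) := fun A hA => by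
  rw [← Fin.snoc_init_self A] at hA ⊢
  rw [wt_snoc] at hA
  rw [lastAct_snoc]
  refine Finset.sum_eq_zero fun G _ => ?_
  by_cases hG : s < boostWeight (A (Fin.last k)) - boostWeight G
  · rw [hL _ _ hG, zero_mul]
  · rw [hX _ (by rw [wt_snoc]; linarith), mul_zero]

end Order

/-! ### Curvature in a frame and the commutation of covariant derivatives. -/

section Curvature

variable {R : Type*} [CommRing R] [Algebra ℝ R] {k : ℕ}
  (e : Fin 4 → Derivation ℝ R R) (γ : Fin 4 → Matrix (Fin 4) (Fin 4) R)

/-- The curvature of a connection in a frame with vanishing torsion. -/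
def curv (C D : Fin 4) : Matrix (Fin 4) (Fin 4) R :=
  dm (e C) (γ D) - dm (e D) (γ C) - (γ C * γ D - γ D * γ C) -
    ∑ G, (γ C D G - γ D C G) • γ G

/-- The connection has no torsion. -/
def TorsionFree : Prop := ∀ C D f,
  e C (e D f) - e D (e C f) = ∑ G, (γ C D G - γ D C G) * e G f

variable {e γ}

/-- The Ricci identity in an anholonomic frame: the bracket of the derivations gives the derivative
along the commutator of the frame vectors, and the remaining zeroth-order terms assemble to the
curvature. -/
lemma nab_comm (h : TorsionFree e γ) (C D : Fin 4) (T : (Fin k → Fin 4) → R) :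
    nab (e C) (γ C) (nab (e D) (γ D) T) - nab (e D) (γ D) (nab (e C) (γ C) T) =
      (∑ G, (γ C D G - γ D C G) • nab (e G) (γ G) T) - act (curv e γ C D) T := by
  have h1 : ∀ C D, act (γ C) (nab (e D) (γ D) T) =
      act (γ C) (fun A => e D (T A)) - act (γ C) (act (γ D) T) := fun C D => by
    rw [← act_sub_right]; rfl
  ext A
  have h2 := congrFun (act_comm (γ C) (γ D) T) A
  have h3 := h C D (T A)
  simp only [curv, act_sub_left, act_sum_left, act_smul_left, Pi.sub_apply, Finset.sum_apply,
    Pi.smul_apply, smul_eq_mul] at h2 ⊢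
  rw [nab_apply, nab_apply _ _ (nab (e C) (γ C) T), h1, h1]
  simp only [Pi.sub_apply, nab_apply, map_sub, deriv_act, mul_sub, Finset.sum_sub_distrib]
  linear_combination h2 + h3

/-- The endomorphism `∇ℓ`. -/
def gradL (γ : Fin 4 → Matrix (Fin 4) (Fin 4) R) : Matrix (Fin 4) (Fin 4) R :=
  Matrix.of fun C G => γ C 0 G

/-- Commuting `∇_ℓ` past `∇`. -/
lemma nab_nabla (h : TorsionFree e γ) (T : (Fin k → Fin 4) → R) :
    nab (e 0) (γ 0) (nabla e γ T) = nabla e γ (nab (e 0) (γ 0) T) -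
      lastAct (gradL γ) (nabla e γ T) - famAct (curv e γ 0) T := by
  refine ext_snoc fun A C => ?_
  have h1 := congrFun (nab_comm h 0 C T) A
  simp only [Pi.sub_apply, lastAct_snoc, famAct_snoc, nabla_snoc, Finset.sum_apply,
    Pi.smul_apply, smul_eq_mul, sub_mul, Finset.sum_sub_distrib] at h1 ⊢
  -- The connection also acts on the index of differentiation. This cancels the half `γ 0 C G` of
  -- the bracket coefficients and leaves `γ C 0 G`, that is, `∇ℓ`.
  have h2 : nab (e 0) (γ 0) (nabla e γ T) (Fin.snoc A C) =
      nab (e 0) (γ 0) (nab (e C) (γ C) T) A - ∑ G, γ 0 C G * nab (e G) (γ G) T A := by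
    rw [nab_apply, act_snoc]
    simp only [nabla_snoc]
    rw [nab_apply (e 0)]; ring
  rw [h2]
  simp only [gradL, Matrix.of_apply]
  linear_combination h1

/-- `∇_ℓ` on families of endomorphisms. -/
def nabM (d : Derivation ℝ R R) (B : Matrix (Fin 4) (Fin 4) R)
    (M : Fin 4 → Matrix (Fin 4) (Fin 4) R) : Fin 4 → Matrix (Fin 4) (Fin 4) R := fun C =>
  dm d (M C) - (B * M C - M C * B) - ∑ G, B C G • M G

/-- `∇_ℓ` on endomorphisms. -/
def nabL (d : Derivation ℝ R R) (B L : Matrix (Fin 4) (Fin 4) R) : Matrix (Fin 4) (Fin 4) R :=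
  dm d L - (B * L - L * B)

lemma nabL_add (d : Derivation ℝ R R) (B L L' : Matrix (Fin 4) (Fin 4) R) :
    nabL d B (L + L') = nabL d B L + nabL d B L' := by
  simp only [nabL, dm_add]; noncomm_ring

lemma nabL_neg (d : Derivation ℝ R R) (B L : Matrix (Fin 4) (Fin 4) R) :
    nabL d B (-L) = -nabL d B L := by
  have : dm d (-L) = - dm d L := by ext; simp
  simp only [nabL, this]; noncomm_ring

lemma nabL_mul (d : Derivation ℝ R R) (B L L' : Matrix (Fin 4) (Fin 4) R) :
    nabL d B (L * L') = nabL d B L * L' + L * nabL d B L' := by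
  simp only [nabL, dm_mul]; noncomm_ring

/-- The parameter of the family becomes a tensor index, so it is differentiated covariantly too;
this is the last term of `nabM`. -/
lemma nab_famAct (d : Derivation ℝ R R) (B : Matrix (Fin 4) (Fin 4) R)
    (M : Fin 4 → Matrix (Fin 4) (Fin 4) R) (T : (Fin k → Fin 4) → R) :
    nab d B (famAct M T) = famAct (nabM d B M) T + famAct M (nab d B T) := by
  refine ext_snoc fun A C => ?_
  have h1 := congrFun (nab_act d B (M C) T) A
  rw [nab_apply, act_snoc, Pi.add_apply]
  simp only [famAct_snoc, nabM] at h1 ⊢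
  rw [nab_apply, Pi.add_apply] at h1
  rw [act_sub_left _ (∑ G, _), Pi.sub_apply, act_sum_left]
  simp only [act_smul_left, Finset.sum_apply, Pi.smul_apply, smul_eq_mul]
  linear_combination h1

lemma nab_lastAct (d : Derivation ℝ R R) (B L : Matrix (Fin 4) (Fin 4) R)
    (X : (Fin (k + 1) → Fin 4) → R) :
    nab d B (lastAct L X) = lastAct (nabL d B L) X + lastAct L (nab d B X) := by
  refine ext_snoc fun A C => ?_
  rw [nab_apply, act_snoc, Pi.add_apply]
  simp only [lastAct_snoc, nab_apply, nabL, act_snoc, map_sum, Derivation.leibniz, smul_eq_mul,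
    Matrix.sub_apply, dm_apply, Matrix.mul_apply, sub_mul, mul_sub, mul_add,
    Finset.sum_sub_distrib, Finset.sum_add_distrib]
  have h1 : act B (fun A' => ∑ G, L C G * X (Fin.snoc A' G)) A =
      ∑ G, L C G * act B (fun A' => X (Fin.snoc A' G)) A := by
    simp only [act, Finset.mul_sum]
    rw [Finset.sum_comm' (t' := Finset.univ) (s' := fun _ => Finset.univ) (by simp)]
    rw [Finset.sum_comm]
    conv_rhs => rw [Finset.sum_comm]
    refine Finset.sum_congr rfl fun i _ => ?_
    rw [Finset.sum_comm]
    exact Finset.sum_congr rfl fun G _ => Finset.sum_congr rfl fun E _ => by ring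
  have h2 : ∑ E, B C E * ∑ G, L E G * X (Fin.snoc A G) =
      ∑ G, (∑ E, B C E * L E G) * X (Fin.snoc A G) := by
    simp only [Finset.mul_sum, Finset.sum_mul]
    rw [Finset.sum_comm]
    exact Finset.sum_congr rfl fun G _ => Finset.sum_congr rfl fun E _ => by ring
  have h3 : ∑ E, L C E * ∑ G, B E G * X (Fin.snoc A G) =
      ∑ G, (∑ E, L C E * B E G) * X (Fin.snoc A G) := by
    simp only [Finset.mul_sum, Finset.sum_mul]
    rw [Finset.sum_comm]
    exact Finset.sum_congr rfl fun G _ => Finset.sum_congr rfl fun E _ => by ring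
  have h4 : ∑ G, X (Fin.snoc A G) * d (L C G) = ∑ G, d (L C G) * X (Fin.snoc A G) :=
    Finset.sum_congr rfl fun G _ => mul_comm _ _
  rw [h1, h2, h3, h4]; ring

end Curvature

end Kundt

/-! ### Kinematic frames: how `∇_ℓ` and `∇` change the order. -/

namespace Kundt

/-- The exchange `ℓ ↔ n`, `m ↔ m̄` that raises and lowers tetrad indices. -/
def sw : Fin 4 → Fin 4 := ![1, 0, 3, 2]

@[simp] lemma sw_sw (A : Fin 4) : sw (sw A) = A := by fin_cases A <;> rfl

lemma sw_involutive : Function.Involutive sw := sw_sw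

@[simp] lemma boostWeight_sw (A : Fin 4) : boostWeight (sw A) = -boostWeight A := by
  fin_cases A <;> rfl

lemma boostWeight_mem (A : Fin 4) : -1 ≤ boostWeight A ∧ boostWeight A ≤ 1 := by
  fin_cases A <;> decide

lemma boostWeight_eq_one {A : Fin 4} (h : 1 ≤ boostWeight A) : A = 0 := by
  fin_cases A <;> simp_all [boostWeight]

section

variable {R : Type*} [CommRing R] [Algebra ℝ R] {k : ℕ}

/-- The exchange of the two index pairs of a tensor of rank four. -/
def pairSwap : Equiv.Perm (Fin 4) := Equiv.swap 0 2 * Equiv.swap 1 3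

/-- A null frame without torsion, whose connection is metric and has no coefficients of positive
boost weight, and the curvature tensor of this connection. -/
structure IsKinematicGeometry (e : Fin 4 → Derivation ℝ R R) (γ : Fin 4 → Matrix (Fin 4) (Fin 4) R)
    (s : Fin 4 → R) (Rm : (Fin 4 → Fin 4) → R) : Prop where
  torsion : TorsionFree e γ
  kin : ∀ C A E, 0 < boostWeight C + boostWeight A - boostWeight E → γ C A E = 0
  s_sq : ∀ A, s A * s A = 1
  s_const : ∀ C A, e C (s A) = 0
  s_sw : ∀ A, s (sw A) = s A
  antisymm : ∀ C A B, s B * γ C A (sw B) = -(s A * γ C B (sw A))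
  riem : ∀ A B C D, Rm ![A, B, C, D] = s A * curv e γ C D B (sw A)
  swap : ∀ A, Rm (A ∘ Equiv.swap 2 3) = -Rm A
  pair : ∀ A, Rm (A ∘ pairSwap) = Rm A
  bianchi : ∀ a b c d f, nab (e f) (γ f) Rm ![a, b, c, d] + nab (e c) (γ c) Rm ![a, b, d, f] +
    nab (e d) (γ d) Rm ![a, b, f, c] = 0

lemma act_four (B : Matrix (Fin 4) (Fin 4) R) (T : (Fin 4 → Fin 4) → R) (a b c d : Fin 4) :
    act B T ![a, b, c, d] = (∑ E, B a E * T ![E, b, c, d]) + (∑ E, B b E * T ![a, E, c, d]) +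
      (∑ E, B c E * T ![a, b, E, d]) + ∑ E, B d E * T ![a, b, c, E] := by
  have h0 : ∀ E, Function.update ![a, b, c, d] 0 E = ![E, b, c, d] := fun E => by
    ext i; fin_cases i <;> rfl
  have h1 : ∀ E, Function.update ![a, b, c, d] 1 E = ![a, E, c, d] := fun E => by
    ext i; fin_cases i <;> rfl
  have h2 : ∀ E, Function.update ![a, b, c, d] 2 E = ![a, b, E, d] := fun E => by
    ext i; fin_cases i <;> rfl
  have h3 : ∀ E, Function.update ![a, b, c, d] 3 E = ![a, b, c, E] := fun E => by
    ext i; fin_cases i <;> rfl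
  unfold act
  rw [Fin.sum_univ_four]
  simp only [h0, h1, h2, h3]
  rfl

lemma act_three (B : Matrix (Fin 4) (Fin 4) R) (T : (Fin 3 → Fin 4) → R) (a b c : Fin 4) :
    act B T ![a, b, c] = (∑ E, B a E * T ![E, b, c]) + (∑ E, B b E * T ![a, E, c]) +
      ∑ E, B c E * T ![a, b, E] := by
  have h0 : ∀ E, Function.update ![a, b, c] 0 E = ![E, b, c] := fun E => by
    ext i; fin_cases i <;> rfl
  have h1 : ∀ E, Function.update ![a, b, c] 1 E = ![a, E, c] := fun E => by
    ext i; fin_cases i <;> rfl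
  have h2 : ∀ E, Function.update ![a, b, c] 2 E = ![a, b, E] := fun E => by
    ext i; fin_cases i <;> rfl
  unfold act
  rw [Fin.sum_univ_three]
  simp only [h0, h1, h2]
  rfl

lemma wt_four (a b c d : Fin 4) :
    wt ![a, b, c, d] = boostWeight a + boostWeight b + boostWeight c + boostWeight d := by
  simp [wt, Fin.sum_univ_four]

lemma eta_four {α : Type*} (A : Fin 4 → α) : A = ![A 0, A 1, A 2, A 3] := by
  ext i; fin_cases i <;> rfl

lemma eta_three {α : Type*} (A : Fin 3 → α) : A = ![A 0, A 1, A 2] := by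
  ext i; fin_cases i <;> rfl

lemma comp_swap_four {α : Type*} (a b c d : α) : ![a, b, c, d] ∘ Equiv.swap 2 3 = ![a, b, d, c] := by
  ext i; fin_cases i <;> rfl

lemma comp_pairSwap {α : Type*} (a b c d : α) : ![a, b, c, d] ∘ pairSwap = ![c, d, a, b] := by
  ext i; fin_cases i <;> rfl

/-- `T(e_A, ·, ℓ, e_C)` as a family of endomorphisms. -/
def raise (s : Fin 4 → R) (T : (Fin 4 → Fin 4) → R) : Fin 4 → Matrix (Fin 4) (Fin 4) R :=
  fun C => Matrix.of fun A E => s E * T ![sw E, A, 0, C]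

/-- The insertion of `ℓ` in the third slot. -/
def insertL (T : (Fin 4 → Fin 4) → R) : (Fin 3 → Fin 4) → R := fun A => T ![A 0, A 1, 0, A 2]

variable {e : Fin 4 → Derivation ℝ R R} {γ : Fin 4 → Matrix (Fin 4) (Fin 4) R} {s : Fin 4 → R}
  {Rm : (Fin 4 → Fin 4) → R}

namespace IsKinematicGeometry

variable (G : IsKinematicGeometry e γ s Rm)
include G

/-- The weight of this coefficient is `2 - boostWeight E`, hence at least 1 for every `E`. It says
`∇_ℓ ℓ = 0`, so inserting `ℓ` commutes with `∇_ℓ`. -/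
lemma conn_zero_zero (E : Fin 4) : γ 0 0 E = 0 :=
  G.kin _ _ _ (by have := (boostWeight_mem E).2; simp only [boostWeight] at *; simp; omega)

lemma conn_ordL (C : Fin 4) : OrdL (-boostWeight C) (γ C) := fun A E h => G.kin _ _ _ (by linarith)

lemma ord_act_conn {t : ℤ} {T : (Fin k → Fin 4) → R} (hT : Ord wt t T) (C : Fin 4) :
    Ord wt (t - boostWeight C) (act (γ C) T) := by
  have := ord_act (G.conn_ordL C) hT
  rwa [neg_add_eq_sub] at this

lemma ord_nab_zero {t : ℤ} {T : (Fin k → Fin 4) → R} (hT : Ord wt t T) :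
    Ord wt t (nab (e 0) (γ 0) T) := fun A hA => by
  rw [nab_apply, hT A hA, map_zero,
    G.ord_act_conn hT 0 A (by simp [boostWeight]; linarith), sub_zero]

/-- If the last index is not `ℓ`, it adds nothing to the weight: the differentiated component of `T`
vanishes already, and the connection terms cannot raise the order. Only the derivative along `ℓ`
gains a unit of weight and needs a hypothesis. -/
lemma ord_nabla {t : ℤ} {T : (Fin k → Fin 4) → R} (hT : Ord wt t T)
    (hD : Ord wt (t - 1) (nab (e 0) (γ 0) T)) : Ord wt t (nabla e γ T) := fun A hA => by
  rw [← Fin.snoc_init_self A] at hA ⊢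
  rw [wt_snoc] at hA
  rw [nabla_snoc]
  set C := A (Fin.last k)
  by_cases hC : C = 0
  · rw [hC] at hA ⊢
    exact hD _ (by simp [boostWeight] at hA; linarith)
  · have : ¬ 1 ≤ boostWeight C := fun h => hC (boostWeight_eq_one h)
    rw [nab_apply, hT _ (by omega), map_zero, G.ord_act_conn hT C _ (by linarith), sub_zero]

omit G in
lemma ord_nab_of_nabla {t : ℤ} {T : (Fin k → Fin 4) → R} (h : Ord wt t (nabla e γ T)) :
    Ord wt (t - 1) (nab (e 0) (γ 0) T) := fun A hA => by
  have := h (Fin.snoc A 0) (by rw [wt_snoc]; simp [boostWeight]; linarith)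
  rwa [nabla_snoc] at this

/-- With an `ℓ` in the last place left uncounted, the derivative along `ℓ` needs no gain, so no
hypothesis on `∇_ℓ T` is required. -/
lemma ord_nabla_last {t : ℤ} {T : (Fin k → Fin 4) → R} (hT : Ord wt t T) :
    Ord wtLast t (nabla e γ T) := fun A hA => by
  rw [← Fin.snoc_init_self A] at hA ⊢
  rw [wtLast_snoc] at hA
  rw [nabla_snoc]
  set C := A (Fin.last k)
  by_cases hC : C = 0
  · rw [hC] at hA ⊢
    exact G.ord_nab_zero hT _ (by simp [boostWeight] at hA; linarith)
  · have : ¬ 1 ≤ boostWeight C := fun h => hC (boostWeight_eq_one h)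
    rw [nab_apply, hT _ (by omega), map_zero, G.ord_act_conn hT C _ (by omega), sub_zero]

lemma gradL_ord : OrdL (-1) (gradL γ) := fun C E h => by
  simp only [gradL, Matrix.of_apply]
  exact G.kin _ _ _ (by simp only [boostWeight] at *; simp at *; linarith)

/-- In a null frame an index is raised by the exchange `sw` and a sign, so the endomorphisms `R(ℓ,
e_C)` are entries of `Rm` and inherit its chain of orders. -/
lemma curv_zero_eq : curv e γ 0 = raise s Rm := by
  ext C A E
  simp only [raise, Matrix.of_apply, G.riem, G.s_sw, sw_sw, ← mul_assoc, G.s_sq, one_mul]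

lemma nabM_raise (T : (Fin 4 → Fin 4) → R) :
    nabM (e 0) (γ 0) (raise s T) = raise s (nab (e 0) (γ 0) T) := by
  ext C A E
  -- Metricity of the connection: the term of the raised index equals minus the corresponding term
  -- of the lowered index.
  have h1 : ∑ G, s G * T ![sw G, A, 0, C] * γ 0 G E =
      -(s E * ∑ G, γ 0 (sw E) G * T ![G, A, 0, C]) := by
    rw [← Equiv.sum_comp (sw_involutive.toPerm), Finset.mul_sum,
      ← Finset.sum_neg_distrib]
    refine Finset.sum_congr rfl fun F _ => ?_
    have h := G.antisymm 0 (sw F) (sw E)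
    simp only [sw_sw, G.s_sw] at h
    simp only [Function.Involutive.coe_toPerm, sw_sw, G.s_sw]
    have h2 := G.s_sq F
    have h3 := G.s_sq E
    linear_combination (T ![F, A, 0, C]) * (s E * s F * h - s F * γ 0 (sw F) E * h3 -
      s E * γ 0 (sw E) F * h2)
  simp only [nabM, raise, Matrix.sub_apply, dm_apply, Matrix.of_apply, Matrix.mul_apply,
    Matrix.sum_apply, Matrix.smul_apply, smul_eq_mul, nab_apply, act_four, Derivation.leibniz,
    G.s_const, G.conn_zero_zero, zero_mul, Finset.sum_const_zero, h1]
  simp only [mul_sub, mul_add, Finset.mul_sum, mul_left_comm (γ 0 _ _)]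
  ring

omit G in
lemma ordM_raise (t : ℤ) (T : (Fin 4 → Fin 4) → R) (hT : Ord wt t T) :
    OrdM (t + -1) (raise s T) := fun C A E h => by
  simp only [raise, Matrix.of_apply]
  rw [hT _ (by rw [wt_four, boostWeight_sw]; simp [boostWeight] at *; linarith), mul_zero]

lemma fil_curv {J : ℕ} (h : Fil (Ord wt) (nab (e 0) (γ 0)) J 0 Rm) :
    Fil OrdM (nabM (e 0) (γ 0)) J (-1) (curv e γ 0) := by
  rw [G.curv_zero_eq]
  have := Fil.map (O₂ := OrdM) (d₂ := nabM (e 0) (γ 0)) (raise s) (-1) ordM_raise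
    (fun f => G.nabM_raise f) h
  simpa using this

/-- The inserted vector contributes no term, because `∇_ℓ ℓ = 0`. -/
lemma nab_insertL (T : (Fin 4 → Fin 4) → R) :
    nab (e 0) (γ 0) (insertL T) = insertL (nab (e 0) (γ 0) T) := by
  ext A
  rw [eta_three A]
  simp only [insertL, nab_apply, act_three, act_four]
  simp [G.conn_zero_zero]

lemma fil_insertL {J : ℕ} (h : Fil (Ord wt) (nab (e 0) (γ 0)) J 0 Rm) :
    Fil (Ord wt) (nab (e 0) (γ 0)) J (-1) (insertL Rm) := by
  have := Fil.map (O₂ := Ord wt) (d₂ := nab (e 0) (γ 0)) insertL (-1)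
    (fun t f hf A hA => hf _ (by
      have : wt A = boostWeight (A 0) + boostWeight (A 1) + boostWeight (A 2) := by
        simp [wt, Fin.sum_univ_three]
      rw [wt_four, show boostWeight 0 = 1 from rfl]; linarith))
    (fun f => G.nab_insertL f) h
  simpa using this

/-- The Riccati (Sachs) equation of the congruence of `ℓ`: commute `∇_ℓ` past `∇` on `ℓ` and use
`∇_ℓ ℓ = 0`. -/
lemma nabL_gradL : nabL (e 0) (γ 0) (gradL γ) =
    Matrix.of (fun C E => curv e γ 0 C 0 E) + -(gradL γ * gradL γ) := by
  ext C E
  simp only [nabL, curv, gradL, Matrix.sub_apply, Matrix.add_apply, Matrix.neg_apply, dm_apply,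
    Matrix.of_apply, Matrix.mul_apply, Matrix.sum_apply, Matrix.smul_apply, smul_eq_mul,
    G.conn_zero_zero, zero_mul, map_zero, Finset.sum_const_zero, sub_mul, Finset.sum_sub_distrib]
  ring

lemma nabL_row (M : Fin 4 → Matrix (Fin 4) (Fin 4) R) :
    nabL (e 0) (γ 0) (Matrix.of fun C E => M C 0 E) =
      Matrix.of fun C E => nabM (e 0) (γ 0) M C 0 E := by
  ext C E
  simp only [nabL, nabM, Matrix.sub_apply, dm_apply,
    Matrix.of_apply, Matrix.mul_apply, Matrix.sum_apply, Matrix.smul_apply, smul_eq_mul,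
    G.conn_zero_zero, zero_mul, Finset.sum_const_zero]
  ring

omit G in
lemma ordL_neg (t : ℤ) (L : Matrix (Fin 4) (Fin 4) R) (h : OrdL t L) : OrdL (t + 0) (-L) :=
  fun C E hE => by simp [h C E (by linarith)]

/-- By the Riccati equation `D∇ℓ` consists of curvature, of order -2 after `ℓ` is inserted twice,
and of a square of order -1 - 1. Thus the chain of `∇ℓ` is generated by that of the curvature and by
its own shorter part, and is one step longer than the former. -/
lemma fil_gradL {J : ℕ} (h : Fil (Ord wt) (nab (e 0) (γ 0)) J 0 Rm) :
    Fil OrdL (nabL (e 0) (γ 0)) (J + 1) (-1) (gradL γ) := by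
  induction J with
  | zero =>
    refine ⟨G.gradL_ord, ?_⟩
    rw [G.nabL_gradL]
    refine OrdL.add _ _ _ (fun C E hE => ?_) ?_
    · exact (G.fil_curv h) _ _ _ (by simp [boostWeight] at *; linarith)
    · have := ordL_neg _ _ (OrdL.mul _ _ _ _ G.gradL_ord G.gradL_ord)
      simpa using this
  | succ J ih =>
    refine ⟨G.gradL_ord, ?_⟩
    rw [G.nabL_gradL]
    refine Fil.add OrdL.add (nabL_add _ _) ?_ ?_
    · have := Fil.map (O₂ := OrdL) (d₂ := nabL (e 0) (γ 0))
        (fun M : Fin 4 → Matrix (Fin 4) (Fin 4) R => Matrix.of fun C E => M C 0 E) (-1)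
        (fun t f hf C E hE => hf C 0 E (by simp [boostWeight] at *; linarith))
        (fun f => G.nabL_row f) (G.fil_curv h)
      simpa using this
    · have h2 := ih h.of_succ
      have h3 := Fil.bilin (O₃ := OrdL) OrdL.add (nabL_add (e 0) (γ 0)) (· * ·)
        (fun s t f g => OrdL.mul s t f g) (nabL_mul _ _) h2 h2
      have h4 := Fil.map (O₂ := OrdL) (d₂ := nabL (e 0) (γ 0)) (fun L => -L) 0 ordL_neg
        (fun f => nabL_neg _ _ _) h3
      simpa using h4

omit G in
lemma nab_sub_eq_add (d : Derivation ℝ R R) (B : Matrix (Fin 4) (Fin 4) R)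
    (f : (Fin k → Fin 4) → R) : nab d B (-f) = -nab d B f := by
  have := nab_sub d B 0 f
  have h0 := nab_sub d B f f
  simp only [zero_sub, sub_self] at this h0
  rw [this, h0, zero_sub]

omit G in
lemma fil_neg {d : Derivation ℝ R R} {B : Matrix (Fin 4) (Fin 4) R} {w : (Fin k → Fin 4) → ℤ}
    {J : ℕ} {t : ℤ} {f : (Fin k → Fin 4) → R} (h : Fil (Ord w) (nab d B) J t f) :
    Fil (Ord w) (nab d B) J t (-f) := by
  have := Fil.map (O₂ := Ord w) (d₂ := nab d B) (fun f => -f) 0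
    (fun t f hf A hA => by simp [hf A (by linarith)]) (fun f => nab_sub_eq_add _ _ _) h
  simpa using this

omit G in
lemma fil_sub {d : Derivation ℝ R R} {B : Matrix (Fin 4) (Fin 4) R} {w : (Fin k → Fin 4) → ℤ}
    {J : ℕ} {t : ℤ} {f g : (Fin k → Fin 4) → R} (h : Fil (Ord w) (nab d B) J t f)
    (h' : Fil (Ord w) (nab d B) J t g) : Fil (Ord w) (nab d B) J t (f - g) := by
  rw [sub_eq_add_neg]
  exact Fil.add Ord.add (nab_add _ _) h (fil_neg h')

lemma fil_famAct {J : ℕ} (h : Fil (Ord wt) (nab (e 0) (γ 0)) J 0 Rm) {t : ℤ}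
    {T : (Fin k → Fin 4) → R} (hT : Fil (Ord wt) (nab (e 0) (γ 0)) J t T) :
    Fil (Ord wt) (nab (e 0) (γ 0)) J (t - 1) (famAct (curv e γ 0) T) := by
  have := Fil.bilin (O₃ := Ord wt) Ord.add (nab_add (e 0) (γ 0)) (famAct (k := k))
    ord_famAct (nab_famAct _ _) (G.fil_curv h) hT
  rwa [neg_add_eq_sub] at this

lemma fil_lastAct {J : ℕ} (h : Fil (Ord wt) (nab (e 0) (γ 0)) J 0 Rm) {t : ℤ}
    {T : (Fin (k + 1) → Fin 4) → R} (hT : Fil (Ord wt) (nab (e 0) (γ 0)) J t T) :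
    Fil (Ord wt) (nab (e 0) (γ 0)) J (t - 1) (lastAct (gradL γ) T) := by
  have := Fil.bilin (O₃ := Ord wt) Ord.add (nab_add (e 0) (γ 0)) (lastAct (k := k))
    ord_lastAct (nab_lastAct _ _) (G.fil_gradL h).of_succ hT
  rwa [neg_add_eq_sub] at this

/-- Each application of `∇` costs one member of the chain but no order. In the commutator formula
`∇(DT)` starts one order lower by hypothesis, and the two correction terms do so because `∇ℓ` and
`R(ℓ, ·)` have order -1. -/
lemma fil_nabla {J : ℕ} (h : Fil (Ord wt) (nab (e 0) (γ 0)) J 0 Rm) {t : ℤ}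
    {T : (Fin k → Fin 4) → R} (hT : Fil (Ord wt) (nab (e 0) (γ 0)) (J + 1) t T) :
    Fil (Ord wt) (nab (e 0) (γ 0)) J t (nabla e γ T) := by
  induction J generalizing t T with
  | zero => exact G.ord_nabla hT.1 hT.2
  | succ J ih =>
    refine ⟨G.ord_nabla hT.1 hT.2.1, ?_⟩
    rw [nab_nabla G.torsion]
    exact fil_sub (fil_sub (ih h.of_succ hT.2)
      (G.fil_lastAct h.of_succ (ih h.of_succ hT.of_succ))) (G.fil_famAct h.of_succ hT.of_succ.of_succ)

/-- The variant without loss in the length of the chain. It is what lets the Bianchi identity reach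
one derivative further than its input. -/
lemma fil_nabla_last {J : ℕ} (h : Fil (Ord wt) (nab (e 0) (γ 0)) J 0 Rm) {t : ℤ}
    {T : (Fin k → Fin 4) → R} (hT : Fil (Ord wt) (nab (e 0) (γ 0)) J t T) :
    Fil (Ord wtLast) (nab (e 0) (γ 0)) J t (nabla e γ T) := by
  induction J generalizing t T with
  | zero => exact G.ord_nabla_last hT
  | succ J ih =>
    refine ⟨G.ord_nabla_last hT.1, ?_⟩
    rw [nab_nabla G.torsion]
    exact fil_sub (fil_sub (ih h.of_succ hT.2)
      -- Here `∇ℓ` is contracted with the last index, so the full weight of `∇T` is needed. One `D`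
      -- has been used up already, so the loss in `fil_nabla` is affordable.
      (G.fil_lastAct h.of_succ (G.fil_nabla h.of_succ hT)).wtLast)
      (G.fil_famAct h.of_succ hT.of_succ).wtLast

end IsKinematicGeometry

end

end Kundt

/-! ### The Bianchi identity and the derivatives of the curvature along `ℓ`. -/

namespace Kundt

section

variable {R : Type*} [CommRing R] [Algebra ℝ R] {k : ℕ}

lemma snoc_three {α : Type*} (a b c d : α) :
    (Fin.snoc ![a, b, c] d : Fin 4 → α) = ![a, b, c, d] := by
  ext i; fin_cases i <;> rfl

lemma nab_iterate_perm (σ : Equiv.Perm (Fin k)) (d : Derivation ℝ R R)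
    (B : Matrix (Fin 4) (Fin 4) R) (T : (Fin k → Fin 4) → R) (j : ℕ) :
    (nab d B)^[j] (fun A => T (A ∘ σ)) = fun A => (nab d B)^[j] T (A ∘ σ) := by
  induction j generalizing T with
  | zero => rfl
  | succ j ih =>
    rw [Function.iterate_succ_apply, Function.iterate_succ_apply, ← ih]
    congr 1
    ext A
    exact nab_perm σ d B T A

lemma nab_iterate_sub (d : Derivation ℝ R R) (B : Matrix (Fin 4) (Fin 4) R)
    (T T' : (Fin k → Fin 4) → R) (j : ℕ) :
    (nab d B)^[j] (T - T') = (nab d B)^[j] T - (nab d B)^[j] T' := by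
  induction j generalizing T T' with
  | zero => rfl
  | succ j ih => simp only [Function.iterate_succ_apply, nab_sub, ih]

lemma nab_iterate_neg (d : Derivation ℝ R R) (B : Matrix (Fin 4) (Fin 4) R)
    (T : (Fin k → Fin 4) → R) (j : ℕ) : (nab d B)^[j] (-T) = -(nab d B)^[j] T := by
  have h := nab_iterate_sub d B T T j
  have h' := nab_iterate_sub d B 0 T j
  have h0 := nab_iterate_sub d B (0 : (Fin k → Fin 4) → R) 0 j
  simp only [zero_sub, sub_self] at h h' h0
  rw [h', h0, zero_sub]

variable {e : Fin 4 → Derivation ℝ R R} {γ : Fin 4 → Matrix (Fin 4) (Fin 4) R} {s : Fin 4 → R}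
  {Rm : (Fin 4 → Fin 4) → R}

/-- The covariant derivative of `T(·, ·, ℓ, ·)`, without the terms with the derivative of `ℓ`. -/
def insertGrad (e : Fin 4 → Derivation ℝ R R) (γ : Fin 4 → Matrix (Fin 4) (Fin 4) R)
    (T : (Fin 4 → Fin 4) → R) : (Fin 4 → Fin 4) → R :=
  nabla e γ (insertL T) + lastAct (k := 3) (gradL γ) T

/-- The symmetries of the Riemann tensor under permutations of the indices. -/
structure HasRiemannSymm (T : (Fin 4 → Fin 4) → R) : Prop where
  swap : ∀ a b c d, T ![a, b, d, c] = -T ![a, b, c, d]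
  pair : ∀ a b c d, T ![c, d, a, b] = T ![a, b, c, d]

lemma two_mul_eq_zero_of {x : R} (h : x = -x) : x = 0 := by
  have h2 : (algebraMap ℝ R 2) * x = 0 := by
    rw [map_ofNat]; linear_combination h
  have h3 : algebraMap ℝ R (1 / 2) * algebraMap ℝ R 2 = 1 := by rw [← map_mul]; norm_num
  linear_combination (algebraMap ℝ R (1 / 2)) * h2 - x * h3

namespace HasRiemannSymm

variable {T : (Fin 4 → Fin 4) → R} (h : HasRiemannSymm T)
include h

lemma swap' (a b c d : Fin 4) : T ![b, a, c, d] = -T ![a, b, c, d] := by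
  rw [← h.pair, h.swap, h.pair]

lemma self (a b c : Fin 4) : T ![a, b, c, c] = 0 :=
  two_mul_eq_zero_of (h.swap a b c c)

lemma self' (a c d : Fin 4) : T ![a, a, c, d] = 0 :=
  two_mul_eq_zero_of (h.swap' a a c d)

/-- A tensor with these symmetries has order at most `t` as soon as this holds for the components
with no `ℓ` in the last pair and for the components `T(ℓ, ·, ℓ, ·)`. -/
lemma ord {t : ℤ} (h1 : ∀ a b c d, c ≠ 0 → d ≠ 0 → t < wt ![a, b, c, d] → T ![a, b, c, d] = 0)
    (h2 : ∀ b d, b ≠ 0 → d ≠ 0 → t < wt ![0, b, 0, d] → T ![0, b, 0, d] = 0) : Ord wt t T := by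
  have h2' : ∀ b d, t < wt ![0, b, 0, d] → T ![0, b, 0, d] = 0 := fun b d hw => by
    by_cases hb : b = 0
    · subst hb; exact h.self' _ _ _
    by_cases hd : d = 0
    · subst hd; exact h.self _ _ _
    exact h2 b d hb hd hw
  have h3 : ∀ a b d, t < wt ![a, b, 0, d] → T ![a, b, 0, d] = 0 := fun a b d hw => by
    by_cases ha : a = 0
    · subst ha; exact h2' _ _ hw
    by_cases hb : b = 0
    · subst hb
      rw [h.swap', h2' _ _ (by rw [wt_four] at *; linarith), neg_zero]
    rw [← h.pair]
    exact h1 _ _ _ _ ha hb (by rw [wt_four] at *; linarith)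
  intro A hA
  rw [eta_four A] at hA ⊢
  by_cases hc : A 2 = 0
  · rw [hc] at hA ⊢
    exact h3 _ _ _ hA
  by_cases hd : A 3 = 0
  · rw [hd] at hA ⊢
    rw [h.swap, h3 _ _ _ (by rw [wt_four] at *; linarith), neg_zero]
  exact h1 _ _ _ _ hc hd hA

end HasRiemannSymm

namespace IsKinematicGeometry

variable (G : IsKinematicGeometry e γ s Rm)
include G

/-- Covariant differentiation in a fixed direction commutes with permutations of the slots, so the
algebraic symmetries persist. -/
lemma iterate_symm (j : ℕ) : HasRiemannSymm ((nab (e 0) (γ 0))^[j] Rm) where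
  swap a b c d := by
    have h1 : (fun A => Rm (A ∘ Equiv.swap 2 3)) = -Rm := funext G.swap
    have h2 := nab_iterate_perm (Equiv.swap 2 3) (e 0) (γ 0) Rm j
    rw [h1, nab_iterate_neg] at h2
    have h3 := congrFun h2 ![a, b, c, d]
    simp only [comp_swap_four] at h3
    rw [← h3]; rfl
  pair a b c d := by
    have h1 : (fun A => Rm (A ∘ pairSwap)) = Rm := funext G.pair
    have h2 := nab_iterate_perm pairSwap (e 0) (γ 0) Rm j
    rw [h1] at h2
    have h3 := congrFun h2 ![a, b, c, d]
    simp only [comp_pairSwap] at h3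
    rw [← h3]

lemma symm : HasRiemannSymm Rm := G.iterate_symm 0

lemma nab_insertL_apply (a b c d : Fin 4) :
    nab (e c) (γ c) Rm ![a, b, 0, d] = insertGrad e γ Rm ![a, b, d, c] := by
  change _ = nabla e γ (insertL Rm) ![a, b, d, c] +
    lastAct (k := 3) (gradL γ) Rm ![a, b, d, c]
  rw [← snoc_three a b d c, nabla_snoc, lastAct_snoc]
  simp only [nab_apply, act_three, act_four, insertL, gradL, Matrix.of_apply, snoc_three]
  -- Antisymmetry moves the contraction with `∇ℓ` from the third slot to the last one, where
  -- `lastAct` has it.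
  have : ∀ E, γ c 0 E * Rm ![a, b, E, d] = -(γ c 0 E * Rm ![a, b, d, E]) := fun E => by
    rw [G.symm.swap a b d E]; ring
  simp only [this, Finset.sum_neg_distrib]
  simp
  ring

/-- The second Bianchi identity with one of its three derivatives along `ℓ`. The other two then fall
on curvature components that contain an `ℓ`. -/
lemma nab_riem : nab (e 0) (γ 0) Rm =
    (fun A => insertGrad e γ Rm (A ∘ Equiv.swap 2 3)) - insertGrad e γ Rm := by
  ext A
  rw [eta_four A]
  have h1 := G.bianchi (A 0) (A 1) (A 2) (A 3) 0
  have h2 : nab (e (A 2)) (γ (A 2)) Rm ![A 0, A 1, A 3, 0] =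
      -nab (e (A 2)) (γ (A 2)) Rm ![A 0, A 1, 0, A 3] := by
    have h3 : (fun A => Rm (A ∘ Equiv.swap 2 3)) = -Rm := funext G.swap
    have h4 := nab_perm (Equiv.swap 2 3) (e (A 2)) (γ (A 2)) Rm ![A 0, A 1, 0, A 3]
    rw [h3, nab_sub_eq_add, comp_swap_four] at h4
    rw [← h4]; rfl
  rw [h2, G.nab_insertL_apply, G.nab_insertL_apply] at h1
  simp only [Pi.sub_apply, comp_swap_four]
  linear_combination h1

/-- The part of `∇_ℓ(Riem)` that the Bianchi identity controls. -/
lemma ord_iterate_succ {J : ℕ} (h : Fil (Ord wt) (nab (e 0) (γ 0)) J 0 Rm)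
    (a b c d : Fin 4) (hc : c ≠ 0) (hd : d ≠ 0) (hw : -(J + 1 : ℤ) < wt ![a, b, c, d]) :
    (nab (e 0) (γ 0))^[J + 1] Rm ![a, b, c, d] = 0 := by
  -- The `ℓ` in the third slot uses up a unit of weight, hence order -1. The weight `wtLast` keeps
  -- all `J` derivatives available.
  have hY : Fil (Ord wtLast) (nab (e 0) (γ 0)) J (-1)
      (insertGrad e γ Rm) := by
    refine Fil.add Ord.add (nab_add _ _) (G.fil_nabla_last h (G.fil_insertL h)) ?_
    have := (G.fil_lastAct (k := 3) h h).wtLast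
    simpa using this
  have hit := hY.iterate
  rw [Function.iterate_succ_apply, G.nab_riem, nab_iterate_sub, nab_iterate_perm]
  simp only [Pi.sub_apply, comp_swap_four]
  have hl : ∀ c, c ≠ 0 → min (boostWeight c) 0 = boostWeight c := fun c hc =>
    min_eq_left (by
      have : ¬ 1 ≤ boostWeight c := fun h => hc (boostWeight_eq_one h)
      omega)
  -- Both `c` and `d` occur as the last index, in one Bianchi term each. Neither is `ℓ`, so the two
  -- notions of weight coincide there.
  have h3 : ∀ c d, d ≠ 0 → wtLast (k := 3) ![a, b, c, d] = wt ![a, b, c, d] := fun c d hd => by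
    have h1 := wtLast_snoc ![a, b, c] d
    have h2 := wt_snoc ![a, b, c] d
    rw [snoc_three] at h1 h2
    rw [h1, h2, hl d hd]
  rw [hit _ (by rw [h3 _ _ hc]; rw [wt_four] at *; linarith),
    hit _ (by rw [h3 _ _ hd]; linarith), sub_zero]

/-- The Bianchi identity extends the chain for all components except those with an `ℓ` in each pair,
and those are settled by the fixed order -1 of all derivatives. -/
lemma fil_riem (h0 : Ord wt 0 Rm) (h1 : Ord wt (-1) (nab (e 0) (γ 0) Rm)) (J : ℕ) :
    Fil (Ord wt) (nab (e 0) (γ 0)) J 0 Rm := by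
  -- The order -1 of the first derivative is never lost, since `∇_ℓ` does not raise the order.
  have hbase : ∀ J, Ord wt (-1) ((nab (e 0) (γ 0))^[J + 1] Rm) := fun J => by
    induction J with
    | zero => simpa using h1
    | succ J ih => rw [Function.iterate_succ_apply']; exact G.ord_nab_zero ih
  induction J with
  | zero => exact h0
  | succ J ih =>
    refine ih.succ_of_iterate ((G.iterate_symm (J + 1)).ord (fun a b c d hc hd hw => ?_)
      fun b d hb hd hw => ?_)
    · exact G.ord_iterate_succ ih a b c d hc hd (by linarith)
    -- The weight of `ℓbℓd` is at least `2 - 1 - 1 = 0`, so order -1 suffices however large `J` is.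
    · refine hbase J _ ?_
      rw [wt_four]
      have := (boostWeight_mem b).1
      have := (boostWeight_mem d).1
      simp [boostWeight] at *
      omega

end IsKinematicGeometry

/-- The iterated covariant derivatives of a tensor. -/
def nablaIter (e : Fin 4 → Derivation ℝ R R) (γ : Fin 4 → Matrix (Fin 4) (Fin 4) R)
    (T : (Fin 4 → Fin 4) → R) : (n : ℕ) → (Fin (4 + n) → Fin 4) → R
  | 0 => T
  | n + 1 => nabla e γ (nablaIter e γ T n)

namespace IsKinematicGeometry

variable (G : IsKinematicGeometry e γ s Rm)
include G

/-- If the curvature and its first covariant derivative have no components of positive boost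
weight, the same holds for all covariant derivatives. -/
theorem ord_nablaIter (h0 : Ord wt 0 Rm) (h1 : Ord wt 0 (nabla e γ Rm)) (n : ℕ) :
    Ord wt 0 (nablaIter e γ Rm n) := by
  have hR := G.fil_riem h0 (ord_nab_of_nabla h1)
  -- All lengths are treated at once, because every `∇` shortens the chain by one.
  have : ∀ J, Fil (Ord wt) (nab (e 0) (γ 0)) J 0 (nablaIter e γ Rm n) := by
    induction n with
    | zero => exact hR
    | succ n ih => exact fun J => G.fil_nabla (hR J) (ih (J + 1))
  exact this 0

/-- In each product of two connection coefficients the weights add up to the weight of the entry, so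
one factor has positive weight and vanishes. In the derivative terms the coefficient misses the
weight of the differentiating vector; it still has positive weight unless that vector is `ℓ` and the
total is only 1. -/
lemma curv_eq_zero {C D A E : Fin 4} (hC : C ≠ 0 ∨
      2 ≤ boostWeight C + boostWeight D + boostWeight A - boostWeight E)
    (hD : D ≠ 0 ∨ 2 ≤ boostWeight C + boostWeight D + boostWeight A - boostWeight E)
    (hw : 1 ≤ boostWeight C + boostWeight D + boostWeight A - boostWeight E) :
    curv e γ C D A E = 0 := by
  have hb : ∀ C, C ≠ 0 → boostWeight C ≤ 0 := fun c hc => by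
      have : ¬ 1 ≤ boostWeight c := fun h => hc (boostWeight_eq_one h)
      omega
  have hC' : boostWeight C < boostWeight C + boostWeight D + boostWeight A - boostWeight E := by
    have := (boostWeight_mem C).2
    rcases hC with h | h
    · have := hb _ h; omega
    · omega
  have hD' : boostWeight D < boostWeight C + boostWeight D + boostWeight A - boostWeight E := by
    have := (boostWeight_mem D).2
    rcases hD with h | h
    · have := hb _ h; omega
    · omega
  have h1 : ∀ C D, 1 ≤ boostWeight C + boostWeight D + boostWeight A - boostWeight E →
      (γ C * γ D) A E = 0 := fun C D hw => by
    rw [Matrix.mul_apply]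
    refine Finset.sum_eq_zero fun F _ => ?_
    by_cases hF : 0 < boostWeight C + boostWeight A - boostWeight F
    · rw [G.kin _ _ _ hF, zero_mul]
    · rw [G.kin D F E (by omega), mul_zero]
  have h2 : ∀ C D F, 1 ≤ boostWeight C + boostWeight D + boostWeight A - boostWeight E →
      γ C D F * γ F A E = 0 := fun C D F hw => by
    by_cases hF : 0 < boostWeight C + boostWeight D - boostWeight F
    · rw [G.kin _ _ _ hF, zero_mul]
    · rw [G.kin F A E (by omega), mul_zero]
  simp only [curv, Matrix.sub_apply, dm_apply, h1 C D hw, h1 D C (by omega), Matrix.sum_apply,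
    Matrix.smul_apply, smul_eq_mul, sub_mul, h2 C D _ hw, h2 D C _ (by omega),
    G.kin D A E (by omega), G.kin C A E (by omega), map_zero, sub_zero, Finset.sum_const_zero]

/-- In a kinematic frame only the components `R_{ℓnℓm}` of the curvature prevent type II. -/
lemma ord_riem (h : ∀ d, boostWeight d = 0 → Rm ![0, 1, 0, d] = 0) : Ord wt 0 Rm := by
  refine G.symm.ord (fun a b c d hc hd hw => ?_) fun b d hb hd hw => ?_
  · rw [G.riem, G.curv_eq_zero (Or.inl hc) (Or.inl hd), mul_zero]
    rw [wt_four] at hw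
    rw [boostWeight_sw]
    omega
  -- Of the components `ℓbℓd` this leaves those of weight 1, which have one `n` and one `m` or `m̄`
  -- in the free slots.
  · have h2 : ∀ b d, 2 ≤ wt ![0, b, 0, d] → Rm ![0, b, 0, d] = 0 := fun b d hw => by
      rw [wt_four] at hw
      rw [G.riem, G.curv_eq_zero (Or.inr ?_) (Or.inr ?_), mul_zero] <;>
      (rw [boostWeight_sw]; omega)
    rw [wt_four] at hw
    have hb1 : ∀ b, b = 0 ∨ b = 1 ∨ boostWeight b = 0 := by decide
    rcases hb1 b with rfl | rfl | hb'
    · exact absurd rfl hb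
    · rcases hb1 d with rfl | rfl | hd'
      · exact absurd rfl hd
      · simp [boostWeight] at hw
      · exact h d hd'
    · rcases hb1 d with rfl | rfl | hd'
      · exact absurd rfl hd
      · rw [← G.symm.pair]; exact h b hb'
      · exact h2 _ _ (by rw [wt_four, hb', hd']; simp [boostWeight])

/-- All connection terms drop out. Those of `ℓ` vanish by `∇_ℓ ℓ = 0`. In those of `n`, the part
along `ℓ` dies by antisymmetry, the part along `m, m̄` because it multiplies a component of weight
1, and the part along `n` because its coefficient has weight 1. -/
lemma nab_riem_special (h0 : Ord wt 0 Rm) :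
    nab (e 0) (γ 0) Rm ![0, 1, 0, 1] = e 0 (Rm ![0, 1, 0, 1]) := by
  have h1 : ∀ E, γ 0 1 E * Rm ![0, E, 0, 1] = 0 := fun E => by
    by_cases hE : 0 ≤ boostWeight E
    · by_cases hE' : E = 0
      · rw [hE', G.symm.self', mul_zero]
      by_cases hE2 : boostWeight E = 0
      · rw [h0 _ (by rw [wt_four, hE2]; simp [boostWeight]), mul_zero]
      · exact absurd (boostWeight_eq_one (by omega)) hE'
    · rw [G.kin _ _ _ (by simp [boostWeight] at *; omega), zero_mul]
  have h2 : ∀ E, γ 0 1 E * Rm ![0, 1, 0, E] = 0 := fun E => by rw [← G.symm.pair]; exact h1 E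
  simp only [nab_apply, act_four, h1, h2, G.conn_zero_zero, zero_mul, Finset.sum_const_zero,
    add_zero, sub_zero]

lemma nab_riem_symm : HasRiemannSymm (nab (e 0) (γ 0) Rm) := G.iterate_symm 1

/-- If the curvature is of type II, only `D R_{ℓnℓn}` prevents its derivative from being so. -/
lemma ord_nabla_riem (h0 : Ord wt 0 Rm) (h : e 0 (Rm ![0, 1, 0, 1]) = 0) :
    Ord wt 0 (nabla e γ Rm) := by
  refine G.ord_nabla h0 (G.nab_riem_symm.ord (fun a b c d hc hd hw => ?_) fun b d hb hd hw => ?_)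
  -- Only the curvature itself, and no derivative of it, enters the first step of the Bianchi
  -- induction.
  · exact G.ord_iterate_succ (J := 0) h0 a b c d hc hd (by simpa using hw)
  · by_cases hw' : 0 < wt ![0, b, 0, d]
    · exact G.ord_nab_zero h0 _ hw'
    -- A component `ℓbℓd` of weight at most 0 must be `ℓnℓn`.
    have h1 : b = 1 ∧ d = 1 := by
      rw [wt_four] at hw'
      revert b d
      decide
    rw [h1.1, h1.2, G.nab_riem_special h0, h]

end IsKinematicGeometry

end

end Kundt

/-! ### Levi-Civita connections and the symmetries of their curvature. -/

namespace Kundt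

section

variable {R : Type*} [CommRing R] [Algebra ℝ R] {k : ℕ}

/-- The Levi-Civita connection of a metric in a frame of commuting derivations. -/
structure IsLeviCivita (p : Fin 4 → Derivation ℝ R R) (g : Matrix (Fin 4) (Fin 4) R)
    (Γ : Fin 4 → Matrix (Fin 4) (Fin 4) R) : Prop where
  comm : ∀ c d f, p c (p d f) = p d (p c f)
  metric_symm : gᵀ = g
  conn_symm : ∀ a b c, Γ a b c = Γ b a c
  compat : ∀ c, dm (p c) g = Γ c * g + (Γ c * g)ᵀ

/-- The curvature tensor with all indices lowered. -/
def lowCurv (p : Fin 4 → Derivation ℝ R R) (g : Matrix (Fin 4) (Fin 4) R)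
    (Γ : Fin 4 → Matrix (Fin 4) (Fin 4) R) : (Fin 4 → Fin 4) → R := fun A =>
  (curv p Γ (A 2) (A 3) * g) (A 1) (A 0)

lemma lowCurv_apply (p : Fin 4 → Derivation ℝ R R) (g : Matrix (Fin 4) (Fin 4) R)
    (Γ : Fin 4 → Matrix (Fin 4) (Fin 4) R) (a b c d : Fin 4) :
    lowCurv p g Γ ![a, b, c, d] = (curv p Γ c d * g) b a := rfl

namespace IsLeviCivita

variable {p : Fin 4 → Derivation ℝ R R} {g : Matrix (Fin 4) (Fin 4) R}
  {Γ : Fin 4 → Matrix (Fin 4) (Fin 4) R} (h : IsLeviCivita p g Γ)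
include h

lemma curv_eq (c d : Fin 4) :
    curv p Γ c d = dm (p c) (Γ d) - dm (p d) (Γ c) - (Γ c * Γ d - Γ d * Γ c) := by
  simp [curv, h.conn_symm c d]

lemma curv_swap (c d : Fin 4) : curv p Γ d c = -curv p Γ c d := by
  rw [h.curv_eq, h.curv_eq]; abel

lemma dm_comm (c d : Fin 4) (M : Matrix (Fin 4) (Fin 4) R) :
    dm (p c) (dm (p d) M) = dm (p d) (dm (p c) M) := by
  ext a b; simp [h.comm c d]

/-- Second partial derivatives of `g` commute. When they are expanded by metric compatibility, their
difference is the lowered curvature plus its transpose. -/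
lemma curv_antisymm (c d : Fin 4) : (curv p Γ c d * g)ᵀ = -(curv p Γ c d * g) := by
  have h1 : ∀ c d, dm (p c) (dm (p d) g) = (dm (p c) (Γ d) * g + Γ d * (Γ c * g + g * (Γ c)ᵀ)) +
      (dm (p c) (Γ d) * g + Γ d * (Γ c * g + g * (Γ c)ᵀ))ᵀ := fun c d => by
    rw [h.compat d, dm_add, dm_transpose, dm_mul, h.compat c, Matrix.transpose_mul (Γ c),
      h.metric_symm]
  have h2 := h.dm_comm c d g
  rw [h1, h1, ← sub_eq_zero] at h2
  rw [← sub_eq_zero, sub_neg_eq_add, ← h2, h.curv_eq]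
  simp only [Matrix.transpose_add, Matrix.transpose_mul, h.metric_symm, Matrix.transpose_sub,
    Matrix.transpose_transpose]
  noncomm_ring

lemma first_bianchi (b c d e : Fin 4) :
    curv p Γ c d b e + curv p Γ d b c e + curv p Γ b c d e = 0 := by
  simp only [h.curv_eq, Matrix.sub_apply, dm_apply, Matrix.mul_apply]
  simp only [h.conn_symm b c, h.conn_symm d c, h.conn_symm d b]
  ring

lemma lowCurv_swap (a b c d : Fin 4) :
    lowCurv p g Γ ![a, b, d, c] = -lowCurv p g Γ ![a, b, c, d] := by
  simp only [lowCurv_apply, h.curv_swap c d, Matrix.neg_mul, Matrix.neg_apply]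

lemma lowCurv_swap' (a b c d : Fin 4) :
    lowCurv p g Γ ![b, a, c, d] = -lowCurv p g Γ ![a, b, c, d] := by
  exact congrFun (congrFun (h.curv_antisymm c d) b) a

lemma lowCurv_cyclic (a b c d : Fin 4) :
    lowCurv p g Γ ![a, b, c, d] + lowCurv p g Γ ![a, c, d, b] + lowCurv p g Γ ![a, d, b, c] = 0 := by
  simp only [lowCurv_apply, Matrix.mul_apply, ← Finset.sum_add_distrib, ← add_mul]
  exact Finset.sum_eq_zero fun E _ => by rw [h.first_bianchi, zero_mul]

lemma lowCurv_pair (a b c d : Fin 4) :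
    lowCurv p g Γ ![c, d, a, b] = lowCurv p g Γ ![a, b, c, d] := by
  rw [← sub_eq_zero]
  refine two_mul_eq_zero_of ?_
  -- The classical argument: the four cyclic identities and the antisymmetry in each pair imply the
  -- pair symmetry.
  have h1 := h.lowCurv_cyclic a b c d
  have h2 := h.lowCurv_cyclic b c d a
  have h3 := h.lowCurv_cyclic c d a b
  have h4 := h.lowCurv_cyclic d a b c
  have e1 := h.lowCurv_swap' a c d b
  have e2 := h.lowCurv_swap' a d b c
  have e3 := h.lowCurv_swap' b d a c
  have e4 := h.lowCurv_swap' b c d a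
  have f1 := h.lowCurv_swap a b c d
  have f2 := h.lowCurv_swap' a b d c
  have f3 := h.lowCurv_swap c d a b
  have f4 := h.lowCurv_swap' c d b a
  have g1 := h.lowCurv_swap c a b d
  have g2 := h.lowCurv_swap d a b c
  have g3 := h.lowCurv_swap b d a c
  have g4 := h.lowCurv_swap b c a d
  have g5 := h.lowCurv_swap a c b d
  have g6 := h.lowCurv_swap' a d c b
  have g7 := h.lowCurv_swap' b d c a
  have g8 := h.lowCurv_swap a d b c
  have g9 := h.lowCurv_swap b d c a
  have i1 := h.lowCurv_swap b a c d
  have i2 := h.lowCurv_swap d c a b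
  have i3 := h.lowCurv_swap' a c b d
  have i4 := h.lowCurv_swap' b c a d
  grind

/-- The Jacobi identity for the three covariant derivatives, before the two form indices are
differentiated covariantly. -/
lemma second_bianchi_matrix (c d f : Fin 4) :
    (dm (p f) (curv p Γ c d) + curv p Γ c d * Γ f - Γ f * curv p Γ c d) +
    (dm (p c) (curv p Γ d f) + curv p Γ d f * Γ c - Γ c * curv p Γ d f) +
    (dm (p d) (curv p Γ f c) + curv p Γ f c * Γ d - Γ d * curv p Γ f c) = 0 := by
  simp only [h.curv_eq, dm_sub, dm_mul, h.dm_comm f c, h.dm_comm f d, h.dm_comm d c]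
  noncomm_ring

/-- Metric compatibility turns the terms of the slots `a, b` into a commutator with `Γ f`. The terms
of the form indices `c, d` stay apart; they cancel in the cyclic sum because the connection is
symmetric. -/
lemma nab_lowCurv (a b c d f : Fin 4) : nab (p f) (Γ f) (lowCurv p g Γ) ![a, b, c, d] =
    ((dm (p f) (curv p Γ c d) + curv p Γ c d * Γ f - Γ f * curv p Γ c d) * g) b a -
      (∑ E, Γ f c E * lowCurv p g Γ ![a, b, E, d]) -
      ∑ E, Γ f d E * lowCurv p g Γ ![a, b, c, E] := by
  have h1 : (dm (p f) (curv p Γ c d) + curv p Γ c d * Γ f - Γ f * curv p Γ c d) * g =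
      dm (p f) (curv p Γ c d * g) - Γ f * (curv p Γ c d * g) - (curv p Γ c d * g) * (Γ f)ᵀ := by
    rw [dm_mul, h.compat, Matrix.transpose_mul, h.metric_symm]
    noncomm_ring
  have h2 : (Γ f * (curv p Γ c d * g)) b a = ∑ E, Γ f b E * lowCurv p g Γ ![a, E, c, d] := rfl
  have h3 : (curv p Γ c d * g * (Γ f)ᵀ) b a = ∑ E, Γ f a E * lowCurv p g Γ ![E, b, c, d] := by
    rw [Matrix.mul_apply]
    exact Finset.sum_congr rfl fun E _ => mul_comm _ _
  rw [h1, nab_apply, act_four, Matrix.sub_apply, Matrix.sub_apply, h2, h3, dm_apply,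
    ← lowCurv_apply]
  ring

lemma second_bianchi (a b c d f : Fin 4) :
    nab (p f) (Γ f) (lowCurv p g Γ) ![a, b, c, d] + nab (p c) (Γ c) (lowCurv p g Γ) ![a, b, d, f] +
      nab (p d) (Γ d) (lowCurv p g Γ) ![a, b, f, c] = 0 := by
  have h0 : _ = 0 * g := congrArg (fun M : Matrix (Fin 4) (Fin 4) R => M * g)
    (h.second_bianchi_matrix c d f)
  rw [Matrix.zero_mul] at h0
  have h1 := congrFun (congrFun h0 b) a
  simp only [Matrix.add_mul, Matrix.add_apply, Matrix.zero_apply] at h1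
  simp only [h.nab_lowCurv]
  have h2 : ∀ c d f, ∑ E, Γ c d E * lowCurv p g Γ ![a, b, f, E] =
      - ∑ E, Γ d c E * lowCurv p g Γ ![a, b, E, f] := fun c d f => by
    rw [← Finset.sum_neg_distrib]
    exact Finset.sum_congr rfl fun E _ => by rw [h.lowCurv_swap, h.conn_symm c d]; ring
  rw [h2 f d, h2 c f, h2 d c]
  linear_combination h1

end IsLeviCivita

/-! ### Change of frame. -/

section Frame

variable (p : Fin 4 → Derivation ℝ R R) (Γ : Fin 4 → Matrix (Fin 4) (Fin 4) R)
  (E Ei : Matrix (Fin 4) (Fin 4) R)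

/-- The directional derivatives of a frame. -/
def frameDeriv (C : Fin 4) : Derivation ℝ R R := ∑ c, E C c • p c

/-- The connection in a frame with inverse matrix `Ei`. -/
def frameConn (C : Fin 4) : Matrix (Fin 4) (Fin 4) R :=
  (dm (frameDeriv p E C) E + E * ∑ c, E C c • Γ c) * Ei

variable {p Γ E Ei}

lemma frameDeriv_apply (C : Fin 4) (f : R) : frameDeriv p E C f = ∑ c, E C c * p c f := by
  have h1 : frameDeriv p E C f = ∑ c, (E C c • p c) f := by
    rw [frameDeriv]
    exact congrFun (map_sum (Derivation.coeFnAddMonoidHom (R := ℝ) (A := R) (M := R))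
      (fun c => E C c • p c) Finset.univ) f |>.trans (by simp [Finset.sum_apply])
  rw [h1]; rfl

/-- The connection in the frame is defined so that this holds; it is the hypothesis of `nab_trans`.
-/
lemma dm_frame (hE : Ei * E = 1) (C : Fin 4) : dm (frameDeriv p E C) E =
    frameConn p Γ E Ei C * E - E * ∑ c, E C c • Γ c := by
  rw [frameConn, Matrix.mul_assoc _ Ei, hE, Matrix.mul_one, add_sub_cancel_right]

lemma trans_snoc (T : (Fin (k + 1) → Fin 4) → R) (A : Fin k → Fin 4) (C : Fin 4) :
    trans E T (Fin.snoc A C) = ∑ c, E C c * trans E (fun b => T (Fin.snoc b c)) A := by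
  simp only [trans, Finset.mul_sum]
  rw [← Fintype.sum_prod_type']
  refine (Fintype.sum_equiv (Fin.snocEquiv fun _ : Fin (k + 1) => Fin 4) _ _ fun x => ?_).symm
  simp only [Fin.snocEquiv, Equiv.coe_fn_mk, Fin.prod_univ_castSucc, Fin.snoc_castSucc,
    Fin.snoc_last]
  ring

lemma nab_frameDeriv (C : Fin 4) (T : (Fin k → Fin 4) → R) :
    nab (frameDeriv p E C) (∑ c, E C c • Γ c) T = ∑ c, E C c • nab (p c) (Γ c) T := by
  ext A
  simp only [nab_apply, frameDeriv_apply, act_sum_left, act_smul_left, Finset.sum_apply,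
    Pi.smul_apply, smul_eq_mul, mul_sub, Finset.sum_sub_distrib]

lemma trans_nabla (hE : Ei * E = 1) (T : (Fin k → Fin 4) → R) :
    nabla (frameDeriv p E) (frameConn p Γ E Ei) (trans E T) = trans E (nabla p Γ T) := by
  refine ext_snoc fun A C => ?_
  rw [nabla_snoc, nab_trans _ _ _ _ (dm_frame (Γ := Γ) hE C), nab_frameDeriv, trans_snoc]
  simp only [nabla_snoc, trans, Finset.sum_apply, Pi.smul_apply, smul_eq_mul, Finset.sum_mul,
    Finset.mul_sum]
  rw [Finset.sum_comm]
  exact Finset.sum_congr rfl fun b _ => Finset.sum_congr rfl fun c _ => by ring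

lemma trans_perm (σ : Equiv.Perm (Fin k)) (T : (Fin k → Fin 4) → R) (A : Fin k → Fin 4) :
    trans E (fun b => T (b ∘ σ)) A = trans E T (A ∘ σ) := by
  refine Fintype.sum_equiv (Equiv.arrowCongr σ.symm (Equiv.refl _)) _ _ fun b => ?_
  simp only [Equiv.arrowCongr_apply, Function.comp_apply]
  congr 1
  exact (Equiv.prod_comp σ (fun i => E (A i) (b i))).symm

lemma trans_one (T : (Fin 1 → Fin 4) → R) (B : Fin 4) :
    trans E T ![B] = ∑ b, E B b * T ![b] := by
  refine Fintype.sum_equiv (Equiv.funUnique (Fin 1) (Fin 4)) _ _ fun b => ?_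
  have : b = ![b 0] := by ext i; fin_cases i; rfl
  rw [this]
  simp [mul_comm]

lemma trans_two (T : (Fin 2 → Fin 4) → R) (B C : Fin 4) :
    trans E T ![B, C] = ∑ c, E C c * ∑ b, E B b * T ![b, c] := by
  have h : ∀ b c : Fin 4, ![b, c] = Fin.snoc ![b] c := fun b c => by
    ext i; fin_cases i <;> rfl
  simp only [h, trans_snoc]
  exact Finset.sum_congr rfl fun c _ => by rw [trans_one]

lemma nabla_pair (e : Fin 4 → Derivation ℝ R R) (γ : Fin 4 → Matrix (Fin 4) (Fin 4) R)
    (T : (Fin 1 → Fin 4) → R) (B C : Fin 4) :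
    nabla e γ T ![B, C] = e C (T ![B]) - ∑ E, γ C B E * T ![E] := by
  have h : (![B, C] : Fin 2 → Fin 4) = Fin.snoc ![B] C := by
    ext i; fin_cases i <;> rfl
  have h2 : ∀ E, Function.update ![B] 0 E = ![E] := fun E => by
    ext i; fin_cases i; rfl
  rw [h, nabla_snoc, nab_apply]
  simp [act, h2]

lemma trans_four (T : (Fin 4 → Fin 4) → R) (A B C D : Fin 4) : trans E T ![A, B, C, D] =
    ∑ d, E D d * ∑ c, E C c * ∑ b, E B b * ∑ a, E A a * T ![a, b, c, d] := by
  have h1 : trans E T ![A, B, C, D] = trans E T (Fin.snoc (Fin.snoc (Fin.snoc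
      (Fin.snoc Fin.elim0 A : Fin 1 → Fin 4) B : Fin 2 → Fin 4) C : Fin 3 → Fin 4) D) := by
    congr 1; ext i; fin_cases i <;> rfl
  have h2 : ∀ a b c d, (Fin.snoc (Fin.snoc (Fin.snoc
      (Fin.snoc Fin.elim0 a : Fin 1 → Fin 4) b : Fin 2 → Fin 4) c : Fin 3 → Fin 4) d) =
      ![a, b, c, d] := fun a b c d => by
    ext i; fin_cases i <;> rfl
  rw [h1]
  simp only [trans_snoc]
  refine Finset.sum_congr rfl fun d _ => ?_
  congr 1
  refine Finset.sum_congr rfl fun c _ => ?_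
  congr 1
  refine Finset.sum_congr rfl fun b _ => ?_
  congr 1
  refine Finset.sum_congr rfl fun a _ => ?_
  congr 1
  rw [← h2]
  simp only [trans, Finset.univ_unique, Finset.sum_singleton, Finset.univ_eq_empty,
    Finset.prod_empty, mul_one]
  congr 5

/-- The matrix of scalar products of a null tetrad. -/
def eta (s : Fin 4 → R) : Matrix (Fin 4) (Fin 4) R :=
  Matrix.of fun A B => if B = sw A then s A else 0

lemma mul_eta {s : Fin 4 → R} (hs : ∀ A, s (sw A) = s A) (M : Matrix (Fin 4) (Fin 4) R)
    (A B : Fin 4) : (M * eta s) A B = s B * M A (sw B) := by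
  rw [Matrix.mul_apply, Finset.sum_eq_single (sw B)]
  · simp [eta, hs, mul_comm]
  · intro F _ hF
    have : B ≠ sw F := fun h => hF (by rw [h, sw_sw])
    simp [eta, this]
  · simp

variable {g : Matrix (Fin 4) (Fin 4) R}

namespace IsLeviCivita

variable (h : IsLeviCivita p g Γ)
include h

/-- In the difference of the two derivatives of the frame the coordinate connection cancels by its
symmetry. -/
lemma frame_bracket (hE : Ei * E = 1) (C D d : Fin 4) :
    frameDeriv p E C (E D d) - frameDeriv p E D (E C d) =
      ∑ G, (frameConn p Γ E Ei C D G - frameConn p Γ E Ei D C G) * E G d := by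
  have h1 := fun C D => congrFun (congrFun (dm_frame (p := p) (Γ := Γ) hE C) D) d
  simp only [dm_apply, Matrix.sub_apply, Matrix.mul_apply, Matrix.sum_apply, Matrix.smul_apply,
    smul_eq_mul] at h1
  rw [h1, h1]
  simp only [sub_mul, Finset.sum_sub_distrib]
  have h2 : ∑ j, E D j * ∑ c, E C c * Γ c j d = ∑ j, E C j * ∑ c, E D c * Γ c j d := by
    simp only [Finset.mul_sum]
    rw [Finset.sum_comm]
    exact Finset.sum_congr rfl fun a _ => Finset.sum_congr rfl fun b _ => by
      rw [h.conn_symm a b]; ring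
  rw [h2]; ring

/-- The second-order parts of the two compositions agree because partial derivatives commute; the
first-order parts are `frame_bracket`. -/
lemma torsionFree (hE : Ei * E = 1) :
    TorsionFree (frameDeriv p E) (frameConn p Γ E Ei) := fun C D f => by
  have h1 : ∀ C D, frameDeriv p E C (frameDeriv p E D f) =
      ∑ d, frameDeriv p E C (E D d) * p d f + ∑ c, ∑ d, E C c * E D d * p c (p d f) :=
    fun C D => by
      rw [frameDeriv_apply D, map_sum]
      simp only [Derivation.leibniz, smul_eq_mul, Finset.sum_add_distrib]
      rw [add_comm]
      congr 1
      · exact Finset.sum_congr rfl fun _ _ => mul_comm _ _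
      · simp only [frameDeriv_apply, Finset.mul_sum]
        rw [Finset.sum_comm]
        exact Finset.sum_congr rfl fun a _ => Finset.sum_congr rfl fun b _ => by ring
  have h2 : ∑ c, ∑ d, E C c * E D d * p c (p d f) = ∑ c, ∑ d, E D c * E C d * p c (p d f) := by
    rw [Finset.sum_comm]
    exact Finset.sum_congr rfl fun a _ => Finset.sum_congr rfl fun b _ => by
      rw [h.comm b a]; ring
  rw [h1, h1, h2, add_sub_add_right_eq_sub, ← Finset.sum_sub_distrib]
  simp only [← sub_mul, h.frame_bracket hE]
  simp only [frameDeriv_apply, Finset.sum_mul, Finset.mul_sum]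
  rw [Finset.sum_comm]
  exact Finset.sum_congr rfl fun a _ => Finset.sum_congr rfl fun b _ => by ring

/-- The curvature does not depend on the frame. -/
lemma curv_frame (hE : Ei * E = 1) (C D : Fin 4) :
    curv (frameDeriv p E) (frameConn p Γ E Ei) C D * E =
      E * ∑ c, ∑ d, (E C c * E D d) • curv p Γ c d := by
  set e := frameDeriv p E
  set γ := frameConn p Γ E Ei
  set Θ : Fin 4 → Matrix (Fin 4) (Fin 4) R := fun C => ∑ c, E C c • Γ c with hΘ
  have hd : ∀ C, dm (e C) E = γ C * E - E * Θ C := dm_frame (p := p) (Γ := Γ) hE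
  -- The commutator of two derivatives of the frame matrix is computed twice: by differentiating
  -- `hd`, and by the torsion formula. Comparison gives the transformation law.
  have h1 : ∀ C D, dm (e C) (dm (e D) E) =
      dm (e C) (γ D) * E + γ D * (γ C * E - E * Θ C) - (γ C * E - E * Θ C) * Θ D -
        E * dm (e C) (Θ D) := fun C D => by
    rw [hd D, dm_sub, dm_mul, dm_mul, hd C]; noncomm_ring
  have h2 : dm (e C) (dm (e D) E) - dm (e D) (dm (e C) E) =
      ∑ G, (γ C D G - γ D C G) • (γ G * E - E * Θ G) := by
    ext a b
    have := h.torsionFree hE C D (E a b)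
    simp only [← hd]
    simpa [Matrix.sum_apply] using this
  -- The derivatives of the coefficients in `Θ` give the bracket term, those of `Γ` the coordinate
  -- curvature up to the commutator of `Θ C` and `Θ D`.
  have h3 : dm (e C) (Θ D) - dm (e D) (Θ C) = (∑ c, ∑ d, (E C c * E D d) • curv p Γ c d) +
      (Θ C * Θ D - Θ D * Θ C) + ∑ G, (γ C D G - γ D C G) • Θ G := by
    have h4 : ∀ C D, dm (e C) (Θ D) = (∑ d, e C (E D d) • Γ d) +
        ∑ c, ∑ d, (E C c * E D d) • dm (p c) (Γ d) := fun C D => by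
      simp only [hΘ, dm_sum, dm_smul, Finset.sum_add_distrib]
      congr 1
      rw [Finset.sum_comm]
      refine Finset.sum_congr rfl fun d _ => ?_
      ext a b
      simp [e, frameDeriv_apply, Matrix.sum_apply, Finset.mul_sum, mul_left_comm, mul_assoc]
    have h5 : ∑ c, ∑ d, (E D c * E C d) • dm (p c) (Γ d) =
        ∑ c, ∑ d, (E C c * E D d) • dm (p d) (Γ c) := by
      rw [Finset.sum_comm]
      exact Finset.sum_congr rfl fun a _ => Finset.sum_congr rfl fun b _ => by rw [mul_comm]
    have h6 : ∑ d, e C (E D d) • Γ d - ∑ d, e D (E C d) • Γ d =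
        ∑ G, (γ C D G - γ D C G) • Θ G := by
      rw [← Finset.sum_sub_distrib]
      simp only [← sub_smul, e, h.frame_bracket hE, hΘ, Finset.smul_sum, Finset.sum_smul, smul_smul]
      rw [Finset.sum_comm]
    have h7 : Θ C * Θ D = ∑ c, ∑ d, (E C c * E D d) • (Γ c * Γ d) := by
      simp only [hΘ, Finset.sum_mul, Finset.mul_sum, Matrix.smul_mul, Matrix.mul_smul, smul_smul]
      rw [Finset.sum_comm]
      exact Finset.sum_congr rfl fun a _ => Finset.sum_congr rfl fun b _ => by
        rw [mul_comm (E D b)]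
    have h8 : Θ D * Θ C = ∑ c, ∑ d, (E C c * E D d) • (Γ d * Γ c) := by
      simp only [hΘ, Finset.sum_mul, Finset.mul_sum, Matrix.smul_mul, Matrix.mul_smul, smul_smul]
      try rw [Finset.sum_comm]
    rw [h4, h4, h5, h7, h8, ← h6]
    simp only [h.curv_eq, smul_sub, Finset.sum_sub_distrib]
    abel
  rw [h1, h1] at h2
  simp only [smul_sub, Finset.sum_sub_distrib] at h2
  have h9 : ∑ G, (γ C D G - γ D C G) • (γ G * E) = (∑ G, (γ C D G - γ D C G) • γ G) * E := by
    simp only [Finset.sum_mul, Matrix.smul_mul]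
  have h10 : ∑ G, (γ C D G - γ D C G) • (E * Θ G) = E * (∑ G, (γ C D G - γ D C G) • Θ G) := by
    simp only [Finset.mul_sum, Matrix.mul_smul]
  rw [h9, h10] at h2
  have h11 := congrArg (E * ·) h3
  simp only [mul_add, mul_sub] at h11
  rw [curv]
  rw [← sub_eq_zero] at h2 h11 ⊢
  rw [← add_zero (0 : Matrix (Fin 4) (Fin 4) R)]
  nth_rewrite 1 [← h2]
  rw [← h11]
  noncomm_ring

variable {s : Fin 4 → R}

/-- Differentiate the scalar products `E g Eᵀ`: they are constant, and the terms with the coordinate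
connection cancel by metric compatibility. -/
lemma frameConn_eta (hE : Ei * E = 1) (hη : E * g * Eᵀ = eta s) (hc : ∀ C A, p C (s A) = 0)
    (C : Fin 4) : (frameConn p Γ E Ei C * eta s)ᵀ = -(frameConn p Γ E Ei C * eta s) := by
  have h1 : dm (frameDeriv p E C) (eta s) = 0 := by
    ext A B
    simp only [dm_apply, eta, Matrix.of_apply, Matrix.zero_apply]
    split_ifs
    · simp [frameDeriv_apply, hc]
    · simp
  have h2 : dm (frameDeriv p E C) g = (∑ c, E C c • Γ c) * g + g * (∑ c, E C c • Γ c)ᵀ := by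
    have : ∀ c, dm (p c) g = Γ c * g + g * (Γ c)ᵀ := fun c => by
      rw [h.compat, Matrix.transpose_mul, h.metric_symm]
    have h3 : dm (frameDeriv p E C) g = ∑ c, E C c • dm (p c) g := by
      ext a b
      simp [frameDeriv_apply, Matrix.sum_apply]
    rw [h3]
    simp only [this, smul_add, Finset.sum_add_distrib, Matrix.transpose_sum, Matrix.transpose_smul,
      Finset.sum_mul, Finset.mul_sum, Matrix.smul_mul, Matrix.mul_smul]
  have h3 : (eta s)ᵀ = eta s := by
    rw [← hη]; simp [Matrix.transpose_mul, h.metric_symm, Matrix.mul_assoc]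
  rw [← sub_eq_zero, sub_neg_eq_add, ← h1, Matrix.transpose_mul, h3, ← hη, dm_mul, dm_mul,
    dm_transpose, h2, dm_frame (Γ := Γ) hE]
  simp only [Matrix.transpose_sub, Matrix.transpose_mul]
  noncomm_ring

/-- The curvature in a null frame with vanishing connection coefficients of positive weight. -/
theorem isKinematicGeometry (hE : Ei * E = 1) (hη : E * g * Eᵀ = eta s)
    (hc : ∀ C A, p C (s A) = 0) (hs : ∀ A, s (sw A) = s A) (hs2 : ∀ A, s A * s A = 1)
    (hkin : ∀ C A B, 0 < boostWeight C + boostWeight A - boostWeight B →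
      frameConn p Γ E Ei C A B = 0) :
    IsKinematicGeometry (frameDeriv p E) (frameConn p Γ E Ei) s (trans E (lowCurv p g Γ)) where
  torsion := h.torsionFree hE
  kin := hkin
  s_sq := hs2
  s_const C A := by simp [frameDeriv_apply, hc]
  s_sw := hs
  antisymm C A B := by
    have := congrFun (congrFun (h.frameConn_eta hE hη hc C) B) A
    rwa [Matrix.transpose_apply, Matrix.neg_apply, mul_eta hs, mul_eta hs] at this
  riem A B C D := by
    rw [← mul_eta hs, ← hη, Matrix.mul_assoc E, ← Matrix.mul_assoc _ E, h.curv_frame hE]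
    have h1 : E * (∑ c, ∑ d, (E C c * E D d) • curv p Γ c d) * (g * Eᵀ) =
        ∑ c, ∑ d, (E C c * E D d) • (E * (curv p Γ c d * g) * Eᵀ) := by
      simp only [Finset.sum_mul, Finset.mul_sum, Matrix.smul_mul, Matrix.mul_smul,
        Matrix.mul_assoc]
    rw [h1, trans_four]
    simp only [Matrix.sum_apply, Matrix.smul_apply, smul_eq_mul]
    rw [Finset.sum_comm]
    refine Finset.sum_congr rfl fun d _ => ?_
    rw [Finset.mul_sum]
    refine Finset.sum_congr rfl fun c _ => ?_
    have h2 : ∀ M : Matrix (Fin 4) (Fin 4) R, (E * M * Eᵀ) B A =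
        ∑ b, E B b * ∑ a, E A a * M b a := fun M => by
      rw [Matrix.mul_assoc, Matrix.mul_apply]
      simp only [Matrix.mul_apply, Matrix.transpose_apply, mul_comm (M _ _)]
    rw [h2]
    simp only [lowCurv_apply]
    ring
  swap A := by
    have h1 : (fun b => lowCurv p g Γ (b ∘ Equiv.swap 2 3)) = fun b => -lowCurv p g Γ b := by
      ext b
      rw [eta_four b, comp_swap_four, h.lowCurv_swap]
    rw [← trans_perm, h1]
    simp [trans]
  pair A := by
    have h1 : (fun b => lowCurv p g Γ (b ∘ pairSwap)) = lowCurv p g Γ := by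
      ext b
      rw [eta_four b, comp_pairSwap, h.lowCurv_pair]
    rw [← trans_perm, h1]
  bianchi a b c d f := by
    have h0 : ∀ a b c d f, nab (frameDeriv p E f) (frameConn p Γ E Ei f)
        (trans E (lowCurv p g Γ)) ![a, b, c, d] =
        trans E (nabla p Γ (lowCurv p g Γ)) ![a, b, c, d, f] := fun a b c d f => by
      rw [← trans_nabla hE, ← nabla_snoc]
      congr 1
      ext i; fin_cases i <;> rfl
    -- The cyclic permutation of the last three slots. It moves the three Bianchi terms to one
    -- common component, so that the coordinate identity can be used under a single sum.
    let σ : Equiv.Perm (Fin 5) := Equiv.swap 2 3 * Equiv.swap 3 4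
    have h1 : ∀ a b c d f : Fin 4, ![a, b, c, d, f] ∘ σ = ![a, b, d, f, c] := fun a b c d f => by
      ext i; fin_cases i <;> rfl
    have h2 : ∀ a b c d f, nabla p Γ (lowCurv p g Γ) ![a, b, c, d, f] =
        nab (p f) (Γ f) (lowCurv p g Γ) ![a, b, c, d] := fun a b c d f => by
      rw [← nabla_snoc]
      congr 1
      ext i; fin_cases i <;> rfl
    rw [h0, h0, h0, ← h1 a b c d f, ← h1 a b d f c, ← h1 a b c d f, ← trans_perm, ← trans_perm,
      ← trans_perm]
    simp only [trans, ← Finset.sum_add_distrib, ← add_mul]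
    refine Finset.sum_eq_zero fun x _ => ?_
    have h3 : x = ![x 0, x 1, x 2, x 3, x 4] := by ext i; fin_cases i <;> rfl
    rw [h3]
    simp only [h1]
    rw [h2, h2, h2, h.second_bianchi, zero_mul]

end IsLeviCivita

end Frame

end

end Kundt

/-! ### Smooth functions on the patch as an algebra with commuting derivations. -/

noncomputable section

namespace Kundt

section PartialDerivative

variable {V : Type} [NormedAddCommGroup V] [NormedSpace ℝ V] {U : Set Coord}

lemma pd_congr (hU : IsOpen U) {f f' : Coord → V} (h : ∀ x ∈ U, f x = f' x) (a : Fin 4)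
    {x : Coord} (hx : x ∈ U) : pd a f x = pd a f' x := by
  have : f =ᶠ[nhds x] f' := Filter.eventuallyEq_of_mem (hU.mem_nhds hx) h
  simp only [pd, this.fderiv_eq]

lemma contDiffOn_pd (hU : IsOpen U) {f : Coord → V} (hf : ContDiffOn ℝ ∞ f U) (a : Fin 4) :
    ContDiffOn ℝ ∞ (pd a f) U := by
  have : ContDiffOn ℝ ∞ (fderiv ℝ f) U := hf.fderiv_of_isOpen hU (by simp)
  exact this.clm_apply contDiffOn_const

lemma differentiableAt_of_smooth (hU : IsOpen U) {f : Coord → V} (hf : ContDiffOn ℝ ∞ f U)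
    {x : Coord} (hx : x ∈ U) : DifferentiableAt ℝ f x :=
  (hf.differentiableOn (by simp)).differentiableAt (hU.mem_nhds hx)

lemma pd_pd_comm (hU : IsOpen U) {f : Coord → V} (hf : ContDiffOn ℝ ∞ f U) (a b : Fin 4)
    {x : Coord} (hx : x ∈ U) : pd a (pd b f) x = pd b (pd a f) x := by
  have hfa : ContDiffAt ℝ ∞ f x := hf.contDiffAt (hU.mem_nhds hx)
  have h1 : DifferentiableAt ℝ (fderiv ℝ f) x :=
    differentiableAt_of_smooth hU (hf.fderiv_of_isOpen hU (by simp)) hx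
  have h2 : ∀ a b, pd a (pd b f) x =
      fderiv ℝ (fderiv ℝ f) x (Pi.single a 1) (Pi.single b 1) := fun a b => by
    unfold pd
    rw [fderiv_clm_apply h1 (differentiableAt_const _)]
    simp
  have h3 : IsSymmSndFDerivAt ℝ f x := hfa.isSymmSndFDerivAt (by
    rw [minSmoothness_of_isRCLikeNormedField]; exact ENat.LEInfty.out)
  rw [h2, h2]
  exact h3.eq _ _

lemma pd_ofReal {f : Coord → ℝ} {x : Coord} (hf : DifferentiableAt ℝ f x) (a : Fin 4) :
    pd a (fun y => (f y : ℂ)) x = ((pd a f x : ℝ) : ℂ) := by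
  unfold pd
  have h := (Complex.ofRealCLM.hasFDerivAt.comp x hf.hasFDerivAt).fderiv
  have h2 : (fun y => (f y : ℂ)) = Complex.ofRealCLM ∘ f := rfl
  rw [h2, h]; rfl

lemma pd_star {f : Coord → ℂ} {x : Coord} (a : Fin 4) :
    pd a (fun y => star (f y)) x = star (pd a f x) := by
  unfold pd
  rw [fderiv_star]; rfl

end PartialDerivative

open Classical in
/-- The extension of a function by zero. -/
def extZero {U : Set Coord} (f : U → ℂ) : Coord → ℂ := fun x =>
  if h : x ∈ U then f ⟨x, h⟩ else 0

lemma extZero_apply {U : Set Coord} (f : U → ℂ) {x : Coord} (hx : x ∈ U) :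
    extZero f x = f ⟨x, hx⟩ := by simp [extZero, hx]

/-- The algebra of smooth complex functions on `U`. -/
def SmoothFun (U : Set Coord) : Subalgebra ℝ (U → ℂ) where
  carrier := {f | ContDiffOn ℝ ∞ (extZero f) U}
  mul_mem' {f f'} hf hf' := (hf.mul hf').congr fun x hx => by simp [extZero_apply _ hx]
  add_mem' {f f'} hf hf' := (hf.add hf').congr fun x hx => by simp [extZero_apply _ hx]
  algebraMap_mem' r := (contDiffOn_const (c := (r : ℂ))).congr fun x hx => by
    rw [extZero_apply _ hx]; rfl

variable {U : Set Coord}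

lemma SmoothFun.ext {f f' : SmoothFun U} (h : ∀ x : U, f.1 x = f'.1 x) : f = f' :=
  Subtype.ext (funext h)

open Classical in
/-- The restriction of a smooth function to `U`. -/
def res (U : Set Coord) (f : Coord → ℂ) : SmoothFun U :=
  if h : ContDiffOn ℝ ∞ f U then
    ⟨fun x => f x, h.congr fun x hx => by rw [extZero_apply _ hx]⟩
  -- A default value; `res` is evaluated at smooth functions only.
  else 0

lemma res_apply {f : Coord → ℂ} (hf : ContDiffOn ℝ ∞ f U) (x : U) : (res U f).1 x = f x := by
  simp [res, hf]

lemma res_congr {f f' : Coord → ℂ} (hf : ContDiffOn ℝ ∞ f U) (h : ∀ x ∈ U, f x = f' x) :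
    res U f = res U f' := by
  have hf' : ContDiffOn ℝ ∞ f' U := hf.congr fun x hx => (h x hx).symm
  exact SmoothFun.ext fun x => by rw [res_apply hf, res_apply hf', h x x.2]

/-- Since `U` is open, derivatives at its points do not see how a function is extended outside. -/
lemma pd_extZero_res (hU : IsOpen U) {f : Coord → ℂ} (hf : ContDiffOn ℝ ∞ f U) (a : Fin 4)
    {x : Coord} (hx : x ∈ U) : pd a (extZero (res U f).1) x = pd a f x :=
  pd_congr hU (fun y hy => by rw [extZero_apply _ hy, res_apply hf]) a hx

/-- The partial derivatives as derivations of the smooth functions. -/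
def pdD (hU : IsOpen U) (a : Fin 4) : Derivation ℝ (SmoothFun U) (SmoothFun U) :=
  Derivation.mk'
    { toFun := fun f => ⟨fun x => pd a (extZero f.1) x,
        (contDiffOn_pd hU f.2 a).congr fun x hx => by rw [extZero_apply _ hx]⟩
      map_add' := fun f f' => SmoothFun.ext fun x => by
        have h1 : pd a (extZero (f + f').1) x = pd a (fun y => extZero f.1 y + extZero f'.1 y) x :=
          pd_congr hU (fun y hy => by simp [extZero_apply _ hy]) a x.2
        have h2 := differentiableAt_of_smooth hU f.2 x.2
        have h3 := differentiableAt_of_smooth hU f'.2 x.2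
        change pd a (extZero (f + f').1) x = pd a (extZero f.1) x + pd a (extZero f'.1) x
        rw [h1]
        unfold pd
        rw [fderiv_fun_add h2 h3]; rfl
      map_smul' := fun r f => SmoothFun.ext fun x => by
        have h1 : pd a (extZero (r • f).1) x = pd a (fun y => r • extZero f.1 y) x :=
          pd_congr hU (fun y hy => by simp [extZero_apply _ hy]) a x.2
        have h2 := differentiableAt_of_smooth hU f.2 x.2
        change pd a (extZero (r • f).1) x = r • pd a (extZero f.1) x
        rw [h1]
        unfold pd
        rw [fderiv_fun_const_smul h2]; rfl }
    (fun f f' => SmoothFun.ext fun x => by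
      have h1 : pd a (extZero (f * f').1) x = pd a (fun y => extZero f.1 y * extZero f'.1 y) x :=
        pd_congr hU (fun y hy => by simp [extZero_apply _ hy]) a x.2
      have h2 := differentiableAt_of_smooth hU f.2 x.2
      have h3 := differentiableAt_of_smooth hU f'.2 x.2
      change pd a (extZero (f * f').1) x =
        f.1 x * pd a (extZero f'.1) x + f'.1 x * pd a (extZero f.1) x
      rw [h1]
      unfold pd
      rw [fderiv_fun_mul h2 h3]
      simp [extZero_apply _ x.2])

lemma pdD_apply (hU : IsOpen U) (a : Fin 4) (f : SmoothFun U) (x : U) :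
    (pdD hU a f).1 x = pd a (extZero f.1) x := rfl

lemma pdD_res (hU : IsOpen U) (a : Fin 4) {f : Coord → ℂ} (hf : ContDiffOn ℝ ∞ f U) :
    pdD hU a (res U f) = res U (pd a f) := SmoothFun.ext fun x => by
  rw [pdD_apply, pd_extZero_res hU hf a x.2, res_apply (contDiffOn_pd hU hf a)]

lemma pdD_comm (hU : IsOpen U) (a b : Fin 4) (f : SmoothFun U) :
    pdD hU a (pdD hU b f) = pdD hU b (pdD hU a f) := SmoothFun.ext fun x => by
  have h : ∀ a b, (pdD hU a (pdD hU b f)).1 x = pd a (pd b (extZero f.1)) x := fun a b => by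
    rw [pdD_apply]
    exact pd_congr hU (fun y hy => by rw [extZero_apply _ hy, pdD_apply]) a x.2
  rw [h, h, pd_pd_comm hU f.2 a b x.2]

/-- Evaluation at a point of `U`. -/
def evalAt (x : U) : SmoothFun U →+* ℂ := (Pi.evalRingHom (fun _ : U => ℂ) x).comp
  (SmoothFun U).val.toRingHom

lemma SmoothFun.ext_evalAt {f f' : SmoothFun U} (h : ∀ x : U, evalAt x f = evalAt x f') : f = f' :=
  SmoothFun.ext h

@[simp] lemma evalAt_algebraMap (x : U) (r : ℝ) :
    evalAt x (algebraMap ℝ (SmoothFun U) r) = (r : ℂ) := rfl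

/-- The restriction of a real function to `U`. -/
def resR (U : Set Coord) (f : Coord → ℝ) : SmoothFun U := res U fun x => (f x : ℂ)

lemma contDiffOn_ofReal {f : Coord → ℝ} (hf : ContDiffOn ℝ ∞ f U) :
    ContDiffOn ℝ ∞ (fun x => (f x : ℂ)) U :=
  Complex.ofRealCLM.contDiff.comp_contDiffOn hf

lemma evalAt_res (x : U) {f : Coord → ℂ} (hf : ContDiffOn ℝ ∞ f U) : evalAt x (res U f) = f x :=
  res_apply hf x

lemma evalAt_resR (x : U) {f : Coord → ℝ} (hf : ContDiffOn ℝ ∞ f U) :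
    evalAt x (resR U f) = (f x : ℂ) := res_apply (contDiffOn_ofReal hf) x

lemma pdD_resR (hU : IsOpen U) (a : Fin 4) {f : Coord → ℝ} (hf : ContDiffOn ℝ ∞ f U) :
    pdD hU a (resR U f) = resR U (pd a f) := by
  rw [resR, pdD_res hU a (contDiffOn_ofReal hf)]
  exact res_congr (contDiffOn_pd hU (contDiffOn_ofReal hf) a) fun x hx =>
    pd_ofReal (differentiableAt_of_smooth hU hf hx) a

end Kundt

end

/-! ### The coordinate tensors over the algebra of smooth functions. -/

noncomputable section

namespace Kundt

variable {U : Set Coord} {ς : ℝ} {g : MetricField}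

namespace IsLorentzMetric

variable (hg : IsLorentzMetric ς U g)
include hg

lemma isUnit_det (hς : ς ≠ 0) {x : Coord} (hx : x ∈ U) : IsUnit (g x).det := by
  obtain ⟨P, hP, h⟩ := hg.signature x hx
  have h1 := congrArg Matrix.det h
  rw [Matrix.det_mul, Matrix.det_mul, Matrix.det_smul, Matrix.det_diagonal] at h1
  refine isUnit_iff_ne_zero.2 fun h0 => ?_
  rw [h0] at h1
  simp [Fin.prod_univ_four, hς] at h1

lemma apply_symm {x : Coord} (hx : x ∈ U) (a b : Fin 4) : g x a b = g x b a :=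
  (hg.symm x hx).apply b a

end IsLorentzMetric

lemma contDiffOn_det {M : Coord → Matrix (Fin 4) (Fin 4) ℝ}
    (hM : ∀ a b, ContDiffOn ℝ ∞ (fun x => M x a b) U) :
    ContDiffOn ℝ ∞ (fun x => (M x).det) U := by
  simp only [Matrix.det_apply]
  exact ContDiffOn.sum fun σ _ => (contDiffOn_prod fun i _ => hM _ _).const_smul _

/-- Cramer's rule: the entries of the inverse are polynomial in those of the matrix, divided by the
determinant. -/
lemma contDiffOn_inv {M : Coord → Matrix (Fin 4) (Fin 4) ℝ}
    (hM : ∀ a b, ContDiffOn ℝ ∞ (fun x => M x a b) U) (hd : ∀ x ∈ U, IsUnit (M x).det)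
    (a b : Fin 4) : ContDiffOn ℝ ∞ (fun x => (M x)⁻¹ a b) U := by
  have h1 : ContDiffOn ℝ ∞ (fun x => (M x).adjugate a b) U := by
    simp only [Matrix.adjugate_apply]
    refine contDiffOn_det fun i j => ?_
    by_cases h : i = b
    · subst h; simpa using contDiffOn_const
    · simpa [Matrix.updateRow_ne h] using hM i j
  have h2 : ContDiffOn ℝ ∞ (fun x => ((M x).det)⁻¹ * (M x).adjugate a b) U :=
    ((contDiffOn_det hM).inv fun x hx => (hd x hx).ne_zero).mul h1
  refine h2.congr fun x _ => ?_
  rw [Matrix.inv_def]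
  simp

variable (U g) in
/-- The metric over the ring of smooth functions. -/
def metricR : Matrix (Fin 4) (Fin 4) (SmoothFun U) := Matrix.of fun a b => resR U fun x => g x a b

variable (U g) in
/-- The Christoffel symbols over the ring of smooth functions. -/
def connR (c : Fin 4) : Matrix (Fin 4) (Fin 4) (SmoothFun U) :=
  Matrix.of fun a f => resR U (christoffel g f c a)

variable (U) in
/-- A tensor field over the ring of smooth functions. -/
def toR {k : ℕ} (T : CovTensor ℂ k) : (Fin k → Fin 4) → SmoothFun U := fun A =>
  res U fun x => T x A

/-- A real tensor field as a complex one. -/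
def toC {k : ℕ} (T : CovTensor ℝ k) : CovTensor ℂ k := fun x A => (T x A : ℂ)

variable (U) in
/-- Smooth tensor fields. -/
def SmoothTensor {V : Type} [NormedAddCommGroup V] [NormedSpace ℝ V] {k : ℕ} (T : CovTensor V k) :
    Prop := ∀ A, ContDiffOn ℝ ∞ (fun x => T x A) U

lemma SmoothTensor.toC {k : ℕ} {T : CovTensor ℝ k} (h : SmoothTensor U T) :
    SmoothTensor U (toC T) := fun A => contDiffOn_ofReal (h A)

namespace IsLorentzMetric

variable (hg : IsLorentzMetric ς U g) (hU : IsOpen U) (hς : ς ≠ 0)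
include hg hU hς

lemma smooth_christoffel (c a b : Fin 4) : ContDiffOn ℝ ∞ (christoffel g c a b) U := by
  have hp : ∀ d a b, ContDiffOn ℝ ∞ (pd d fun y => g y a b) U := fun d a b =>
    contDiffOn_pd hU (hg.smooth a b) d
  have hi := contDiffOn_inv hg.smooth (fun x hx => hg.isUnit_det hς hx)
  unfold christoffel
  exact contDiffOn_const.mul (ContDiffOn.sum fun d _ =>
    (hi c d).mul (((hp _ _ _).add (hp _ _ _)).sub (hp _ _ _)))

lemma smooth_covD {V : Type} [NormedAddCommGroup V] [NormedSpace ℝ V] {k : ℕ} {T : CovTensor V k}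
    (hT : SmoothTensor U T) : SmoothTensor U (covD g T) := fun A => by
  unfold covD
  exact (contDiffOn_pd hU (hT _) _).sub (ContDiffOn.sum fun i _ => ContDiffOn.sum fun c _ =>
    (hg.smooth_christoffel hU hς _ _ _).smul (hT _))

lemma smooth_riemann : SmoothTensor U (riemann g) := fun A => by
  have hp : ∀ d a b c, ContDiffOn ℝ ∞ (pd d (christoffel g a b c)) U := fun d a b c =>
    contDiffOn_pd hU (hg.smooth_christoffel hU hς a b c) d
  have hc := hg.smooth_christoffel hU hς
  unfold riemann riemannUp
  exact ContDiffOn.sum fun e _ => (hg.smooth _ _).mul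
    (((hp _ _ _ _).sub (hp _ _ _ _)).add (ContDiffOn.sum fun f _ =>
      ((hc _ _ _).mul (hc _ _ _)).sub ((hc _ _ _).mul (hc _ _ _))))

lemma smooth_nablaRiem (n : ℕ) : SmoothTensor U (nablaRiem g n) := by
  induction n with
  | zero => exact hg.smooth_riemann hU hς
  | succ n ih => exact hg.smooth_covD hU hς ih

lemma covD_toC {k : ℕ} {T : CovTensor ℝ k} (hT : SmoothTensor U T) {x : Coord} (hx : x ∈ U)
    (A : Fin (k + 1) → Fin 4) : covD g (toC T) x A = toC (covD g T) x A := by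
  simp only [covD, toC, Complex.ofReal_sub, Complex.ofReal_sum, smul_eq_mul, Complex.ofReal_mul,
    Complex.real_smul]
  rw [pd_ofReal (differentiableAt_of_smooth hU (hT _) hx)]

lemma evalAt_connR (c a f : Fin 4) (x : U) :
    evalAt x (connR U g c a f) = (christoffel g f c a x : ℂ) :=
  evalAt_resR x (hg.smooth_christoffel hU hς f c a)

omit hU hς in
lemma evalAt_metricR (a b : Fin 4) (x : U) : evalAt x (metricR U g a b) = (g x a b : ℂ) :=
  evalAt_resR x (hg.smooth a b)

lemma nabla_toR {k : ℕ} {T : CovTensor ℂ k} (hT : SmoothTensor U T) :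
    nabla (pdD hU) (connR U g) (toR U T) = toR U (covD g T) := by
  ext1 A
  refine SmoothFun.ext_evalAt fun x => ?_
  have h1 : ∀ A, evalAt x (toR U T A) = T x A := fun A => evalAt_res x (hT A)
  have h2 : evalAt x (toR U (covD g T) A) = covD g T x A :=
    evalAt_res x (hg.smooth_covD hU hς hT A)
  rw [h2, nabla, nab_apply, covD, map_sub]
  congr 1
  · rw [toR, pdD_res hU _ (hT _), evalAt_res x (contDiffOn_pd hU (hT _) _)]
  · simp only [act, map_sum, map_mul, h1, hg.evalAt_connR hU hς, Complex.real_smul]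

lemma christoffel_symm (c a b : Fin 4) {x : Coord} (hx : x ∈ U) :
    christoffel g c a b x = christoffel g c b a x := by
  unfold christoffel
  congr 1
  refine Finset.sum_congr rfl fun d _ => ?_
  rw [pd_congr hU (fun y hy => hg.apply_symm hy a b) d hx]
  ring

/-- The Christoffel symbols of the first kind, free of the inverse metric. Metric compatibility and
the explicit formulas for Kundt metrics are read off from them. -/
lemma christoffel_low (a b c : Fin 4) {x : Coord} (hx : x ∈ U) :
    ∑ f, christoffel g f c a x * g x f b = (1 / 2) * (pd c (fun y => g y b a) x +
      pd a (fun y => g y b c) x - pd b (fun y => g y c a) x) := by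
  have h1 : ∀ d, ∑ f, (g x)⁻¹ f d * g x f b = if d = b then 1 else 0 := fun d => by
    have h2 := Matrix.mul_nonsing_inv (g x) (hg.isUnit_det hς hx)
    have h3 := congrFun (congrFun h2 b) d
    rw [Matrix.mul_apply, Matrix.one_apply] at h3
    rw [show (if d = b then (1 : ℝ) else 0) = if b = d then 1 else 0 by simp [eq_comm], ← h3]
    exact Finset.sum_congr rfl fun f _ => by rw [hg.apply_symm hx f b, mul_comm]
  have h4 : ∑ f, christoffel g f c a x * g x f b = (1 / 2) * ∑ d,
      (∑ f, (g x)⁻¹ f d * g x f b) * (pd c (fun y => g y d a) x +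
      pd a (fun y => g y d c) x - pd d (fun y => g y c a) x) := by
    simp only [christoffel, Finset.mul_sum, Finset.sum_mul]
    rw [Finset.sum_comm]
    exact Finset.sum_congr rfl fun f _ => Finset.sum_congr rfl fun d _ => by ring
  rw [h4]
  simp [h1]

/-- The Levi-Civita connection over the ring of smooth functions. -/
lemma isLeviCivita : IsLeviCivita (pdD hU) (metricR U g) (connR U g) where
  comm := pdD_comm hU
  metric_symm := by
    ext1 a b
    refine SmoothFun.ext_evalAt fun x => ?_
    rw [Matrix.transpose_apply, hg.evalAt_metricR, hg.evalAt_metricR, hg.apply_symm x.2]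
  conn_symm a b c := SmoothFun.ext_evalAt fun x => by
    rw [hg.evalAt_connR hU hς, hg.evalAt_connR hU hς, hg.christoffel_symm hU hς _ _ _ x.2]
  compat c := by
    ext1 a b
    refine SmoothFun.ext_evalAt fun x => ?_
    have h1 : ∀ a b, evalAt x ((connR U g c * metricR U g) a b) =
        ((∑ f, christoffel g f c a x * g x f b : ℝ) : ℂ) := fun a b => by
      simp only [Matrix.mul_apply, map_sum, map_mul, hg.evalAt_connR hU hς, hg.evalAt_metricR,
        Complex.ofReal_sum, Complex.ofReal_mul]
    rw [dm_apply, Matrix.add_apply, Matrix.transpose_apply, map_add, h1, h1, metricR,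
      Matrix.of_apply, pdD_resR hU c (hg.smooth a b),
      evalAt_resR x (contDiffOn_pd hU (hg.smooth a b) c), hg.christoffel_low hU hς _ _ _ x.2,
      hg.christoffel_low hU hς _ _ _ x.2, ← Complex.ofReal_add,
      pd_congr hU (fun y hy => hg.apply_symm hy b a) c x.2,
      pd_congr hU (fun y hy => hg.apply_symm hy b c) a x.2,
      pd_congr hU (fun y hy => hg.apply_symm hy a c) b x.2]
    congr 1
    ring

lemma evalAt_curv (c d b e : Fin 4) (x : U) :
    evalAt x (curv (pdD hU) (connR U g) c d b e) = (riemannUp g e b c d x : ℂ) := by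
  have hp : ∀ c d b e, evalAt x (pdD hU c (connR U g d b e)) =
      ((pd c (christoffel g e d b) x : ℝ) : ℂ) := fun c d b e => by
    have hs := hg.smooth_christoffel hU hς e d b
    rw [connR, Matrix.of_apply, pdD_resR hU c hs, evalAt_resR x (contDiffOn_pd hU hs c)]
  rw [(hg.isLeviCivita hU hς).curv_eq]
  simp only [Matrix.sub_apply, dm_apply, Matrix.mul_apply, map_sub, map_sum, map_mul, hp,
    hg.evalAt_connR hU hς, riemannUp, Complex.ofReal_sub, Complex.ofReal_add, Complex.ofReal_sum,
    Complex.ofReal_mul, Finset.sum_sub_distrib]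
  have h1 : ∀ c d, ∑ f, (christoffel g f c b x : ℂ) * (christoffel g e d f x : ℂ) =
      ∑ f, (christoffel g e d f x : ℂ) * (christoffel g f c b x : ℂ) := fun c d =>
    Finset.sum_congr rfl fun f _ => mul_comm _ _
  rw [h1, h1]; ring

lemma lowCurv_eq : lowCurv (pdD hU) (metricR U g) (connR U g) = toR U (toC (riemann g)) := by
  ext1 A
  refine SmoothFun.ext_evalAt fun x => ?_
  rw [toR, evalAt_res x ((hg.smooth_riemann hU hς).toC A)]
  simp only [lowCurv, Matrix.mul_apply, map_sum, map_mul, hg.evalAt_curv hU hς, hg.evalAt_metricR,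
    toC, riemann, Complex.ofReal_sum, Complex.ofReal_mul]
  exact Finset.sum_congr rfl fun f _ => by rw [hg.apply_symm x.2, mul_comm]

lemma nablaIter_eq (n : ℕ) : nablaIter (pdD hU) (connR U g) (toR U (toC (riemann g))) n =
    toR U (toC (nablaRiem g n)) := by
  induction n with
  | zero => rfl
  | succ n ih =>
    have hs := hg.smooth_nablaRiem hU hς n
    rw [nablaIter, ih, hg.nabla_toR hU hς hs.toC]
    ext1 A
    exact res_congr (hg.smooth_covD hU hς hs.toC A) fun x hx => hg.covD_toC hU hς hs hx A

end IsLorentzMetric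

end Kundt

end

/-! ### Null tetrads, spin coefficients and part (2) of the theorem. -/

noncomputable section

namespace Kundt

variable {U : Set Coord} {ς : ℝ} {g : MetricField} {F : Tetrad}

/-- Complex conjugation of the members of a tetrad. -/
def cj : Fin 4 → Fin 4 := ![0, 1, 3, 2]

lemma Tetrad.e_cj (F : Tetrad) (A : Fin 4) (x : Coord) (a : Fin 4) :
    F.e (cj A) x a = star (F.e A x a) := by
  fin_cases A <;> simp [cj, Tetrad.e]

lemma Tetrad.dot_cj (F : Tetrad) (g : MetricField) (A B : Fin 4) (x : Coord) :
    F.dot g (cj A) (cj B) x = star (F.dot g A B x) := by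
  simp only [Tetrad.dot, star_sum, star_mul', Tetrad.e_cj]
  simp

lemma Tetrad.low_cj (F : Tetrad) (g : MetricField) (A : Fin 4) (x : Coord) (a : Fin 1 → Fin 4) :
    F.low g (cj A) x a = star (F.low g A x a) := by
  simp only [Tetrad.low, star_sum, star_mul', Tetrad.e_cj]
  simp

/-- The metric and its connection are real, so conjugation only exchanges `m` and `m̄`. This yields
the coefficients that the definition of a kinematic frame does not list. -/
lemma rot_cj (g : MetricField) (F : Tetrad) (A B C : Fin 4) (x : Coord) :
    rot g F (cj A) (cj B) (cj C) x = star (rot g F A B C x) := by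
  have h1 : ∀ A a, covD g (F.low g (cj A)) x a = star (covD g (F.low g A) x a) := fun A a => by
    simp only [covD, Tetrad.low_cj, pd_star, star_sub, star_sum, Complex.real_smul, star_mul']
    simp
  simp only [rot, h1, Tetrad.e_cj, star_sum, star_mul']

lemma Tetrad.dot_symm (F : Tetrad) (hg : IsLorentzMetric ς U g) (A B : Fin 4) {x : Coord}
    (hx : x ∈ U) : F.dot g A B x = F.dot g B A x := by
  unfold Tetrad.dot
  rw [Finset.sum_comm]
  exact Finset.sum_congr rfl fun a _ => Finset.sum_congr rfl fun b _ => by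
    rw [hg.apply_symm hx]; ring

variable (U F) in
/-- The frame over the ring of smooth functions. -/
def frameR : Matrix (Fin 4) (Fin 4) (SmoothFun U) := Matrix.of fun A a => res U fun x => F.e A x a

variable (U ς) in
/-- The signs of the scalar products of a null tetrad. -/
def sgnR (A : Fin 4) : SmoothFun U := algebraMap ℝ _ (![1, 1, ς, ς] A)

variable (U ς g F) in
/-- The inverse of the frame over the ring of smooth functions. -/
def frameInvR : Matrix (Fin 4) (Fin 4) (SmoothFun U) :=
  metricR U g * (frameR U F)ᵀ * eta (sgnR U ς)

lemma sgnR_sw (A : Fin 4) : sgnR U ς (sw A) = sgnR U ς A := by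
  fin_cases A <;> rfl

lemma sgnR_sq (hς : ς = 1 ∨ ς = -1) (A : Fin 4) : sgnR U ς A * sgnR U ς A = 1 := by
  have : (![1, 1, ς, ς] A) * (![1, 1, ς, ς] A) = 1 := by
    rcases hς with rfl | rfl <;> fin_cases A <;> simp
  rw [sgnR, ← map_mul, this, map_one]

namespace IsNullTetrad

variable (hF : IsNullTetrad ς U g F)
include hF

lemma smooth_e (A a : Fin 4) : ContDiffOn ℝ ∞ (fun x => F.e A x a) U := by
  have hl := contDiffOn_ofReal (contDiffOn_pi.1 hF.smooth_l a)
  have hn := contDiffOn_ofReal (contDiffOn_pi.1 hF.smooth_n a)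
  have hm := contDiffOn_pi.1 hF.smooth_m a
  have hm' : ContDiffOn ℝ ∞ (fun x => star (F.m x a)) U :=
    (Complex.conjCLE.contDiff (n := ∞)).comp_contDiffOn hm
  fin_cases A
  exacts [hl, hn, hm, hm']

lemma evalAt_frameR (A a : Fin 4) (x : U) : evalAt x (frameR U F A a) = F.e A x a :=
  evalAt_res x (hF.smooth_e A a)

lemma dot_eq (hg : IsLorentzMetric ς U g) (A B : Fin 4) {x : Coord} (hx : x ∈ U) :
    F.dot g A B x = if B = sw A then ((![1, 1, ς, ς] A : ℝ) : ℂ) else 0 := by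
  have hs := F.dot_symm hg
  have hc := F.dot_cj g
  have h00 := hF.dot_ll x hx
  have h01 := hF.dot_ln x hx
  have h02 := hF.dot_lm x hx
  have h11 := hF.dot_nn x hx
  have h12 := hF.dot_nm x hx
  have h22 := hF.dot_mm x hx
  have h23 := hF.dot_mmbar x hx
  have h03 : F.dot g 0 3 x = 0 := by have := hc 0 2 x; rw [h02, star_zero] at this; exact this
  have h13 : F.dot g 1 3 x = 0 := by have := hc 1 2 x; rw [h12, star_zero] at this; exact this
  have h33 : F.dot g 3 3 x = 0 := by have := hc 2 2 x; rw [h22, star_zero] at this; exact this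
  have h10 := (hs 1 0 hx).trans h01
  have h20 := (hs 2 0 hx).trans h02
  have h30 := (hs 3 0 hx).trans h03
  have h21 := (hs 2 1 hx).trans h12
  have h31 := (hs 3 1 hx).trans h13
  have h32 := (hs 3 2 hx).trans h23
  fin_cases A <;> fin_cases B <;> simp [sw, *]

lemma frame_metric (hg : IsLorentzMetric ς U g) :
    frameR U F * metricR U g * (frameR U F)ᵀ = eta (sgnR U ς) := by
  ext1 A B
  refine SmoothFun.ext_evalAt fun x => ?_
  have h1 : evalAt x ((frameR U F * metricR U g * (frameR U F)ᵀ) A B) = F.dot g A B x := by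
    rw [Matrix.mul_assoc, Matrix.mul_apply]
    simp only [Matrix.mul_apply, map_sum, map_mul, hF.evalAt_frameR, Matrix.transpose_apply,
      hg.evalAt_metricR, Tetrad.dot, Finset.mul_sum]
    exact Finset.sum_congr rfl fun a _ => Finset.sum_congr rfl fun b _ => by ring
  rw [h1, hF.dot_eq hg A B x.2, eta, Matrix.of_apply]
  split_ifs
  · rw [sgnR, evalAt_algebraMap]
  · rw [map_zero]

/-- From `E g Eᵀ = η` and `η² = 1` the matrix `g Eᵀ η` is a right inverse of `E`, hence also a left
inverse. -/
lemma frameInv_mul (hς : ς = 1 ∨ ς = -1) (hg : IsLorentzMetric ς U g) :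
    frameInvR U ς g F * frameR U F = 1 := by
  rw [mul_eq_one_comm, frameInvR, ← Matrix.mul_assoc, ← Matrix.mul_assoc,
    hF.frame_metric hg]
  ext1 A B
  rw [mul_eta sgnR_sw, eta, Matrix.of_apply]
  by_cases h : A = B
  · subst h; simp [sgnR_sq hς]
  · have : sw B ≠ sw A := fun h' => h (by rw [← sw_sw A, ← h', sw_sw])
    simp [h, this]

lemma component_eq {k : ℕ} {T : CovTensor ℝ k} (hT : SmoothTensor U T) (A : Fin k → Fin 4) (x : U) :
    component F T A x = evalAt x (trans (frameR U F) (toR U (toC T)) A) := by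
  simp only [component, trans, map_sum, map_mul, map_prod, hF.evalAt_frameR]
  exact Finset.sum_congr rfl fun b _ => by rw [toR, evalAt_res x (hT.toC b), toC]

lemma typeII_iff {k : ℕ} {T : CovTensor ℝ k} (hT : SmoothTensor U T) :
    TypeII U F T ↔ Ord wt 0 (trans (frameR U F) (toR U (toC T))) := by
  refine ⟨fun h A hA => SmoothFun.ext_evalAt fun x => ?_, fun h A hA x hx => ?_⟩
  · rw [← hF.component_eq hT, h A hA x x.2, map_zero]
  · rw [hF.component_eq hT A ⟨x, hx⟩, h A hA, map_zero]

/-- The rotation coefficients are the coefficients of the connection in the tetrad. -/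
lemma rot_eq (hU : IsOpen U) (hς : ς = 1 ∨ ς = -1) (hg : IsLorentzMetric ς U g) (A B C : Fin 4)
    (x : U) : rot g F A B C x = evalAt x
      (-(frameConn (pdD hU) (connR U g) (frameR U F) (frameInvR U ς g F) C * eta (sgnR U ς)) B A) := by
  have hς0 : ς ≠ 0 := by rcases hς with rfl | rfl <;> norm_num
  have hE := hF.frameInv_mul hς hg
  have hlow : SmoothTensor U (F.low g A) := fun a => ContDiffOn.sum fun b _ =>
    (contDiffOn_ofReal (hg.smooth _ _)).mul (hF.smooth_e _ _)
  have hcov := hg.smooth_covD hU hς0 hlow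
  have h1 : rot g F A B C x =
      evalAt x (trans (frameR U F) (toR U (covD g (F.low g A))) ![B, C]) := by
    simp only [trans_two, map_sum, map_mul, hF.evalAt_frameR]
    rw [rot, Finset.sum_comm]
    refine Finset.sum_congr rfl fun c _ => ?_
    rw [Finset.mul_sum]
    refine Finset.sum_congr rfl fun b _ => ?_
    rw [toR, evalAt_res x (hcov _)]
    ring
  -- The covector `e_A` has constant components in its own frame, so only the connection term of its
  -- covariant derivative is left.
  have h3 : ∀ B, trans (frameR U F) (toR U (F.low g A)) ![B] = eta (sgnR U ς) B A := fun B => by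
    rw [← hF.frame_metric hg]
    refine SmoothFun.ext_evalAt fun x => ?_
    rw [trans_one, Matrix.mul_assoc, Matrix.mul_apply]
    simp only [map_sum, map_mul, hF.evalAt_frameR]
    refine Finset.sum_congr rfl fun b _ => ?_
    congr 1
    rw [toR, evalAt_res x (hlow _), Tetrad.low, Matrix.mul_apply, map_sum]
    refine Finset.sum_congr rfl fun a _ => ?_
    rw [map_mul, Matrix.transpose_apply, hF.evalAt_frameR, hg.evalAt_metricR]
    rfl
  have h5 : frameDeriv (pdD hU) (frameR U F) C (eta (sgnR U ς) B A) = 0 := by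
    rw [eta, Matrix.of_apply]
    split_ifs
    · rw [sgnR, Derivation.map_algebraMap]
    · rw [map_zero]
  rw [h1, ← hg.nabla_toR hU hς0 hlow, ← trans_nabla hE, nabla_pair, h3, h5, zero_sub,
    Matrix.mul_apply]
  simp only [h3]

end IsNullTetrad

namespace IsKinematicFrame

variable (hF : IsKinematicFrame ς U g F)
include hF

/-- All rotation coefficients of positive boost weight vanish in a kinematic frame. -/
lemma rot_eq_zero (hanti : ∀ A B C, ∀ x ∈ U, rot g F A B C x = -rot g F B A C x) {A B C : Fin 4}
    (hw : 0 < boostWeight A + boostWeight B + boostWeight C) {x : Coord} (hx : x ∈ U) :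
    rot g F A B C x = 0 := by
  have hself : ∀ A C, rot g F A A C x = 0 := fun A C => by
    have := hanti A A C x hx
    linear_combination this / 2
  have h1 : rot g F 0 2 0 x = 0 := hF.kappa_eq x hx
  have h2 : rot g F 0 2 2 x = 0 := hF.sigma_eq x hx
  have h3 : rot g F 0 2 3 x = 0 := hF.rho_eq x hx
  have h1' : rot g F 0 3 0 x = 0 := by
    have := rot_cj g F 0 2 0 x; rw [h1, star_zero] at this; exact this
  have h2' : rot g F 0 3 3 x = 0 := by
    have := rot_cj g F 0 2 2 x; rw [h2, star_zero] at this; exact this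
  have h3' : rot g F 0 3 2 x = 0 := by
    have := rot_cj g F 0 2 3 x; rw [h3, star_zero] at this; exact this
  have h4 : rot g F 0 1 0 x - rot g F 2 3 0 x = 0 := by
    have := hF.epsilon_eq x hx
    rw [epsilon] at this
    linear_combination 2 * this
  -- The single complex condition `ε = 0` gives two equations: `ℓ_{a;b} n^a ℓ^b` is real and
  -- `m_{a;b} m̄^a ℓ^b` is imaginary, so both vanish.
  have h5 : rot g F 0 1 0 x - rot g F 3 2 0 x = 0 := by
    have e1 : rot g F 0 1 0 x = star (rot g F 0 1 0 x) := rot_cj g F 0 1 0 x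
    have e2 : rot g F 3 2 0 x = star (rot g F 2 3 0 x) := rot_cj g F 2 3 0 x
    rw [e1, e2, ← star_sub, h4, star_zero]
  have h6 := hanti 3 2 0 x hx
  have h7 : rot g F 0 1 0 x = 0 := by linear_combination h4 / 2 + h5 / 2 + h6 / 2
  have h8 : rot g F 2 3 0 x = 0 := by linear_combination h7 - h4
  -- Up to antisymmetry these are all rotation coefficients of positive weight, namely `κ, σ, ρ`,
  -- their conjugates and the two parts of `ε`.
  have key : ∀ A B C, A < B → 0 < boostWeight A + boostWeight B + boostWeight C →
      (A, B, C) ∈ ({(0, 2, 0), (0, 2, 2), (0, 2, 3), (0, 3, 0), (0, 3, 3), (0, 3, 2), (0, 1, 0),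
        (2, 3, 0)} : Finset (Fin 4 × Fin 4 × Fin 4)) := by decide
  have key2 : ∀ A B C, A < B → 0 < boostWeight A + boostWeight B + boostWeight C →
      rot g F A B C x = 0 := fun A B C hAB hw => by
    have := key A B C hAB hw
    simp only [Finset.mem_insert, Finset.mem_singleton, Prod.mk.injEq] at this
    rcases this with ⟨rfl, rfl, rfl⟩ | ⟨rfl, rfl, rfl⟩ | ⟨rfl, rfl, rfl⟩ | ⟨rfl, rfl, rfl⟩ |
      ⟨rfl, rfl, rfl⟩ | ⟨rfl, rfl, rfl⟩ | ⟨rfl, rfl, rfl⟩ | ⟨rfl, rfl, rfl⟩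
    exacts [h1, h2, h3, h1', h2', h3', h7, h8]
  rcases lt_trichotomy A B with h | rfl | h
  · exact key2 A B C h hw
  · exact hself A C
  · rw [hanti A B C x hx, key2 B A C h (by omega), neg_zero]

/-- A kinematic frame, over the ring of smooth functions. -/
theorem isKinematicGeometry (hU : IsOpen U) (hς : ς = 1 ∨ ς = -1) (hg : IsLorentzMetric ς U g) :
    IsKinematicGeometry (frameDeriv (pdD hU) (frameR U F))
      (frameConn (pdD hU) (connR U g) (frameR U F) (frameInvR U ς g F)) (sgnR U ς)
      (trans (frameR U F) (toR U (toC (riemann g)))) := by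
  have hς0 : ς ≠ 0 := by rcases hς with rfl | rfl <;> norm_num
  have hL := hg.isLeviCivita hU hς0
  have hE := hF.null.frameInv_mul hς hg
  have hη := hF.null.frame_metric hg
  have hc : ∀ C A, pdD hU C (sgnR U ς A) = 0 := fun C A => by
    rw [sgnR, Derivation.map_algebraMap]
  rw [← hg.lowCurv_eq hU hς0]
  refine hL.isKinematicGeometry hE hη hc sgnR_sw (sgnR_sq hς) fun C A B hw => ?_
  have hanti : ∀ A B C, ∀ x ∈ U, rot g F A B C x = -rot g F B A C x := fun A B C x hx => by
    have h1 := congrFun (congrFun (hL.frameConn_eta hE hη hc C) A) B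
    rw [Matrix.transpose_apply, Matrix.neg_apply] at h1
    rw [hF.null.rot_eq hU hς hg A B C ⟨x, hx⟩, hF.null.rot_eq hU hς hg B A C ⟨x, hx⟩, h1]
    simp
  -- Lowering the upper index `B` of the connection replaces it by `sw B`, of opposite weight; the
  -- weight of the coefficient becomes the sum of the three weights of a rotation coefficient.
  have h2 : (frameConn (pdD hU) (connR U g) (frameR U F) (frameInvR U ς g F) C *
      eta (sgnR U ς)) A (sw B) = 0 := SmoothFun.ext_evalAt fun x => by
    have h3 := hF.null.rot_eq hU hς hg (sw B) A C x
    rw [hF.rot_eq_zero hanti (by rw [boostWeight_sw]; omega) x.2] at h3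
    rw [map_neg] at h3
    rw [map_zero]
    linear_combination h3
  rw [mul_eta sgnR_sw, sgnR_sw, sw_sw] at h2
  have h4 := sgnR_sq (U := U) hς B
  linear_combination (sgnR U ς B) * h2 -
    frameConn (pdD hU) (connR U g) (frameR U F) (frameInvR U ς g F) C A B * h4

omit hF in
lemma _root_.Kundt.IsNullTetrad.trans_nablaRiem (hF : IsNullTetrad ς U g F) (hU : IsOpen U)
    (hς : ς = 1 ∨ ς = -1) (hg : IsLorentzMetric ς U g) (n : ℕ) :
    trans (frameR U F) (toR U (toC (nablaRiem g n))) =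
      nablaIter (frameDeriv (pdD hU) (frameR U F))
        (frameConn (pdD hU) (connR U g) (frameR U F) (frameInvR U ς g F))
        (trans (frameR U F) (toR U (toC (riemann g)))) n := by
  have hς0 : ς ≠ 0 := by rcases hς with rfl | rfl <;> norm_num
  rw [← hg.nablaIter_eq hU hς0]
  induction n with
  | zero => rfl
  | succ n ih => rw [nablaIter, nablaIter, ← ih, trans_nabla (hF.frameInv_mul hς hg)]

/-- If the Riemann tensor and its first covariant derivative are of type II in a kinematic frame,
so are all covariant derivatives. -/
theorem typeII_nablaRiem (hU : IsOpen U) (hς : ς = 1 ∨ ς = -1) (hg : IsLorentzMetric ς U g)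
    (h0 : TypeII U F (nablaRiem g 0)) (h1 : TypeII U F (nablaRiem g 1)) (n : ℕ) :
    TypeII U F (nablaRiem g n) := by
  have hς0 : ς ≠ 0 := by rcases hς with rfl | rfl <;> norm_num
  rw [hF.null.typeII_iff (hg.smooth_nablaRiem hU hς0 _),
    hF.null.trans_nablaRiem hU hς hg] at h0 h1 ⊢
  exact (hF.isKinematicGeometry hU hς hg).ord_nablaIter h0 h1 n

end IsKinematicFrame

end Kundt

end

/-! ### The curvature of Kundt metrics along `∂_v`. -/

namespace Kundt

section

variable {R : Type*} [CommRing R] [Algebra ℝ R] {p : Fin 4 → Derivation ℝ R R}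
  {g gi : Matrix (Fin 4) (Fin 4) R} {Γ : Fin 4 → Matrix (Fin 4) (Fin 4) R}

/-- A metric with the null coordinate vector `∂_v`, whose covector is `du`, and with a transverse
part that does not depend on `v`. -/
structure IsKundtGeometry (p : Fin 4 → Derivation ℝ R R) (g gi : Matrix (Fin 4) (Fin 4) R)
    (Γ : Fin 4 → Matrix (Fin 4) (Fin 4) R) : Prop extends IsLeviCivita p g Γ where
  inv : g * gi = 1
  row : ∀ b, g 1 b = if b = 0 then 1 else 0
  transverse : ∀ i j, i ≠ 0 → j ≠ 0 → p 1 (g i j) = 0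

namespace IsKundtGeometry

variable (h : IsKundtGeometry p g gi Γ)
include h

lemma metric_apply_symm (a b : Fin 4) : g a b = g b a := by
  conv_lhs => rw [← h.metric_symm]
  rfl

lemma deriv_row (c b : Fin 4) : p c (g 1 b) = 0 := by
  rw [h.row]; split_ifs <;> simp

/-- The components `g_{vb}` are constant, so the antisymmetric part `∂_a g_{vb} - ∂_b g_{va}` of the
lowered connection along `∂_v` is zero. Hence twice this matrix is `∂_v g`. -/
lemma low_symm : (Γ 1 * g)ᵀ = Γ 1 * g := by
  have hc : ∀ c a b, p c (g a b) = (Γ c * g) a b + (Γ c * g) b a := fun c a b =>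
    congrFun (congrFun (h.compat c) a) b
  have hs : ∀ c a b, (Γ c * g) a b = (Γ a * g) c b := fun c a b => by
    simp only [Matrix.mul_apply, h.conn_symm c a]
  ext a b
  have h1 := hc a 1 b
  have h2 := hc b 1 a
  rw [h.deriv_row] at h1 h2
  rw [Matrix.transpose_apply]
  have h3 := hs 1 a b
  have h4 := hs 1 b a
  have h5 := hs a b 1
  linear_combination h4 - h3 - h2 + h1 + h5

lemma low_add_low : Γ 1 * g + Γ 1 * g = dm (p 1) g := by
  rw [h.compat, h.low_symm]

lemma low_apply_add (a b : Fin 4) : (Γ 1 * g) a b + (Γ 1 * g) a b = p 1 (g a b) :=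
  congrFun (congrFun h.low_add_low a) b

lemma low_eq_zero {a b : Fin 4} (hab : p 1 (g a b) = 0) : (Γ 1 * g) a b = 0 :=
  two_mul_eq_zero_of (by have := h.low_apply_add a b; rw [hab] at this; linear_combination this)

lemma conn_zero (b : Fin 4) : Γ 1 b 0 = 0 := by
  have h1 : (Γ 1 * g) b 1 = Γ 1 b 0 := by
    simp [Matrix.mul_apply, h.metric_apply_symm _ 1, h.row]
  rw [← h1]
  exact h.low_eq_zero (by rw [h.metric_apply_symm, h.deriv_row])

lemma conn_low_symm (a b : Fin 4) : (Γ 1 * (Γ 1 * g)) a b = (Γ 1 * (Γ 1 * g)) b a := by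
  have h1 : (Γ 1 * (Γ 1 * g))ᵀ = Γ 1 * (Γ 1 * g) := by
    rw [Matrix.transpose_mul, h.low_symm]
    conv_rhs => rw [← h.low_symm]
    simp only [Matrix.transpose_mul, h.metric_symm, Matrix.mul_assoc]
  exact (congrFun (congrFun h1 b) a).symm ▸ rfl

/-- The summand with `f = u` vanishes because `Γ^u_{vb} = 0`, and the others because `∂_v g_{fa} =
0` for `f, a ≠ u`. By symmetry only the `uu` component of this product can be non-zero. -/
lemma conn_low_eq_zero (b : Fin 4) {a : Fin 4} (ha : a ≠ 0) : (Γ 1 * (Γ 1 * g)) b a = 0 := by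
  rw [Matrix.mul_apply]
  refine Finset.sum_eq_zero fun f _ => ?_
  by_cases hf : f = 0
  · rw [hf, h.conn_zero, zero_mul]
  · rw [h.low_eq_zero (h.transverse f a hf ha), mul_zero]

lemma conn_row_one (e : Fin 4) : Γ 1 1 e = 0 := by
  have h1 : ∀ e, (Γ 1 * g) 1 e = 0 := fun e => h.low_eq_zero (h.deriv_row _ _)
  have h2 : Γ 1 = Γ 1 * g * gi := by rw [Matrix.mul_assoc, h.inv, Matrix.mul_one]
  rw [h2, Matrix.mul_apply]
  exact Finset.sum_eq_zero fun f _ => by rw [h1, zero_mul]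

lemma deriv_conn : dm (p 1) (Γ 1) * g =
    dm (p 1) (Γ 1 * g) - (Γ 1 * (Γ 1 * g) + Γ 1 * (Γ 1 * g)) := by
  rw [← Matrix.mul_add, h.low_add_low, dm_mul, add_sub_cancel_right]

/-- The components `R_{avvb}`. -/
lemma lowCurv_special (a b : Fin 4) : lowCurv p g Γ ![a, 1, 1, b] =
    (dm (p 1) (Γ 1 * g) - Γ 1 * (Γ 1 * g)) b a := by
  have h1 : ∀ e, curv p Γ 1 b 1 e = (dm (p 1) (Γ 1) + Γ 1 * Γ 1) b e := fun e => by
    rw [h.curv_eq]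
    have h2 : (Γ 1 * Γ b) 1 e = 0 := by
      rw [Matrix.mul_apply]
      exact Finset.sum_eq_zero fun f _ => by rw [h.conn_row_one, zero_mul]
    have h3 : (Γ b * Γ 1) 1 e = (Γ 1 * Γ 1) b e := by
      simp only [Matrix.mul_apply, h.conn_symm b 1]
    simp only [Matrix.sub_apply, Matrix.add_apply, dm_apply, h2, h3, h.conn_row_one, map_zero,
      h.conn_symm b 1]
    ring
  have h4 : (curv p Γ 1 b * g) 1 a = ((dm (p 1) (Γ 1) + Γ 1 * Γ 1) * g) b a := by
    simp only [Matrix.mul_apply (M := curv p Γ 1 b), h1]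
    rfl
  rw [lowCurv_apply, h4, Matrix.add_mul, h.deriv_conn, Matrix.mul_assoc]
  simp only [Matrix.add_apply, Matrix.sub_apply]
  ring

lemma lowCurv_special_symm (a b : Fin 4) :
    lowCurv p g Γ ![a, 1, 1, b] = lowCurv p g Γ ![b, 1, 1, a] := by
  have h1 := congrFun (congrFun h.low_symm b) a
  rw [Matrix.transpose_apply] at h1
  simp only [h.lowCurv_special, Matrix.sub_apply, dm_apply, h1, h.conn_low_symm b a]

lemma lowCurv_special_eq_zero {a b : Fin 4} (ha : a ≠ 0) (hb : b ≠ 0) :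
    lowCurv p g Γ ![a, 1, 1, b] = 0 := by
  rw [h.lowCurv_special, Matrix.sub_apply, h.conn_low_eq_zero _ ha, dm_apply,
    h.low_eq_zero (h.transverse b a hb ha), map_zero, sub_zero]

/-- The quadratic term of the curvature has only a `uu` component, so what remains is linear in the
metric. The equation is stated doubled to avoid the factor one half. -/
lemma lowCurv_special_add {i : Fin 4} (hi : i ≠ 0) :
    lowCurv p g Γ ![i, 1, 1, 0] + lowCurv p g Γ ![i, 1, 1, 0] = p 1 (p 1 (g 0 i)) := by
  rw [h.lowCurv_special, Matrix.sub_apply, h.conn_low_eq_zero _ hi, sub_zero, dm_apply,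
    ← map_add, h.low_apply_add]

/-- The quadratic term of `R_{uvvu}` is built from the first `v`-derivatives of the `g_{ui}`. Under
`h0` it does not depend on `v`, and the linear term alone survives the derivative. -/
lemma deriv_lowCurv_special (h0 : ∀ i, i ≠ 0 → p 1 (p 1 (g 0 i)) = 0) :
    p 1 (lowCurv p g Γ ![0, 1, 1, 0]) + p 1 (lowCurv p g Γ ![0, 1, 1, 0]) =
      p 1 (p 1 (p 1 (g 0 0))) := by
  have hN : ∀ i, i ≠ 0 → p 1 ((Γ 1 * g) 0 i) = 0 := fun i hi => two_mul_eq_zero_of (by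
    have := congrArg (p 1) (h.low_apply_add 0 i)
    rw [map_add, h0 i hi] at this
    linear_combination this)
  have hN' : ∀ i, i ≠ 0 → p 1 ((Γ 1 * g) i 0) = 0 := fun i hi => by
    have h1 := congrFun (congrFun h.low_symm 0) i
    rw [Matrix.transpose_apply] at h1
    rw [h1, hN i hi]
  have h1 : ∀ a, a ≠ 0 → (dm (p 1) (Γ 1) * g) 0 a = 0 := fun a ha => by
    rw [h.deriv_conn, Matrix.sub_apply, Matrix.add_apply, h.conn_low_eq_zero _ ha, dm_apply,
      hN a ha]
    ring
  -- The lowered row of `∂_v Γ_v` with index `u` is a multiple of `du`, the `v`-row of `g`. Raising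
  -- its index therefore gives a multiple of `∂_v`, without transverse part.
  have h2 : ∀ i, i ≠ 0 → i ≠ 1 → p 1 (Γ 1 0 i) = 0 := fun i _ hi1 => by
    set y := (dm (p 1) (Γ 1) * g) 0 0 with hy
    have h3 : ∀ a, (dm (p 1) (Γ 1) * g) 0 a = y * g 1 a := fun a => by
      rw [h.row]
      by_cases ha : a = 0
      · rw [ha]; simp [hy]
      · rw [h1 a ha]; simp [ha]
    have h4 : dm (p 1) (Γ 1) = dm (p 1) (Γ 1) * g * gi := by
      rw [Matrix.mul_assoc, h.inv, Matrix.mul_one]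
    have h5 : (g * gi) 1 i = 0 := by rw [h.inv, Matrix.one_apply, if_neg (Ne.symm hi1)]
    rw [← dm_apply, h4, Matrix.mul_apply]
    simp only [h3, mul_assoc]
    rw [← Finset.mul_sum, ← Matrix.mul_apply, h5, mul_zero]
  have h3 : p 1 ((Γ 1 * (Γ 1 * g)) 0 0) = 0 := by
    rw [Matrix.mul_apply, map_sum]
    refine Finset.sum_eq_zero fun f _ => ?_
    rw [Derivation.leibniz, smul_eq_mul, smul_eq_mul]
    by_cases hf : f = 0
    · rw [hf, h.conn_zero, map_zero]; ring
    · by_cases hf1 : f = 1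
      · rw [hf1, h.low_eq_zero (h.deriv_row _ _), map_zero]; ring
      · rw [h2 f hf hf1, hN' f hf]; ring
  rw [h.lowCurv_special, Matrix.sub_apply, map_sub, h3, sub_zero, dm_apply, ← map_add, ← map_add,
    h.low_apply_add]

end IsKundtGeometry

variable {E Ei : Matrix (Fin 4) (Fin 4) R} {s : Fin 4 → R}

/-- The curvature of a Kundt metric in a kinematic frame with `ℓ = ∂_v`. -/
lemma trans_lowCurv_special (hl : ∀ a, E 0 a = if a = 1 then 1 else 0)
    (A D : Fin 4) : trans E (lowCurv p g Γ) ![A, 0, 0, D] =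
      ∑ d, E D d * ∑ a, E A a * lowCurv p g Γ ![a, 1, 1, d] := by
  rw [trans_four]
  simp [hl]

/-- For a Kundt metric, the curvature and its derivative are of type II if and only if
`W_{i,vv} = 0` and `H_{,vvv} = 0`. -/
theorem kundt_iff (h : IsKundtGeometry p g gi Γ) (hE : Ei * E = 1) (hη : E * g * Eᵀ = eta s)
    (hs : s 0 = 1) (hl : ∀ a, E 0 a = if a = 1 then 1 else 0)
    (G : IsKinematicGeometry (frameDeriv p E) (frameConn p Γ E Ei) s (trans E (lowCurv p g Γ))) :
    (Ord wt 0 (trans E (lowCurv p g Γ)) ∧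
      Ord wt 0 (nabla (frameDeriv p E) (frameConn p Γ E Ei) (trans E (lowCurv p g Γ)))) ↔
    (∀ i, i ≠ 0 → p 1 (p 1 (g 0 i)) = 0) ∧ p 1 (p 1 (p 1 (g 0 0))) = 0 := by
  -- The `u`-component of `e_D` is its scalar product with `ℓ = ∂_v`, so only `n` has one.
  have hu : ∀ D, E D 0 = if D = 1 then 1 else 0 := fun D => by
    have h1 : (E * g * Eᵀ) 0 D = E D 0 := by
      rw [Matrix.mul_assoc, Matrix.mul_apply]
      simp only [hl, ite_mul, one_mul, zero_mul, Finset.sum_ite_eq', Finset.mem_univ, if_true]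
      rw [Matrix.mul_apply]
      simp [h.row]
    rw [← h1, hη]
    simp only [eta, Matrix.of_apply, hs]
    rfl
  have hD : ∀ f, frameDeriv p E 0 f = p 1 f := fun f => by
    rw [frameDeriv_apply]; simp [hl]
  -- For `D = m, m̄` only the `u`-component of `n` contributes, because `R_{avvd} = 0` when `a, d ≠
  -- u`.
  have hW : ∀ D, boostWeight D = 0 → trans E (lowCurv p g Γ) ![0, 1, 0, D] +
      trans E (lowCurv p g Γ) ![0, 1, 0, D] = - ∑ d, E D d * p 1 (p 1 (g 0 d)) := fun D hD0 => by
    have hDu : E D 0 = 0 := by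
      rw [hu, if_neg]; rintro rfl; simp [boostWeight] at hD0
    rw [G.symm.swap' 1 0 0 D, trans_lowCurv_special hl, ← neg_add, ← Finset.sum_add_distrib]
    congr 1
    refine Finset.sum_congr rfl fun d _ => ?_
    by_cases hd : d = 0
    · rw [hd, hDu]; ring
    · rw [Finset.sum_eq_single 0 (fun a _ ha => by rw [h.lowCurv_special_eq_zero ha hd, mul_zero])
        (by simp), hu, if_pos rfl, h.lowCurv_special_symm, ← h.lowCurv_special_add hd]
      ring
  have hH : (∀ i, i ≠ 0 → p 1 (p 1 (g 0 i)) = 0) →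
      p 1 (trans E (lowCurv p g Γ) ![0, 1, 0, 1]) + p 1 (trans E (lowCurv p g Γ) ![0, 1, 0, 1]) =
        - p 1 (p 1 (p 1 (g 0 0))) := fun h0 => by
    have hz : ∀ i, i ≠ 0 → lowCurv p g Γ ![i, 1, 1, 0] = 0 := fun i hi =>
      two_mul_eq_zero_of (by
        have := h.lowCurv_special_add hi
        rw [h0 i hi] at this
        linear_combination this)
    have h1 : trans E (lowCurv p g Γ) ![0, 1, 0, 1] = - lowCurv p g Γ ![0, 1, 1, 0] := by
      rw [G.symm.swap' 1 0 0 1, trans_lowCurv_special hl]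
      congr 1
      rw [Finset.sum_eq_single 0, Finset.sum_eq_single 0, hu, if_pos rfl]
      · ring
      · intro a _ ha; rw [hz a ha, mul_zero]
      · simp
      · intro d _ hd
        rw [Finset.sum_eq_zero, mul_zero]
        intro a _
        by_cases ha : a = 0
        · rw [ha, h.lowCurv_special_symm, hz d hd, mul_zero]
        · rw [h.lowCurv_special_eq_zero ha hd, mul_zero]
      · simp
    rw [h1, map_neg, ← neg_add, h.deriv_lowCurv_special h0]
  constructor
  · rintro ⟨h0, h1⟩
    have hw : ∀ i, i ≠ 0 → p 1 (p 1 (g 0 i)) = 0 := by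
      have h2 : ∀ D, boostWeight D = 0 → ∑ d, E D d * p 1 (p 1 (g 0 d)) = 0 := fun D hD0 => by
        have h3 := hW D hD0
        rw [h0 _ (by rw [wt_four, hD0]; simp [boostWeight])] at h3
        linear_combination h3
      have hg1 : p 1 (p 1 (g 0 1)) = 0 := by rw [h.metric_apply_symm, h.deriv_row, map_zero]
      -- The rows `m` and `m̄` of `E` annihilate the covector with entries `∂_v² g_{ud}`, whatever
      -- its `u`-entry is. That entry is chosen to make row `n` vanish as well; row `ℓ` picks out
      -- the zero `v`-entry. Then `E w = 0`, and `E` is invertible.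
      set w : Fin 4 → R := fun d => if d = 0 then
        -∑ i, (if i = 0 then 0 else E 1 i * p 1 (p 1 (g 0 i))) else p 1 (p 1 (g 0 d)) with hw
      have h4 : E *ᵥ w = 0 := by
        ext D
        have h5 : ∀ D, (E *ᵥ w) D = E D 0 * w 0 + E D 1 * w 1 + E D 2 * w 2 + E D 3 * w 3 :=
          fun D => by simp [Matrix.mulVec, dotProduct, Fin.sum_univ_four]
        have hw1 : w 1 = 0 := by simp [hw, hg1]
        have hwi : ∀ i, i ≠ 0 → w i = p 1 (p 1 (g 0 i)) := fun i hi => by simp [hw, hi]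
        have h6 : ∀ D, boostWeight D = 0 → E D 0 = 0 := fun D hD0 => by
          rw [hu, if_neg]; rintro rfl; simp [boostWeight] at hD0
        have h7 : ∀ D, boostWeight D = 0 → (E *ᵥ w) D = 0 := fun D hD0 => by
          have h8 := h2 D hD0
          rw [Fin.sum_univ_four, h6 D hD0, hg1] at h8
          rw [h5, h6 D hD0, hw1, hwi 2 (by decide), hwi 3 (by decide)]
          linear_combination h8
        have hb1 : D = 0 ∨ D = 1 ∨ boostWeight D = 0 := by revert D; decide
        rcases hb1 with rfl | rfl | hb
        · rw [h5, hw1, hl, hl, hl, hl]; simp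
        · rw [h5, hw1, hu, hwi 2 (by decide), hwi 3 (by decide)]
          simp [hw, Fin.sum_univ_four, hg1]
        · exact h7 D hb
      have h9 : w = 0 := by
        rw [← Matrix.one_mulVec w, ← hE, ← Matrix.mulVec_mulVec, h4, Matrix.mulVec_zero]
      intro i hi
      have := congrFun h9 i
      simpa [hw, hi] using this
    refine ⟨hw, ?_⟩
    have h2 := IsKinematicGeometry.ord_nab_of_nabla h1 ![0, 1, 0, 1] (by rw [wt_four]; simp [boostWeight])
    rw [G.nab_riem_special h0, hD] at h2
    have h3 := hH hw
    rw [h2] at h3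
    linear_combination h3
  · rintro ⟨hw, hh⟩
    have h0 : Ord wt 0 (trans E (lowCurv p g Γ)) := G.ord_riem fun D hD0 =>
      two_mul_eq_zero_of (by
        have h1 := hW D hD0
        have h2 : ∑ d, E D d * p 1 (p 1 (g 0 d)) = 0 := Finset.sum_eq_zero fun d _ => by
          by_cases hd : d = 0
          · rw [hd, hu, if_neg, zero_mul]; rintro rfl; simp [boostWeight] at hD0
          · rw [hw d hd, mul_zero]
        linear_combination h1 - h2)
    refine ⟨h0, G.ord_nabla_riem h0 ?_⟩
    rw [hD]
    exact two_mul_eq_zero_of (by linear_combination hH hw - hh)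

end

end Kundt

/-! ### The Kundt line element: signature and smoothness. -/

noncomputable section

namespace Kundt

variable {U : Set Coord} {ς : ℝ} {H : Coord → ℝ} {W : Fin 2 → Coord → ℝ}
  {h : Coord → Matrix (Fin 2) (Fin 2) ℝ}

lemma kundtMetric_bilin (x : Coord) (p q : Fin 4 → ℂ) :
    ∑ a, ∑ b, (kundtMetric H W h x a b : ℂ) * p a * q b =
      2 * H x * p 0 * q 0 + p 0 * q 1 + p 1 * q 0 + W 0 x * (p 0 * q 2 + p 2 * q 0) +
      W 1 x * (p 0 * q 3 + p 3 * q 0) + h x 0 0 * p 2 * q 2 + h x 0 1 * p 2 * q 3 +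
      h x 1 0 * p 3 * q 2 + h x 1 1 * p 3 * q 3 := by
  simp [Fin.sum_univ_four, kundtMetric]
  ring

lemma kundtMetric_bilin_real (x : Coord) (p q : Fin 4 → ℝ) :
    ∑ a, ∑ b, kundtMetric H W h x a b * p a * q b =
      2 * H x * p 0 * q 0 + p 0 * q 1 + p 1 * q 0 + W 0 x * (p 0 * q 2 + p 2 * q 0) +
      W 1 x * (p 0 * q 3 + p 3 * q 0) + h x 0 0 * p 2 * q 2 + h x 0 1 * p 2 * q 3 +
      h x 1 0 * p 3 * q 2 + h x 1 1 * p 3 * q 3 := by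
  simp [Fin.sum_univ_four, kundtMetric]
  ring

lemma kundtMetric_row (x : Coord) (b : Fin 4) :
    kundtMetric H W h x 1 b = if b = 0 then 1 else 0 := by
  fin_cases b <;> simp [kundtMetric]

lemma pd_const {V : Type} [NormedAddCommGroup V] [NormedSpace ℝ V] (a : Fin 4) (v : V) (x : Coord) :
    pd a (fun _ => v) x = 0 := by simp [pd]

namespace IsKundtData

variable (hd : IsKundtData ς U H W h)
include hd

lemma h_symm {x : Coord} (hς : ς ≠ 0) (hx : x ∈ U) : h x 1 0 = h x 0 1 := by
  have h1 := (hd.definite x hx).1.apply 0 1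
  simp only [Matrix.smul_apply, smul_eq_mul, star_trivial] at h1
  exact mul_left_cancel₀ hς h1

lemma diag_pos {x : Coord} (hx : x ∈ U) : 0 < ς * h x 0 0 := by
  simpa using (hd.definite x hx).diag_pos (i := 0)

lemma det_pos (hς : ς = 1 ∨ ς = -1) {x : Coord} (hx : x ∈ U) :
    0 < h x 0 0 * h x 1 1 - h x 0 1 ^ 2 := by
  have hς0 : ς ≠ 0 := by rcases hς with rfl | rfl <;> norm_num
  have h1 := (hd.definite x hx).det_pos
  rw [Matrix.det_fin_two] at h1
  simp only [Matrix.smul_apply, smul_eq_mul, hd.h_symm hς0 hx] at h1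
  have h2 : ς * ς = 1 := by rcases hς with rfl | rfl <;> norm_num
  have h3 : ς * h x 0 0 * (ς * h x 1 1) - ς * h x 0 1 * (ς * h x 0 1) =
      h x 0 0 * h x 1 1 - h x 0 1 ^ 2 := by
    linear_combination (h x 0 0 * h x 1 1 - h x 0 1 ^ 2) * h2
  rwa [h3] at h1

lemma smooth_metric (a b : Fin 4) : ContDiffOn ℝ ∞ (fun x => kundtMetric H W h x a b) U := by
  have hH : ContDiffOn ℝ ∞ (fun x => 2 * H x) U := contDiffOn_const.mul hd.smooth_H
  have h0 := hd.smooth_W 0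
  have h1 := hd.smooth_W 1
  have h00 := hd.smooth_h 0 0
  have h01 := hd.smooth_h 0 1
  have h10 := hd.smooth_h 1 0
  have h11 := hd.smooth_h 1 1
  have c0 : ContDiffOn ℝ ∞ (fun _ : Coord => (0 : ℝ)) U := contDiffOn_const
  have c1 : ContDiffOn ℝ ∞ (fun _ : Coord => (1 : ℝ)) U := contDiffOn_const
  fin_cases a <;> fin_cases b
  exacts [hH, c1, h0, h1, c1, c0, c0, c0, h0, c0, h00, h01, h1, c0, h10, h11]

lemma metric_symm (hς : ς ≠ 0) {x : Coord} (hx : x ∈ U) : (kundtMetric H W h x).IsSymm := by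
  have h1 := hd.h_symm hς hx
  ext a b
  fin_cases a <;> fin_cases b <;> simp [kundtMetric, h1]

/-- The derivative of the metric along `∂_v` has only the components `uu` and `ui`. -/
lemma pd_metric_eq_zero {x : Coord} (hx : x ∈ U) {a b : Fin 4} (ha : a ≠ 0) (hb : b ≠ 0) :
    pd 1 (fun y => kundtMetric H W h y a b) x = 0 := by
  have h00 := hd.h_v 0 0 x hx
  have h01 := hd.h_v 0 1 x hx
  have h10 := hd.h_v 1 0 x hx
  have h11 := hd.h_v 1 1 x hx
  have c0 : pd 1 (fun _ : Coord => (0 : ℝ)) x = 0 := pd_const _ _ _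
  fin_cases a <;> fin_cases b
  exacts [absurd rfl ha, absurd rfl ha, absurd rfl ha, absurd rfl ha, absurd rfl hb, c0, c0, c0,
    absurd rfl hb, c0, h00, h01, absurd rfl hb, c0, h10, h11]

omit hd in
lemma pd_metric_row (c b : Fin 4) (x : Coord) :
    pd c (fun y => kundtMetric H W h y 1 b) x = 0 := by
  simp only [kundtMetric_row, pd_const]

omit hd in
lemma pd_metric_col (c a : Fin 4) (x : Coord) :
    pd c (fun y => kundtMetric H W h y a 1) x = 0 := by
  have : ∀ y, kundtMetric H W h y a 1 = if a = 0 then 1 else 0 := fun y => by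
    fin_cases a <;> simp [kundtMetric]
  simp only [this, pd_const]

/-- The Kundt metric is Lorentzian. -/
theorem isLorentzMetric (hς : ς = 1 ∨ ς = -1) : IsLorentzMetric ς U (kundtMetric H W h) where
  smooth := hd.smooth_metric
  symm x hx := hd.metric_symm (by rcases hς with rfl | rfl <;> norm_num) hx
  signature x hx := by
    have hς0 : ς ≠ 0 := by rcases hς with rfl | rfl <;> norm_num
    have hς2 : ς * ς = 1 := by rcases hς with rfl | rfl <;> norm_num
    have hs := hd.h_symm hς0 hx
    have hk := hd.diag_pos hx
    have hD := hd.det_pos hς hx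
    -- The numbers `δ` and `c` normalize an orthogonal basis of the transverse metric, and `r =
    -- 1/√2` normalizes the combinations of the two null vectors.
    obtain ⟨δ, hδ⟩ : ∃ δ, δ ^ 2 = h x 0 0 * h x 1 1 - h x 0 1 ^ 2 := ⟨_, Real.sq_sqrt hD.le⟩
    obtain ⟨c, hc⟩ : ∃ c, c ^ 2 * (ς * h x 0 0 * δ ^ 2) = 1 := by
      refine ⟨(√(ς * h x 0 0 * δ ^ 2))⁻¹, ?_⟩
      have : 0 < ς * h x 0 0 * δ ^ 2 := by rw [hδ]; positivity
      rw [inv_pow, Real.sq_sqrt this.le, inv_mul_cancel₀ this.ne']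
    obtain ⟨r, hr⟩ : ∃ r : ℝ, r ^ 2 * 2 = 1 := ⟨(√2)⁻¹, by
      rw [inv_pow, Real.sq_sqrt (by norm_num)]; norm_num⟩
    -- The first two vectors are `r (n ∓ ς ∂_v)` with the null vector `n = ∂_u - H ∂_v`. The other
    -- two have transverse parts proportional to `(-h₀₁, h₀₀)` and `(1, 0)`; their `v`-components
    -- make them orthogonal to `∂_u`.
    let P : Fin 4 → Fin 4 → ℝ := ![![r, r * (-H x - ς), 0, 0], ![r, r * (-H x + ς), 0, 0],
      ![0, c * (ς * (W 0 x * h x 0 1 - W 1 x * h x 0 0)), -(c * (ς * h x 0 1)), c * (ς * h x 0 0)],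
      ![0, -(c * (W 0 x * δ)), c * δ, 0]]
    have hP : ∀ a b, ((Matrix.of P)ᵀᵀ * kundtMetric H W h x * (Matrix.of P)ᵀ) a b =
        (ς • Matrix.diagonal ![-1, 1, 1, 1]) a b := fun a b => by
      have h1 : ((Matrix.of P)ᵀᵀ * kundtMetric H W h x * (Matrix.of P)ᵀ) a b =
          ∑ c, ∑ d, kundtMetric H W h x c d * P a c * P b d := by
        rw [Matrix.mul_assoc, Matrix.mul_apply]
        simp only [Matrix.mul_apply, Finset.mul_sum, Matrix.transpose_apply, Matrix.of_apply]
        exact Finset.sum_congr rfl fun c _ => Finset.sum_congr rfl fun d _ => by ring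
      rw [h1, kundtMetric_bilin_real, hs]
      fin_cases a <;> fin_cases b <;> simp [P, Matrix.diagonal]
      · linear_combination -ς * hr
      · ring
      · ring
      · ring
      · ring
      · linear_combination ς * hr
      · ring
      · ring
      · ring
      · ring
      · linear_combination ς * hc - c ^ 2 * h x 0 0 * ς ^ 2 * hδ
      · ring
      · ring
      · ring
      · ring
      · linear_combination ς * hc - c ^ 2 * h x 0 0 * δ ^ 2 * hς2
    have hP' := Matrix.ext hP
    refine ⟨(Matrix.of P)ᵀ, ?_, hP'⟩
    have h1 := congrArg Matrix.det hP'
    rw [Matrix.det_mul, Matrix.det_smul, Matrix.det_diagonal] at h1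
    refine isUnit_iff_ne_zero.2 fun h0 => ?_
    rw [h0] at h1
    simp [Fin.prod_univ_four, hς0] at h1

end IsKundtData

end Kundt

end

/-! ### A null tetrad adapted to `∂_v`. -/

noncomputable section

namespace Kundt

variable {U : Set Coord} {ς : ℝ} {H : Coord → ℝ} {W : Fin 2 → Coord → ℝ}
  {h : Coord → Matrix (Fin 2) (Fin 2) ℝ}

/-- The root of the determinant of the transverse metric. -/
def rootDet (h : Coord → Matrix (Fin 2) (Fin 2) ℝ) (x : Coord) : ℝ :=
  √(h x 0 0 * h x 1 1 - h x 0 1 ^ 2)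

/-- The factor that normalizes the complex null vector of the transverse metric. -/
def normFactor (ς : ℝ) (h : Coord → Matrix (Fin 2) (Fin 2) ℝ) (x : Coord) : ℝ :=
  (√(2 * (ς * h x 0 0) * (h x 0 0 * h x 1 1 - h x 0 1 ^ 2)))⁻¹

/-- The transverse components of the complex null vector of the transverse metric. -/
def transM (ς : ℝ) (h : Coord → Matrix (Fin 2) (Fin 2) ℝ) (x : Coord) : Fin 2 → ℂ :=
  ![normFactor ς h x * (-((ς * h x 0 1 : ℝ) : ℂ) + rootDet h x * Complex.I),
    normFactor ς h x * ((ς * h x 0 0 : ℝ) : ℂ)]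

/-- A null tetrad for the Kundt metric with `ℓ = ∂_v`. -/
def kundtFrame (ς : ℝ) (H : Coord → ℝ) (W : Fin 2 → Coord → ℝ)
    (h : Coord → Matrix (Fin 2) (Fin 2) ℝ) : Tetrad where
  l _ := Pi.single 1 1
  n x := ![1, -H x, 0, 0]
  m x := ![0, -(W 0 x * transM ς h x 0 + W 1 x * transM ς h x 1), transM ς h x 0, transM ς h x 1]

lemma kundtFrame_e_zero (x : Coord) (a : Fin 4) :
    (kundtFrame ς H W h).e 0 x a = if a = 1 then 1 else 0 := by
  fin_cases a <;> simp [Tetrad.e, kundtFrame]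

lemma kundtFrame_e_one (x : Coord) :
    (kundtFrame ς H W h).e 1 x = ![1, -(H x : ℂ), 0, 0] := by
  ext a
  fin_cases a <;> simp [Tetrad.e, kundtFrame]

lemma kundtFrame_e_two (x : Coord) : (kundtFrame ς H W h).e 2 x =
    ![0, -(W 0 x * transM ς h x 0 + W 1 x * transM ς h x 1), transM ς h x 0, transM ς h x 1] := rfl

lemma kundtFrame_e_three (x : Coord) : (kundtFrame ς H W h).e 3 x =
    ![0, -(W 0 x * star (transM ς h x 0) + W 1 x * star (transM ς h x 1)), star (transM ς h x 0),
      star (transM ς h x 1)] := by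
  ext a
  fin_cases a <;> simp [Tetrad.e, kundtFrame]

/-- A function that is differentiable at a point, with vanishing derivative along `∂_v`. -/
def ConstV {V : Type} [NormedAddCommGroup V] [NormedSpace ℝ V] (f : Coord → V) (x : Coord) : Prop :=
  DifferentiableAt ℝ f x ∧ pd 1 f x = 0

namespace ConstV

lemma const {V : Type} [NormedAddCommGroup V] [NormedSpace ℝ V] (c : V) (x : Coord) :
    ConstV (fun _ => c) x := ⟨differentiableAt_const c, pd_const _ _ _⟩

lemma ofReal {f : Coord → ℝ} {x : Coord} (hf : ConstV f x) : ConstV (fun y => (f y : ℂ)) x :=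
  ⟨Complex.ofRealCLM.differentiableAt.comp x hf.1, by rw [pd_ofReal hf.1, hf.2, Complex.ofReal_zero]⟩

lemma comp {f : Coord → ℝ} {x : Coord} {φ : ℝ → ℝ} (hφ : DifferentiableAt ℝ φ (f x))
    (hf : ConstV f x) : ConstV (fun y => φ (f y)) x := by
  refine ⟨hφ.comp x hf.1, ?_⟩
  have h1 := hf.2
  unfold pd at *
  have h2 : fderiv ℝ (fun y => φ (f y)) x = (fderiv ℝ φ (f x)).comp (fderiv ℝ f x) :=
    fderiv_comp x hφ hf.1
  rw [h2]
  simp [h1]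

variable {V : Type} [NormedCommRing V] [NormedAlgebra ℝ V] {f f' : Coord → V} {x : Coord}

lemma mul (hf : ConstV f x) (hf' : ConstV f' x) : ConstV (fun y => f y * f' y) x := by
  refine ⟨hf.1.mul hf'.1, ?_⟩
  have h1 := hf.2
  have h2 := hf'.2
  unfold pd at *
  rw [fderiv_fun_mul hf.1 hf'.1]
  simp [h1, h2]

lemma add (hf : ConstV f x) (hf' : ConstV f' x) : ConstV (fun y => f y + f' y) x := by
  refine ⟨hf.1.add hf'.1, ?_⟩
  have h1 := hf.2
  have h2 := hf'.2
  unfold pd at *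
  rw [fderiv_fun_add hf.1 hf'.1]
  simp [h1, h2]

end ConstV

namespace IsKundtData

variable (hd : IsKundtData ς U H W h)
include hd

lemma det_smooth : ContDiffOn ℝ ∞ (fun x => h x 0 0 * h x 1 1 - h x 0 1 ^ 2) U :=
  ((hd.smooth_h 0 0).mul (hd.smooth_h 1 1)).sub ((hd.smooth_h 0 1).pow 2)

lemma smooth_rootDet (hς : ς = 1 ∨ ς = -1) : ContDiffOn ℝ ∞ (rootDet h) U :=
  hd.det_smooth.sqrt fun _ hx => (hd.det_pos hς hx).ne'

lemma norm_pos (hς : ς = 1 ∨ ς = -1) {x : Coord} (hx : x ∈ U) :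
    0 < 2 * (ς * h x 0 0) * (h x 0 0 * h x 1 1 - h x 0 1 ^ 2) := by
  have h1 := hd.det_pos hς hx
  have h2 := hd.diag_pos hx
  positivity

lemma smooth_normFactor (hς : ς = 1 ∨ ς = -1) : ContDiffOn ℝ ∞ (normFactor ς h) U := by
  have h1 : ContDiffOn ℝ ∞ (fun x => 2 * (ς * h x 0 0) * (h x 0 0 * h x 1 1 - h x 0 1 ^ 2)) U :=
    (contDiffOn_const.mul (contDiffOn_const.mul (hd.smooth_h 0 0))).mul hd.det_smooth
  exact (h1.sqrt fun _ hx => (hd.norm_pos hς hx).ne').inv fun _ hx =>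
    (Real.sqrt_pos.2 (hd.norm_pos hς hx)).ne'

lemma smooth_transM (hς : ς = 1 ∨ ς = -1) (i : Fin 2) :
    ContDiffOn ℝ ∞ (fun x => transM ς h x i) U := by
  have h1 := contDiffOn_ofReal (hd.smooth_normFactor hς)
  have h2 := contDiffOn_ofReal (hd.smooth_rootDet hς)
  have h3 : ∀ j, ContDiffOn ℝ ∞ (fun x => ((ς * h x 0 j : ℝ) : ℂ)) U := fun j =>
    contDiffOn_ofReal (contDiffOn_const.mul (hd.smooth_h 0 j))
  fin_cases i
  · exact h1.mul ((h3 1).neg.add (h2.mul contDiffOn_const))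
  · exact h1.mul (h3 0)

lemma constV_h (hU : IsOpen U) (i j : Fin 2) {x : Coord} (hx : x ∈ U) :
    ConstV (fun y => h y i j) x :=
  ⟨differentiableAt_of_smooth hU (hd.smooth_h i j) hx, hd.h_v i j x hx⟩

lemma constV_det (hU : IsOpen U) {x : Coord} (hx : x ∈ U) :
    ConstV (fun y => h y 0 0 * h y 1 1 - h y 0 1 ^ 2) x := by
  have h1 := ((hd.constV_h hU 0 0 hx).mul (hd.constV_h hU 1 1 hx)).add
    ((ConstV.const (-1 : ℝ) x).mul ((hd.constV_h hU 0 1 hx).mul (hd.constV_h hU 0 1 hx)))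
  have : (fun y => h y 0 0 * h y 1 1 - h y 0 1 ^ 2) =
      fun y => h y 0 0 * h y 1 1 + -1 * (h y 0 1 * h y 0 1) := by ext y; ring
  rw [this]; exact h1

lemma constV_rootDet (hU : IsOpen U) (hς : ς = 1 ∨ ς = -1) {x : Coord} (hx : x ∈ U) :
    ConstV (rootDet h) x :=
  ConstV.comp (φ := Real.sqrt) (differentiableAt_id.sqrt (hd.det_pos hς hx).ne')
    (hd.constV_det hU hx)

lemma constV_normFactor (hU : IsOpen U) (hς : ς = 1 ∨ ς = -1) {x : Coord} (hx : x ∈ U) :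
    ConstV (normFactor ς h) x := by
  have h1 := ((ConstV.const (2 : ℝ) x).mul ((ConstV.const ς x).mul (hd.constV_h hU 0 0 hx))).mul
    (hd.constV_det hU hx)
  exact ConstV.comp (φ := fun t => (√t)⁻¹) ((differentiableAt_id.sqrt (hd.norm_pos hς hx).ne').inv
    (Real.sqrt_pos.2 (hd.norm_pos hς hx)).ne') h1

lemma normFactor_sq (hς : ς = 1 ∨ ς = -1) {x : Coord} (hx : x ∈ U) :
    normFactor ς h x ^ 2 * (2 * (ς * h x 0 0) * rootDet h x ^ 2) = 1 := by
  rw [normFactor, rootDet, Real.sq_sqrt (hd.det_pos hς hx).le, inv_pow,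
    Real.sq_sqrt (hd.norm_pos hς hx).le, inv_mul_cancel₀ (hd.norm_pos hς hx).ne']

lemma rootDet_sq (hς : ς = 1 ∨ ς = -1) {x : Coord} (hx : x ∈ U) :
    rootDet h x ^ 2 = h x 0 0 * h x 1 1 - h x 0 1 ^ 2 := Real.sq_sqrt (hd.det_pos hς hx).le

/-- The ratio of the transverse components of `m` is a complex root of `h₀₀ z² + 2 h₀₁ z + h₁₁`,
which makes `m` null; `normFactor` fixes `m · m̄`, and the `v`-component of `m` makes it orthogonal
to `n`. -/
lemma isNullTetrad_kundtFrame (hς : ς = 1 ∨ ς = -1) :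
    IsNullTetrad ς U (kundtMetric H W h) (kundtFrame ς H W h) where
  smooth_l := contDiffOn_const
  smooth_n := contDiffOn_pi.2 fun a => by
    have h1 := hd.smooth_H.neg
    fin_cases a
    exacts [contDiffOn_const, h1, contDiffOn_const, contDiffOn_const]
  smooth_m := contDiffOn_pi.2 fun a => by
    have h0 := hd.smooth_transM hς 0
    have h1 := hd.smooth_transM hς 1
    have h2 := (((contDiffOn_ofReal (hd.smooth_W 0)).mul h0).add
      ((contDiffOn_ofReal (hd.smooth_W 1)).mul h1)).neg
    fin_cases a
    exacts [contDiffOn_const, h2, h0, h1]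
  dot_ll x hx := by
    rw [Tetrad.dot, kundtMetric_bilin]; simp [kundtFrame_e_zero]
  dot_ln x hx := by
    rw [Tetrad.dot, kundtMetric_bilin]; simp [kundtFrame_e_zero, kundtFrame_e_one]
  dot_lm x hx := by
    rw [Tetrad.dot, kundtMetric_bilin]; simp [kundtFrame_e_zero, kundtFrame_e_two]
  dot_nn x hx := by
    rw [Tetrad.dot, kundtMetric_bilin]; simp [kundtFrame_e_one]; ring
  dot_nm x hx := by
    rw [Tetrad.dot, kundtMetric_bilin]; simp [kundtFrame_e_one, kundtFrame_e_two]
  dot_mm x hx := by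
    have hς0 : ς ≠ 0 := by rcases hς with rfl | rfl <;> norm_num
    have hς2 : (ς : ℂ) ^ 2 = 1 := by rcases hς with rfl | rfl <;> norm_num
    have h1 : (rootDet h x : ℂ) ^ 2 = h x 0 0 * h x 1 1 - h x 0 1 ^ 2 := by
      exact_mod_cast hd.rootDet_sq hς hx
    rw [Tetrad.dot, kundtMetric_bilin, hd.h_symm hς0 hx]
    simp [kundtFrame_e_two, transM]
    linear_combination ((normFactor ς h x : ℂ) ^ 2 * h x 0 0) * ((rootDet h x : ℂ) ^ 2 * Complex.I_sq
      - h1 + (h x 0 0 * h x 1 1 - h x 0 1 ^ 2) * hς2)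
  dot_mmbar x hx := by
    have hς0 : ς ≠ 0 := by rcases hς with rfl | rfl <;> norm_num
    have hς2 : (ς : ℂ) ^ 2 = 1 := by rcases hς with rfl | rfl <;> norm_num
    have h1 : (rootDet h x : ℂ) ^ 2 = h x 0 0 * h x 1 1 - h x 0 1 ^ 2 := by
      exact_mod_cast hd.rootDet_sq hς hx
    have h2 : (normFactor ς h x : ℂ) ^ 2 * (2 * (ς * h x 0 0) * rootDet h x ^ 2) = 1 := by
      exact_mod_cast hd.normFactor_sq hς hx
    rw [Tetrad.dot, kundtMetric_bilin, hd.h_symm hς0 hx]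
    simp [kundtFrame_e_two, kundtFrame_e_three, transM]
    linear_combination (ς : ℂ) * h2 + ((normFactor ς h x : ℂ) ^ 2 * h x 0 0) *
      (-(rootDet h x : ℂ) ^ 2 * Complex.I_sq - h1 +
        (h x 0 0 * h x 1 1 - h x 0 1 ^ 2 - 2 * rootDet h x ^ 2) * hς2)

end IsKundtData

end Kundt

end

/-! ### The spin coefficients of the adapted tetrad. -/

noncomputable section

namespace Kundt

variable {U : Set Coord} {ς : ℝ} {H : Coord → ℝ} {W : Fin 2 → Coord → ℝ}
  {h : Coord → Matrix (Fin 2) (Fin 2) ℝ}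

lemma covD_covector (g : MetricField) (T : CovTensor ℂ 1) (x : Coord) (a b : Fin 4) :
    covD g T x ![a, b] =
      pd b (fun y => T y ![a]) x - ∑ c, (christoffel g c b a x : ℂ) * T x ![c] := by
  have h1 : Fin.init ![a, b] = ![a] := by
    ext i; fin_cases i; rfl
  have h2 : (![a, b] : Fin 2 → Fin 4) (Fin.last 1) = b := rfl
  have h3 : ∀ c, Function.update ![a] 0 c = ![c] := fun c => by
    ext i; fin_cases i; simp
  rw [covD, h1, h2]
  simp [h3, Complex.real_smul]

lemma kundtFrame_alignedWithV : (kundtFrame ς H W h).AlignedWithV U := fun _ _ => rfl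

namespace IsKundtData

variable (hd : IsKundtData ς U H W h)
include hd

lemma christoffel_zero (hU : IsOpen U) (hς : ς = 1 ∨ ς = -1) (a b : Fin 4) {x : Coord}
    (hx : x ∈ U) : christoffel (kundtMetric H W h) 0 b a x =
      -(1 / 2) * pd 1 (fun y => kundtMetric H W h y b a) x := by
  have hς0 : ς ≠ 0 := by rcases hς with rfl | rfl <;> norm_num
  have hg := hd.isLorentzMetric hς
  have h1 := hg.christoffel_low hU hς0 a 1 b hx
  have h2 : ∀ f, kundtMetric H W h x f 1 = if f = 0 then 1 else 0 := fun f => by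
    rw [hg.apply_symm hx, kundtMetric_row]
  simp only [h2, pd_metric_row] at h1
  simp at h1
  linarith

/-- Since `ℓ_a dx^a = du` has constant components, only `-Γ^u_{ab}` is left. It vanishes unless one
of the indices is `u`, which gives `κ = σ = ρ = 0`. -/
lemma covD_low_zero (hU : IsOpen U) (hς : ς = 1 ∨ ς = -1) (a b : Fin 4) {x : Coord}
    (hx : x ∈ U) : covD (kundtMetric H W h) ((kundtFrame ς H W h).low (kundtMetric H W h) 0) x
      ![a, b] = ((1 / 2 * pd 1 (fun y => kundtMetric H W h y b a) x : ℝ) : ℂ) := by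
  have hlow : ∀ y a, (kundtFrame ς H W h).low (kundtMetric H W h) 0 y ![a] =
      if a = 0 then 1 else 0 := fun y a => by
    simp only [Tetrad.low, kundtFrame_e_zero]
    fin_cases a <;> simp [kundtMetric]
  rw [covD_covector]
  simp only [hlow]
  rw [pd_const]
  simp [hd.christoffel_zero hU hς a b hx]

/-- For `a ≠ u` the component `m_a` only involves the `v`-independent transverse data. The
connection term is `½ m^b ∂_v g_{ba}`, where `b = u` drops out by `m^u = 0` and the other values of
`b` by `∂_v g_{ba} = 0`. -/
lemma covD_low_two (hU : IsOpen U) (hς : ς = 1 ∨ ς = -1) {a : Fin 4} (ha : a ≠ 0) {x : Coord}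
    (hx : x ∈ U) : covD (kundtMetric H W h) ((kundtFrame ς H W h).low (kundtMetric H W h) 2) x
      ![a, 1] = 0 := by
  have hς0 : ς ≠ 0 := by rcases hς with rfl | rfl <;> norm_num
  have hg := hd.isLorentzMetric hς
  have hm : ∀ i, ConstV (fun y => transM ς h y i) x := fun i => by
    have h1 := (hd.constV_normFactor hU hς hx).ofReal
    have h2 := (hd.constV_rootDet hU hς hx).ofReal
    have h3 : ∀ j, ConstV (fun y => ((ς * h y 0 j : ℝ) : ℂ)) x := fun j =>
      ((ConstV.const ς x).mul (hd.constV_h hU 0 j hx)).ofReal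
    fin_cases i
    · have h4 := h1.mul (((ConstV.const (-1 : ℂ) x).mul (h3 1)).add
        (h2.mul (ConstV.const Complex.I x)))
      simpa [transM] using h4
    · exact h1.mul (h3 0)
  have h1 : pd 1 (fun y => (kundtFrame ς H W h).low (kundtMetric H W h) 2 y ![a]) x = 0 := by
    simp only [Tetrad.low, Fin.sum_univ_four, kundtFrame_e_two]
    have h2 : ∀ i, ConstV (fun y => (h y i 0 : ℂ) * transM ς h y 0 + h y i 1 * transM ς h y 1) x :=
      fun i => ((hd.constV_h hU i 0 hx).ofReal.mul (hm 0)).add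
        ((hd.constV_h hU i 1 hx).ofReal.mul (hm 1))
    fin_cases a
    · exact absurd rfl ha
    · simp [kundtMetric, pd_const]
    · simpa [kundtMetric] using (h2 0).2
    · simpa [kundtMetric] using (h2 1).2
  have h3 : ∀ b, ∑ c, (christoffel (kundtMetric H W h) c 1 a x : ℂ) * kundtMetric H W h x c b =
      ((1 / 2 * pd 1 (fun y => kundtMetric H W h y b a) x : ℝ) : ℂ) := fun b => by
    have h4 := hg.christoffel_low hU hς0 a b 1 hx
    rw [pd_metric_col, pd_metric_row, add_zero, sub_zero] at h4
    exact_mod_cast h4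
  rw [covD_covector, h1, zero_sub, neg_eq_zero]
  simp only [Tetrad.low, Finset.mul_sum]
  rw [Finset.sum_comm]
  refine Finset.sum_eq_zero fun b _ => ?_
  have h5 : ∑ c, (christoffel (kundtMetric H W h) c 1 a x : ℂ) *
      ((kundtMetric H W h x (![c] 0) b : ℂ) * (kundtFrame ς H W h).e 2 x b) =
      ((1 / 2 * pd 1 (fun y => kundtMetric H W h y b a) x : ℝ) : ℂ) *
        (kundtFrame ς H W h).e 2 x b := by
    rw [← h3, Finset.sum_mul]
    exact Finset.sum_congr rfl fun c _ => by simp [mul_assoc]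
  rw [h5]
  by_cases hb : b = 0
  · subst hb; simp [kundtFrame_e_two]
  · simp [hd.pd_metric_eq_zero hx hb ha]

lemma rot_zero_eq_zero (hU : IsOpen U) (hς : ς = 1 ∨ ς = -1) {B C : Fin 4} {x : Coord} (hx : x ∈ U)
    (hB : (kundtFrame ς H W h).e B x 0 = 0) (hC : (kundtFrame ς H W h).e C x 0 = 0) :
    rot (kundtMetric H W h) (kundtFrame ς H W h) 0 B C x = 0 := by
  refine Finset.sum_eq_zero fun a _ => Finset.sum_eq_zero fun b _ => ?_
  rw [hd.covD_low_zero hU hς a b hx]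
  by_cases ha : a = 0
  · subst ha; simp [hB]
  by_cases hb : b = 0
  · subst hb; simp [hC]
  simp [hd.pd_metric_eq_zero hx hb ha]

theorem isKinematicFrame_kundtFrame (hU : IsOpen U) (hς : ς = 1 ∨ ς = -1) :
    IsKinematicFrame ς U (kundtMetric H W h) (kundtFrame ς H W h) where
  null := hd.isNullTetrad_kundtFrame hς
  kappa_eq x hx := hd.rot_zero_eq_zero hU hς hx (by simp [kundtFrame_e_two])
    (by simp [kundtFrame_e_zero])
  sigma_eq x hx := hd.rot_zero_eq_zero hU hς hx (by simp [kundtFrame_e_two])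
    (by simp [kundtFrame_e_two])
  rho_eq x hx := hd.rot_zero_eq_zero hU hς hx (by simp [kundtFrame_e_two])
    (by simp [kundtFrame_e_three])
  epsilon_eq x hx := by
    have h1 : rot (kundtMetric H W h) (kundtFrame ς H W h) 0 1 0 x = 0 := by
      refine Finset.sum_eq_zero fun a _ => Finset.sum_eq_zero fun b _ => ?_
      rw [hd.covD_low_zero hU hς a b hx, kundtFrame_e_zero]
      by_cases hb : b = 1
      · subst hb; simp [pd_metric_row]
      · simp [hb]
    have h2 : rot (kundtMetric H W h) (kundtFrame ς H W h) 2 3 0 x = 0 := by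
      refine Finset.sum_eq_zero fun a _ => Finset.sum_eq_zero fun b _ => ?_
      rw [kundtFrame_e_zero]
      by_cases hb : b = 1
      · subst hb
        by_cases ha : a = 0
        · subst ha; simp [kundtFrame_e_three]
        · simp [hd.covD_low_two hU hς ha hx]
      · simp [hb]
    rw [epsilon, h1, h2]; simp

end IsKundtData

end Kundt

end

/-! ### The criterion for the Kundt line element and the theorem. -/

noncomputable section

namespace Kundt

namespace IsKundtData

variable {U : Set Coord} {ς : ℝ} {H : Coord → ℝ} {W : Fin 2 → Coord → ℝ}
  {h : Coord → Matrix (Fin 2) (Fin 2) ℝ} (hd : IsKundtData ς U H W h)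
include hd

lemma isKundtGeometry (hU : IsOpen U) (hς : ς = 1 ∨ ς = -1) {F : Tetrad}
    (hF : IsNullTetrad ς U (kundtMetric H W h) F) :
    IsKundtGeometry (pdD hU) (metricR U (kundtMetric H W h))
      ((frameR U F)ᵀ * eta (sgnR U ς) * frameR U F) (connR U (kundtMetric H W h)) := by
  have hς0 : ς ≠ 0 := by rcases hς with rfl | rfl <;> norm_num
  have hg := hd.isLorentzMetric hς
  refine { hg.isLeviCivita hU hς0 with inv := ?_, row := fun b => ?_, transverse := ?_ }
  -- The inverse metric is taken in the form `Eᵀ η E`; with it `g * gi = 1` is the inverse frame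
  -- formula, bracketed differently.
  · have h1 := hF.frameInv_mul hς hg
    rwa [frameInvR, Matrix.mul_assoc, Matrix.mul_assoc, ← Matrix.mul_assoc (frameR U F)ᵀ] at h1
  · refine SmoothFun.ext_evalAt fun x => ?_
    rw [hg.evalAt_metricR, kundtMetric_row]
    split_ifs <;> simp
  · intro i j hi hj
    rw [metricR, Matrix.of_apply, pdD_resR hU 1 (hd.smooth_metric i j)]
    refine SmoothFun.ext_evalAt fun x => ?_
    rw [evalAt_resR x (contDiffOn_pd hU (hd.smooth_metric i j) 1),
      hd.pd_metric_eq_zero x.2 hi hj, map_zero, Complex.ofReal_zero]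

end IsKundtData

lemma resR_eq_zero_iff {U : Set Coord} {f : Coord → ℝ} (hf : ContDiffOn ℝ ∞ f U) :
    resR U f = 0 ↔ ∀ x ∈ U, f x = 0 := by
  refine ⟨fun h x hx => ?_, fun h => SmoothFun.ext_evalAt fun x => ?_⟩
  · have h1 := evalAt_resR ⟨x, hx⟩ hf
    rw [h, map_zero] at h1
    exact_mod_cast h1.symm
  · rw [evalAt_resR x hf, h x x.2, map_zero, Complex.ofReal_zero]

namespace IsKundtData

variable {U : Set Coord} {ς : ℝ} {H : Coord → ℝ} {W : Fin 2 → Coord → ℝ}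
  {h : Coord → Matrix (Fin 2) (Fin 2) ℝ} (hd : IsKundtData ς U H W h)
include hd

lemma degenerateData_iff (hU : IsOpen U) : DegenerateData U H W ↔
    (∀ i, i ≠ 0 → pdD hU 1 (pdD hU 1 (metricR U (kundtMetric H W h) 0 i)) = 0) ∧
      pdD hU 1 (pdD hU 1 (pdD hU 1 (metricR U (kundtMetric H W h) 0 0))) = 0 := by
  have hs := hd.smooth_metric
  have h2 : ∀ f : Coord → ℝ, ContDiffOn ℝ ∞ f U → (pdD hU 1 (pdD hU 1 (resR U f)) = 0 ↔
      ∀ x ∈ U, pd 1 (pd 1 f) x = 0) := fun f hf => by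
    rw [pdD_resR hU 1 hf, pdD_resR hU 1 (contDiffOn_pd hU hf 1),
      resR_eq_zero_iff (contDiffOn_pd hU (contDiffOn_pd hU hf 1) 1)]
  have h3 : pdD hU 1 (pdD hU 1 (pdD hU 1 (resR U H))) = 0 ↔
      ∀ x ∈ U, pd 1 (pd 1 (pd 1 H)) x = 0 := by
    rw [pdD_resR hU 1 hd.smooth_H, h2 _ (contDiffOn_pd hU hd.smooth_H 1)]
  -- The entry `g_{uu}` is `2H`; the factor 2 is removed again in `h4`.
  have e0 : metricR U (kundtMetric H W h) 0 0 = (2 : ℝ) • resR U H :=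
    SmoothFun.ext_evalAt fun x => by
      rw [Algebra.smul_def, map_mul, evalAt_algebraMap, evalAt_resR x hd.smooth_H, metricR,
        Matrix.of_apply, evalAt_resR x (hs 0 0)]
      simp [kundtMetric]
  have e1 : metricR U (kundtMetric H W h) 0 1 = 1 :=
    SmoothFun.ext_evalAt fun x => by
      rw [metricR, Matrix.of_apply, evalAt_resR x (hs 0 1), map_one]
      simp [kundtMetric]
  have e2 : metricR U (kundtMetric H W h) 0 2 = resR U (W 0) := rfl
  have e3 : metricR U (kundtMetric H W h) 0 3 = resR U (W 1) := rfl
  have h4 : pdD hU 1 (pdD hU 1 (pdD hU 1 (metricR U (kundtMetric H W h) 0 0))) = 0 ↔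
      ∀ x ∈ U, pd 1 (pd 1 (pd 1 H)) x = 0 := by
    simp only [e0, Derivation.map_smul]
    rw [← h3]
    refine ⟨fun h => ?_, fun h => by rw [h, smul_zero]⟩
    have := congrArg (fun t => (2⁻¹ : ℝ) • t) h
    simpa [smul_smul] using this
  rw [h4, DegenerateData]
  refine and_congr ⟨fun h i hi => ?_, fun h i => ?_⟩ Iff.rfl
  · fin_cases i
    · exact absurd rfl hi
    · change pdD hU 1 (pdD hU 1 (metricR U (kundtMetric H W _) 0 1)) = 0
      rw [e1]; simp
    · exact (h2 _ (hd.smooth_W 0)).2 (h 0)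
    · exact (h2 _ (hd.smooth_W 1)).2 (h 1)
  · fin_cases i
    · exact (h2 _ (hd.smooth_W 0)).1 (h 2 (by decide))
    · exact (h2 _ (hd.smooth_W 1)).1 (h 3 (by decide))

theorem typeII_iff_degenerateData (hU : IsOpen U) (hς : ς = 1 ∨ ς = -1) {F : Tetrad}
    (hF : IsKinematicFrame ς U (kundtMetric H W h) F) (hv : F.AlignedWithV U) :
    (TypeII U F (nablaRiem (kundtMetric H W h) 0) ∧ TypeII U F (nablaRiem (kundtMetric H W h) 1)) ↔
      DegenerateData U H W := by
  have hς0 : ς ≠ 0 := by rcases hς with rfl | rfl <;> norm_num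
  have hg := hd.isLorentzMetric hς
  have hG := hF.isKinematicGeometry hU hς hg
  rw [← hg.lowCurv_eq hU hς0] at hG
  rw [hF.null.typeII_iff (hg.smooth_nablaRiem hU hς0 0),
    hF.null.typeII_iff (hg.smooth_nablaRiem hU hς0 1), hF.null.trans_nablaRiem hU hς hg,
    hF.null.trans_nablaRiem hU hς hg, hd.degenerateData_iff hU, ← hg.lowCurv_eq hU hς0]
  refine Kundt.kundt_iff (hd.isKundtGeometry hU hς hF.null) (hF.null.frameInv_mul hς hg)
    (hF.null.frame_metric hg) (by simp [sgnR]) (fun a => SmoothFun.ext_evalAt fun x => ?_) hG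
  rw [hF.null.evalAt_frameR]
  simp only [Tetrad.e, Matrix.cons_val_zero, hv x x.2, Pi.single_apply]
  split_ifs <;> simp

end IsKundtData

end Kundt

end

theorem theorem4p1 (ς : ℝ) (hς : ς = 1 ∨ ς = -1) (U : Set Kundt.Coord) (hU : IsOpen U) :
    -- `K_1` implies `K_n`
    (∀ g : Kundt.MetricField, Kundt.IsLorentzMetric ς U g →
      Kundt.InK ς U g 1 → ∀ n : ℕ, 2 ≤ n → Kundt.InK ς U g n) ∧
    -- and every kinematic frame that shows `K_1` shows `K_n`
    (∀ g : Kundt.MetricField, Kundt.IsLorentzMetric ς U g →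
      ∀ F : Kundt.Tetrad, Kundt.IsKinematicFrame ς U g F →
        Kundt.TypeII U F (Kundt.nablaRiem g 0) → Kundt.TypeII U F (Kundt.nablaRiem g 1) →
          ∀ n : ℕ, Kundt.TypeII U F (Kundt.nablaRiem g n)) ∧
    -- the version for the Kundt line element
    (∀ (H : Kundt.Coord → ℝ) (W : Fin 2 → Kundt.Coord → ℝ)
      (h : Kundt.Coord → Matrix (Fin 2) (Fin 2) ℝ), Kundt.IsKundtData ς U H W h →
      Kundt.IsLorentzMetric ς U (Kundt.kundtMetric H W h) ∧
      (∃ F : Kundt.Tetrad, F.AlignedWithV U ∧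
        Kundt.IsKinematicFrame ς U (Kundt.kundtMetric H W h) F) ∧
      ∀ F : Kundt.Tetrad, F.AlignedWithV U →
        Kundt.IsKinematicFrame ς U (Kundt.kundtMetric H W h) F →
        ((Kundt.TypeII U F (Kundt.nablaRiem (Kundt.kundtMetric H W h) 0) ∧
            Kundt.TypeII U F (Kundt.nablaRiem (Kundt.kundtMetric H W h) 1)) ↔
          Kundt.DegenerateData U H W) ∧
        (Kundt.DegenerateData U H W →
          ∀ n : ℕ, Kundt.TypeII U F (Kundt.nablaRiem (Kundt.kundtMetric H W h) n))) := by
  refine ⟨fun g hg ⟨F, hF, hT⟩ n _ => ⟨F, hF, fun k _ =>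
      hF.typeII_nablaRiem hU hς hg (hT 0 zero_le_one) (hT 1 le_rfl) k⟩,
    fun g hg F hF h0 h1 n => hF.typeII_nablaRiem hU hς hg h0 h1 n,
    fun H W h hd => ⟨hd.isLorentzMetric hς, ⟨Kundt.kundtFrame ς H W h,
      Kundt.kundtFrame_alignedWithV, hd.isKinematicFrame_kundtFrame hU hς⟩, fun F hv hF => ?_⟩⟩
  have h1 := hd.typeII_iff_degenerateData hU hς hF hv
  exact ⟨h1, fun hD n => hF.typeII_nablaRiem hU hς (hd.isLorentzMetric hς) (h1.2 hD).1 (h1.2 hD).2 n⟩
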